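/- Let $F$ be a nonarchimedean local field of odd residual characteristic, with ring of integers $\mathcal O_F$, maximal ideal $P_F$ and residue field of cardinality $q$. Let $E/F$ be the unramified quadratic extension, with maximal ideal $P_E$, nontrivial automorphism $x\mapsto\bar x$, and ring of integers $\mathcal O_E$; let $\varpi$ be a uniformizer of $F$ (hence of $E$). Let $E^1=\{\lambda\in E^\times:\lambda\bar\lambda=1\}$, $E^1_1=E^1\cap(1+P_E)$, $E^1_0=E^1\cap F^\times(1+P_E)$, $E^0=\{y\in E: y+\bar y=0\}$. Let $D=E\oplus E\delta$ be the quaternion division algebra over $F$ with $\delta^2=\varpi$ and $\delta a=\bar a\delta$ for $a\in E$, let $\mathcal O_D=\mathcal O_E\oplus\mathcal O_E\delta$, $P_D^k=\mathcal O_D\delta^k$ ($k\in\mathbb Z$), let $D^0$ be the set of elements of $D$ of reduced trace $0$, let $D^1$ be the group of elements of reduced norm $1$, and let $D^1_k=\{x\in D^1: x-1\in P_D^k\}$. Let $$U(2)=\{x\in GL_2(E): x\,\mathrm{diag}(1,-\varpi)\,\bar x^{t}=\mathrm{diag}(1,-\varpi)\}=D^1\rtimes E^1,$$ where $a+c\delta\in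 D^1$ is identified with $\begin{pmatrix}a&c\\ \varpi\bar c&\bar a\end{pmatrix}$ and $b\in E^1$ (the semidirect factor) with $\mathrm{diag}(1,b)$. For subgroups $A,B$ of $E^1$ write $AD^1_k\rtimes B$ for the group of products of $a\in A\subset E^1\subset D^1$, $x\in D^1_k$ and $b\in B$ (in the semidirect factor). Let $\psi$ be an additive character of $F$ that is trivial on $P_F$ and nontrivial on $\mathcal O_F$. Let $n\ge 1$ and $r=\lfloor (n+2)/2\rfloor$. Let $\beta\in D^0$ have valuation $v_D(\beta)=-n$, and suppose that $\beta\in E^0+P_D^{1-r}$ (for example $\beta\in E^0$). Put $\psi_\beta(x)=\psi(\mathrm{Tr}_{D/F}(\beta(x-1)))$ for $x\in D^1_r$. Let $\gamma$ and $\zeta$ be continuous characters of $E^1$ such that $\gamma=\psi_\beta$ on $E^1\cap D^1_r$, and let $\gamma_{(\beta,\zeta)}$ be the character $(\lambda x,b)\mapsto\gamma(\lambda)\psi_\beta(x)\zeta(b)$ of $E^1D^1_r\rtimes E^1$. Let $n$ and $r$ both be even. Let $f$ and $g$ be the characters of the representations of $E^1D^1_{r-1}\rtimes E^1_1$ induced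 from the restrictions of $\gamma_{(\beta,\zeta)}$ to $E^1D^1_r\rtimes E^1_1$ and to $E^1_0D^1_r\rtimes E^1_1$, respectively. Then: (1) Up to equivalence there is a unique $q$-dimensional irreducible smooth representation $\tau^1=\tau^1_{(\beta,\gamma,\zeta)}$ of $E^1D^1_{r-1}\rtimes E^1$ whose restriction to $E^1D^1_{r-1}\rtimes E^1_1$ has character $2q^{-1}g-f$ and in whose restriction to the semidirect factor $E^1$ the character $\zeta$ does not occur. (2) The induced representation $\mathrm{Ind}(U(2),E^1D^1_{r-1}\rtimes E^1;\tau^1)$ is smooth and irreducible. More generally, the same holds for every $q$-dimensional irreducible smooth representation of $E^1D^1_{r-1}\rtimes E^1$ whose restriction to $E^1D^1_{r-1}\rtimes E^1_1$ has character $2q^{-1}g-f$. -/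

import Mathlib

open ValuativeRel

namespace HeisenbergU2
set_option linter.unusedSectionVars false

section Fields
variable {F E : Type*} [Field F] [ValuativeRel F] [TopologicalSpace F]
  [IsNonarchimedeanLocalField F] [Field E] [ValuativeRel E] [TopologicalSpace E]
  [IsNonarchimedeanLocalField E] [Algebra F E] [ValuativeExtension F E]
  [Algebra.IsQuadraticExtension F E]

lemma conj_conj (σ : E ≃ₐ[F] E) (x : E) : σ (σ x) = x := by
  have h2 : Module.finrank F E = 2 := Algebra.IsQuadraticExtension.finrank_eq_two F E
  classical
  have hc : Fintype.card (E ≃ₐ[F] E) ≤ 2 := h2 ▸ AlgEquiv.card_le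
  have : σ * σ = 1 := by
    by_contra h
    have h1 : σ ≠ 1 := by rintro rfl; simp at h
    have h3 : σ * σ ≠ σ := by simpa using h1
    have : ({1, σ, σ * σ} : Finset (E ≃ₐ[F] E)).card = 3 := by
      rw [Finset.card_eq_three]
      exact ⟨1, σ, σ * σ, h1.symm, Ne.symm h, Ne.symm h3, rfl⟩
    have := (Finset.card_le_univ ({1, σ, σ * σ} : Finset (E ≃ₐ[F] E)))
    omega
  exact DFunLike.congr_fun this x

lemma mem_range_of_fixed {σ : E ≃ₐ[F] E} (hσ : σ ≠ 1) {x : E} (hx : σ x = x) :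
    ∃ a : F, algebraMap F E a = x := by
  have h2 : (Module.finrank F E).Prime := by
    rw [Algebra.IsQuadraticExtension.finrank_eq_two F E]; exact Nat.prime_two
  have := IntermediateField.isSimpleOrder_of_finrank_prime F E h2
  let K : IntermediateField F E := IntermediateField.fixedField (Subgroup.zpowers σ)
  have hK : K ≠ ⊤ := by
    intro h
    apply hσ
    ext y
    have : y ∈ K := h ▸ IntermediateField.mem_top
    exact this ⟨σ, Subgroup.mem_zpowers σ⟩
  have hb : K = ⊥ := (IsSimpleOrder.eq_bot_or_eq_top K).resolve_right hK
  have hxK : x ∈ K := by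
    rintro ⟨g, hg⟩
    obtain ⟨k, rfl⟩ := Subgroup.mem_zpowers_iff.mp hg
    have : σ ∈ MulAction.stabilizer (E ≃ₐ[F] E) x := hx
    exact Subgroup.zpow_mem _ this k
  rw [hb] at hxK
  exact IntermediateField.mem_bot.mp hxK

lemma val_le_one_iff (a : F) : valuation E (algebraMap F E a) ≤ 1 ↔ valuation F a ≤ 1 := by
  have := ValuativeExtension.vle_iff_vle (A := F) (B := E) a 1
  simpa [Valuation.Compatible.vle_iff_le (v := valuation E), Valuation.Compatible.vle_iff_le (v := valuation F)] using this

lemma val_lt_one_iff (a : F) : valuation E (algebraMap F E a) < 1 ↔ valuation F a < 1 := by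
  have := ValuativeExtension.vle_iff_vle (A := F) (B := E) 1 a
  rw [map_one, Valuation.Compatible.vle_iff_le (v := valuation E), Valuation.Compatible.vle_iff_le (v := valuation F)] at this
  simpa using this.not

lemma exists_root (t : F) (ht : valuation F t < 1) : ∃ y : F, y ^ 2 - y + t = 0 := by
  let := IsTopologicalAddGroup.rightUniformSpace F
  have := isUniformAddGroup_of_addCommGroup (G := F)
  let t' : 𝒪[F] := ⟨t, ht.le⟩
  have htm : t' ∈ 𝓂[F] := by
    rw [IsLocalRing.mem_maximalIdeal, mem_nonunits_iff, Valuation.Integers.isUnit_iff_valuation_eq_one (Valuation.integer.integers (valuation F))]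
    exact ht.ne
  open Polynomial in
  obtain ⟨a, ha, -⟩ := HenselianRing.is_henselian (R := 𝒪[F]) (I := 𝓂[F]) (X ^ 2 - X + C t') (by monicity!) 0 (by simpa using htm) (by simp)
  refine ⟨a, ?_⟩
  have := congrArg (Subtype.val) (show a ^ 2 - a + t' = 0 by simpa using ha)
  simpa using this


lemma val_norm_one_aux (σ : E ≃ₐ[F] E) {x : E} (hx : x * σ x = 1) : valuation E x ≤ 1 := by
  by_contra hlt
  rw [not_le] at hlt
  have hx0 : x ≠ 0 := left_ne_zero_of_mul_eq_one hx
  have key : σ x = x → False := by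
    intro h
    rw [h] at hx
    have h1 : valuation E x * valuation E x = 1 := by rw [← map_mul, hx, map_one]
    exact absurd h1 (one_lt_mul'' hlt hlt).ne'
  have hσ : σ ≠ 1 := by
    rintro rfl
    exact key rfl
  have hv : valuation E x * valuation E (σ x) = 1 := by rw [← map_mul, hx, map_one]
  have hvσ : valuation E (σ x) < 1 := by
    by_contra h
    rw [not_lt] at h
    exact absurd hv (one_lt_mul_of_lt_of_le' hlt h).ne'
  obtain ⟨a, ha⟩ := mem_range_of_fixed hσ (x := x + σ x) (by rw [map_add, conj_conj, add_comm])
  have hva : valuation E (algebraMap F E a) = valuation E x := by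
    rw [ha]; exact Valuation.map_add_eq_of_lt_left _ (hvσ.trans hlt)
  have ha0 : a ≠ 0 := by
    rintro rfl
    rw [map_zero, map_zero] at hva
    exact hx0 ((valuation E).zero_iff.mp hva.symm)
  have ht : valuation F (a⁻¹ ^ 2) < 1 := by
    rw [← val_lt_one_iff (E := E), map_pow, map_pow, map_inv₀, map_inv₀, hva]
    exact pow_lt_one₀ zero_le (inv_lt_one_of_one_lt₀ hlt) two_ne_zero
  obtain ⟨y, hy⟩ := exists_root _ ht
  have hz : (a * y) ^ 2 - a * (a * y) + 1 = 0 := by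
    have : (a * y) ^ 2 - a * (a * y) + 1 = a ^ 2 * (y ^ 2 - y + a⁻¹ ^ 2) := by
      field_simp
    rw [this, hy, mul_zero]
  have hz' := congrArg (algebraMap F E) hz
  simp only [map_add, map_sub, map_mul, map_pow, map_one, map_zero, ha] at hz'
  have hf : (algebraMap F E (a * y) - x) * (algebraMap F E (a * y) - σ x) = 0 := by
    rw [map_mul, ha]
    linear_combination hz' + hx
  rcases mul_eq_zero.mp hf with h | h
  · apply key
    rw [← sub_eq_zero.mp h, AlgEquiv.commutes]
  · apply key
    have h3 := sub_eq_zero.mp h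
    have h4 := congrArg σ h3
    rw [AlgEquiv.commutes, conj_conj] at h4
    rw [← h3, h4]

lemma val_norm_one (σ : E ≃ₐ[F] E) {x : E} (hx : x * σ x = 1) : valuation E x = 1 := by
  have h1 := val_norm_one_aux σ hx
  have h2 := val_norm_one_aux σ (x := σ x) (by rw [conj_conj, mul_comm, hx])
  have hv : valuation E x * valuation E (σ x) = 1 := by rw [← map_mul, hx, map_one]
  by_contra h
  exact absurd hv (mul_lt_one_of_lt_of_le (lt_of_le_of_ne h1 h) h2).ne

lemma val_conj (σ : E ≃ₐ[F] E) (x : E) : valuation E (σ x) = valuation E x := by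
  by_cases hx : x = 0
  · simp [hx]
  have hσx : σ x ≠ 0 := by simpa using hx
  have := val_norm_one σ (x := σ x / x) (by rw [map_div₀, conj_conj]; field_simp)
  rw [map_div₀] at this
  exact (div_eq_one_iff_eq (by simpa using hx)).mp this


lemma algebraMap_trace {σ : E ≃ₐ[F] E} (hσ : σ ≠ 1) (x : E) :
    algebraMap F E (Algebra.trace F E x) = x + σ x := by
  classical
  have h2 : Module.finrank F E = 2 := Algebra.IsQuadraticExtension.finrank_eq_two F E
  have hc : Fintype.card (E ≃ₐ[F] E) ≤ 2 := h2 ▸ AlgEquiv.card_le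
  have hp : ({1, σ} : Finset (E ≃ₐ[F] E)).card = 2 := Finset.card_pair hσ.symm
  have hu : (Finset.univ : Finset (E ≃ₐ[F] E)) = {1, σ} :=
    (Finset.eq_of_subset_of_card_le (Finset.subset_univ _) (by rw [hp]; exact hc)).symm
  have : IsGalois F E := by
    apply IsGalois.of_card_aut_eq_finrank
    rw [h2, Nat.card_eq_fintype_card, ← Finset.card_univ, hu, hp]
  rw [trace_eq_sum_automorphisms, hu, Finset.sum_pair hσ.symm]
  rfl

end Fields

section Groups

open scoped MatrixGroups

variable (F E : Type*) [Field F] [ValuativeRel F] [TopologicalSpace F]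
  [IsNonarchimedeanLocalField F] [Field E] [ValuativeRel E] [TopologicalSpace E]
  [IsNonarchimedeanLocalField E] [Algebra F E] [ValuativeExtension F E]
  [Algebra.IsQuadraticExtension F E]

/-- A uniformizer of `F` that is still a uniformizer of `E`. It exists exactly when `E / F` is
unramified, and every uniformizer of `F` is then of this kind. -/
structure UnramifiedUniformizer where
  val : F
  ne_zero : val ≠ 0
  lt_one : valuation F val < 1
  le_base : ∀ x : F, valuation F x < 1 → valuation F x ≤ valuation F val
  le_ext : ∀ x : E, valuation E x < 1 → valuation E x ≤ valuation E (algebraMap F E val)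

variable {F E}

/-- The fractional ideal `P_E^k`, for `k : ℤ`. -/
def PE (ϖ : UnramifiedUniformizer F E) (k : ℤ) : Set E :=
  {x | valuation E x ≤ valuation E (algebraMap F E ϖ.val) ^ k}

/-- The quaternion division algebra `D = E ⊕ E δ`, where `δ² = ϖ` and `δ a = σ(a) δ`, realised in
`M₂(E)` by its right multiplication on the left `E`-space `D` with basis `1, δ`: the element
`a + c δ` is the matrix `!![a, c; ϖ σ(c), σ(a)]`. Its reduced norm is the determinant. -/
def quat (σ : E ≃ₐ[F] E) (ϖ : UnramifiedUniformizer F E) :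
    Subalgebra F (Matrix (Fin 2) (Fin 2) E) where
  carrier := {M | M 1 1 = σ (M 0 0) ∧ M 1 0 = algebraMap F E ϖ.val * σ (M 0 1)}
  mul_mem' := by
    rintro M N ⟨h1, h2⟩ ⟨h3, h4⟩
    simp only [Set.mem_ofPred_eq, Matrix.mul_apply, Fin.sum_univ_two, map_add, map_mul, h1, h2, h3,
      h4, AlgEquiv.commutes, conj_conj]
    constructor <;> ring
  add_mem' := by
    rintro M N ⟨h1, h2⟩ ⟨h3, h4⟩
    simp only [Set.mem_ofPred_eq, Matrix.add_apply, map_add, h1, h2, h3, h4]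
    exact ⟨trivial, by ring⟩
  algebraMap_mem' a := by
    simp [Matrix.algebraMap_matrix_apply]

/-- The uniformizer `δ` of `D`. -/
def delta (ϖ : UnramifiedUniformizer F E) : GL (Fin 2) E where
  val := !![0, 1; algebraMap F E ϖ.val, 0]
  inv := !![0, (algebraMap F E ϖ.val)⁻¹; 1, 0]
  val_inv := by
    have : algebraMap F E ϖ.val ≠ 0 := by simpa using ϖ.ne_zero
    rw [Matrix.mul_fin_two, Matrix.one_fin_two]
    simp only [mul_inv_cancel₀ this, mul_zero, mul_one, add_zero, zero_add, zero_mul]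
  inv_val := by
    have : algebraMap F E ϖ.val ≠ 0 := by simpa using ϖ.ne_zero
    rw [Matrix.mul_fin_two, Matrix.one_fin_two]
    simp only [inv_mul_cancel₀ this, mul_zero, mul_one, add_zero, zero_add, zero_mul]

/-- The ring of integers `O_D = O_E ⊕ O_E δ`. -/
def OD (σ : E ≃ₐ[F] E) (ϖ : UnramifiedUniformizer F E) : Set (Matrix (Fin 2) (Fin 2) E) :=
  {M | M ∈ quat σ ϖ ∧ valuation E (M 0 0) ≤ 1 ∧ valuation E (M 0 1) ≤ 1}

/-- `P_D^k = O_D δ^k`, for `k : ℤ`. -/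
def PD (σ : E ≃ₐ[F] E) (ϖ : UnramifiedUniformizer F E) (k : ℤ) :
    Set (Matrix (Fin 2) (Fin 2) E) :=
  {M | ∃ a ∈ OD σ ϖ, M = a * (delta ϖ ^ k : GL (Fin 2) E)}

lemma delta_sq_zpow (ϖ : UnramifiedUniformizer F E) (j : ℤ) :
    ((delta ϖ ^ (2 * j) : GL (Fin 2) E) : Matrix (Fin 2) (Fin 2) E) =
      !![(algebraMap F E ϖ.val) ^ j, 0; 0, (algebraMap F E ϖ.val) ^ j] := by
  have h0 : algebraMap F E ϖ.val ≠ 0 := by simpa using ϖ.ne_zero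
  have h : delta ϖ ^ (2 : ℤ) = Units.map (Matrix.scalar (Fin 2)).toMonoidHom (Units.mk0 _ h0) := by
    rw [zpow_ofNat, pow_two]
    ext i j
    fin_cases i <;> fin_cases j <;> simp [delta, Algebra.smul_def]
  rw [zpow_mul, h, ← map_zpow, Units.coe_map, Units.val_zpow_eq_zpow_val, Units.val_mk0]
  ext a b
  fin_cases a <;> fin_cases b <;> simp

lemma delta_mem (σ : E ≃ₐ[F] E) (ϖ : UnramifiedUniformizer F E) :
    ((delta ϖ : GL (Fin 2) E) : Matrix (Fin 2) (Fin 2) E) ∈ quat σ ϖ := by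
  change _ ∧ _
  simp [delta]

lemma delta_zpow_mem (σ : E ≃ₐ[F] E) (ϖ : UnramifiedUniformizer F E) (k : ℤ) :
    ((delta ϖ ^ k : GL (Fin 2) E) : Matrix (Fin 2) (Fin 2) E) ∈ quat σ ϖ := by
  have h2 : ∀ j : ℤ, ((delta ϖ ^ (2 * j) : GL (Fin 2) E) : Matrix (Fin 2) (Fin 2) E) ∈ quat σ ϖ := by
    intro j
    rw [delta_sq_zpow]
    change _ ∧ _
    simp
  obtain ⟨j, rfl | rfl⟩ := Int.even_or_odd' k
  · exact h2 j
  · rw [zpow_add, zpow_one, Units.val_mul]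
    exact mul_mem (h2 j) (delta_mem σ ϖ)

lemma val_unif_pos (ϖ : UnramifiedUniformizer F E) :
    0 < valuation E (algebraMap F E ϖ.val) := by
  rw [Valuation.pos_iff]
  simpa using ϖ.ne_zero

lemma mem_PD (σ : E ≃ₐ[F] E) (ϖ : UnramifiedUniformizer F E) (k : ℤ)
    (M : Matrix (Fin 2) (Fin 2) E) :
    M ∈ PD σ ϖ k ↔ M ∈ quat σ ϖ ∧ M 0 0 ∈ PE ϖ ((k + 1) / 2) ∧ M 0 1 ∈ PE ϖ (k / 2) := by
  have hp := val_unif_pos ϖ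
  have h1 : M ∈ PD σ ϖ k ↔ M * (delta ϖ ^ (-k) : GL (Fin 2) E) ∈ OD σ ϖ := by
    constructor
    · rintro ⟨a, ha, rfl⟩
      rw [mul_assoc, ← Units.val_mul, ← zpow_add, add_neg_cancel, zpow_zero, Units.val_one, mul_one]
      exact ha
    · intro h
      refine ⟨_, h, ?_⟩
      rw [mul_assoc, ← Units.val_mul, ← zpow_add, neg_add_cancel, zpow_zero, Units.val_one, mul_one]
  have h2 : M * (delta ϖ ^ (-k) : GL (Fin 2) E) ∈ quat σ ϖ ↔ M ∈ quat σ ϖ := by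
    constructor
    · intro h
      have := mul_mem h (delta_zpow_mem σ ϖ k)
      rwa [mul_assoc, ← Units.val_mul, ← zpow_add, neg_add_cancel, zpow_zero, Units.val_one,
        mul_one] at this
    · intro h
      exact mul_mem h (delta_zpow_mem σ ϖ (-k))
  have h3 : ∀ (x : E) (j : ℤ), valuation E (x * (algebraMap F E ϖ.val) ^ (-j)) ≤ 1 ↔ x ∈ PE ϖ j := by
    intro x j
    rw [map_mul, map_zpow₀, zpow_neg, mul_inv_le_iff₀ (zpow_pos hp j), one_mul]
    rfl
  rw [h1]
  change _ ∧ _ ∧ _ ↔ _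
  rw [h2]
  refine and_congr_right fun _ ↦ ?_
  obtain ⟨j, rfl | rfl⟩ := Int.even_or_odd' k
  · rw [← mul_neg, delta_sq_zpow, show (2 * j + 1) / 2 = j by omega, show 2 * j / 2 = j by omega]
    simp only [Matrix.mul_apply, Fin.sum_univ_two, Matrix.of_apply, Matrix.cons_val', Matrix.cons_val_zero,
      Matrix.cons_val_one, Matrix.cons_val_fin_one, mul_zero, zero_add, add_zero, h3]
  · have h4 : ((delta ϖ ^ (-(2 * j + 1)) : GL (Fin 2) E) : Matrix (Fin 2) (Fin 2) E) =
        !![0, (algebraMap F E ϖ.val) ^ (-(j + 1)); (algebraMap F E ϖ.val) ^ (-j), 0] := by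
      have h0 : algebraMap F E ϖ.val ≠ 0 := by simpa using ϖ.ne_zero
      rw [show -(2 * j + 1) = 2 * (-(j + 1)) + 1 by ring, zpow_add, zpow_one, Units.val_mul,
        delta_sq_zpow]
      have : (algebraMap F E ϖ.val) ^ (-j) =
          (algebraMap F E ϖ.val) ^ (-(j + 1)) * algebraMap F E ϖ.val := by
        rw [← zpow_add_one₀ h0]; congr 1; ring
      rw [this]
      simp [delta]
    rw [h4, show (2 * j + 1 + 1) / 2 = j + 1 by omega, show (2 * j + 1) / 2 = j by omega]
    simp only [Matrix.mul_apply, Fin.sum_univ_two, Matrix.of_apply, Matrix.cons_val', Matrix.cons_val_zero,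
      Matrix.cons_val_one, Matrix.cons_val_fin_one, mul_zero, zero_add, add_zero, h3]
    exact and_comm


lemma PE_add {ϖ : UnramifiedUniformizer F E} {k : ℤ} {x y : E} (hx : x ∈ PE ϖ k) (hy : y ∈ PE ϖ k) :
    x + y ∈ PE ϖ k :=
  show valuation E (x + y) ≤ _ from (Valuation.map_add _ x y).trans (max_le hx hy)

lemma PE_anti {ϖ : UnramifiedUniformizer F E} {j k : ℤ} (h : j ≤ k) {x : E} (hx : x ∈ PE ϖ k) :
    x ∈ PE ϖ j :=
  le_trans (show valuation E x ≤ _ from hx)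
    (zpow_le_zpow_right_of_le_one₀ (val_unif_pos ϖ) ((val_lt_one_iff _).mpr ϖ.lt_one).le h)

lemma PE_mul {ϖ : UnramifiedUniformizer F E} {j k : ℤ} {x y : E} (hx : x ∈ PE ϖ j)
    (hy : y ∈ PE ϖ k) : x * y ∈ PE ϖ (j + k) := by
  change valuation E (x * y) ≤ _
  rw [map_mul, zpow_add₀ (val_unif_pos ϖ).ne']
  exact mul_le_mul' hx hy

lemma PD_sub_mem_quat {σ : E ≃ₐ[F] E} {ϖ : UnramifiedUniformizer F E} {k : ℤ}
    {M : Matrix (Fin 2) (Fin 2) E} (h : M ∈ PD σ ϖ k) : M ∈ quat σ ϖ :=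
  ((mem_PD σ ϖ k M).mp h).1

lemma PD_add {σ : E ≃ₐ[F] E} {ϖ : UnramifiedUniformizer F E} {k : ℤ}
    {M N : Matrix (Fin 2) (Fin 2) E} (hM : M ∈ PD σ ϖ k) (hN : N ∈ PD σ ϖ k) :
    M + N ∈ PD σ ϖ k := by
  rw [mem_PD] at *
  exact ⟨add_mem hM.1 hN.1, PE_add hM.2.1 hN.2.1, PE_add hM.2.2 hN.2.2⟩

lemma PD_anti {σ : E ≃ₐ[F] E} {ϖ : UnramifiedUniformizer F E} {j k : ℤ} (h : j ≤ k)
    {M : Matrix (Fin 2) (Fin 2) E} (hM : M ∈ PD σ ϖ k) : M ∈ PD σ ϖ j := by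
  rw [mem_PD] at *
  exact ⟨hM.1, PE_anti (by omega) hM.2.1, PE_anti (by omega) hM.2.2⟩

lemma PD_mul {σ : E ≃ₐ[F] E} {ϖ : UnramifiedUniformizer F E} {j k : ℤ}
    {M N : Matrix (Fin 2) (Fin 2) E} (hM : M ∈ PD σ ϖ j) (hN : N ∈ PD σ ϖ k) :
    M * N ∈ PD σ ϖ (j + k) := by
  rw [mem_PD] at *
  obtain ⟨hM0, hM1, hM2⟩ := hM
  obtain ⟨hN0, hN1, hN2⟩ := hN
  have hσ : ∀ {x : E} {l : ℤ}, x ∈ PE ϖ l → σ x ∈ PE ϖ l := fun {x l} hx ↦ by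
    change valuation E (σ x) ≤ _
    rw [val_conj]
    exact hx
  have hu : algebraMap F E ϖ.val ∈ PE ϖ 1 := by
    change valuation E (algebraMap F E ϖ.val) ≤ valuation E (algebraMap F E ϖ.val) ^ (1 : ℤ)
    rw [zpow_one]
  refine ⟨mul_mem hM0 hN0, ?_, ?_⟩
  · rw [Matrix.mul_apply, Fin.sum_univ_two, hN0.2]
    exact PE_add (PE_anti (by omega) (PE_mul hM1 hN1))
      (PE_anti (by omega) (PE_mul hM2 (PE_mul hu (hσ hN2))))
  · rw [Matrix.mul_apply, Fin.sum_univ_two, hN0.1]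
    exact PE_add (PE_anti (by omega) (PE_mul hM1 hN2)) (PE_anti (by omega) (PE_mul hM2 (hσ hN1)))

/-- The unitary group `U(2)` of the anisotropic Hermitian form with matrix `diag(1, -ϖ)`. -/
def U2 (σ : E ≃ₐ[F] E) (ϖ : UnramifiedUniformizer F E) : Subgroup (GL (Fin 2) E) where
  carrier := {g | (g : Matrix (Fin 2) (Fin 2) E) * !![1, 0; 0, -algebraMap F E ϖ.val] *
    ((g : Matrix (Fin 2) (Fin 2) E).map σ).transpose = !![1, 0; 0, -algebraMap F E ϖ.val]}
  one_mem' := by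
    simp
  mul_mem' := by
    intro g h hg hh
    simp only [Set.mem_ofPred_eq] at *
    rw [Units.val_mul, Matrix.map_mul, Matrix.transpose_mul]
    calc _ = (g : Matrix (Fin 2) (Fin 2) E) * ((h : Matrix (Fin 2) (Fin 2) E) *
          !![1, 0; 0, -algebraMap F E ϖ.val] *
          ((h : Matrix (Fin 2) (Fin 2) E).map σ).transpose) *
          ((g : Matrix (Fin 2) (Fin 2) E).map σ).transpose := by simp only [Matrix.mul_assoc]
      _ = _ := by rw [hh, hg]
  inv_mem' := by
    intro g hg
    simp only [Set.mem_ofPred_eq] at *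
    have h1 : ((g : Matrix (Fin 2) (Fin 2) E).map σ).transpose *
        (((g⁻¹ : GL (Fin 2) E) : Matrix (Fin 2) (Fin 2) E).map σ).transpose = 1 := by
      rw [← Matrix.transpose_mul, ← Matrix.map_mul, ← Units.val_mul, inv_mul_cancel]
      simp
    conv_lhs => rw [← hg]
    calc _ = ((g⁻¹ : GL (Fin 2) E) : Matrix (Fin 2) (Fin 2) E) * (g : Matrix (Fin 2) (Fin 2) E) *
          !![1, 0; 0, -algebraMap F E ϖ.val] *
          (((g : Matrix (Fin 2) (Fin 2) E).map σ).transpose *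
        (((g⁻¹ : GL (Fin 2) E) : Matrix (Fin 2) (Fin 2) E).map σ).transpose) := by
          simp only [Matrix.mul_assoc]
      _ = _ := by rw [h1, ← Units.val_mul, inv_mul_cancel]; simp

/-- The group `E¹` of elements of norm one. -/
def E1 (σ : E ≃ₐ[F] E) : Subgroup Eˣ where
  carrier := {u | (u : E) * σ u = 1}
  one_mem' := by simp
  mul_mem' := by
    intro u v hu hv
    simp only [Set.mem_ofPred_eq, Units.val_mul, map_mul] at *
    linear_combination (v : E) * σ v * hu + hv
  inv_mem' := by
    intro u hu
    simp only [Set.mem_ofPred_eq] at *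
    rw [Units.val_inv_eq_inv_val, map_inv₀, ← mul_inv, hu, inv_one]

/-- The group `1 + P_E`. -/
def oneUnits (E : Type*) [Field E] [ValuativeRel E] : Subgroup Eˣ where
  carrier := {u | valuation E ((u : E) - 1) < 1}
  one_mem' := by simp
  mul_mem' := by
    intro u v hu hv
    simp only [Set.mem_ofPred_eq, Units.val_mul] at *
    have : (u : E) * v - 1 = (u - 1) * (v - 1) + ((u - 1) + (v - 1)) := by ring
    rw [this]
    refine Valuation.map_add_lt _ ?_ (Valuation.map_add_lt _ hu hv)
    rw [map_mul]
    exact mul_lt_one_of_lt_of_le hu hv.le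
  inv_mem' := by
    intro u hu
    simp only [Set.mem_ofPred_eq] at *
    have h1 : valuation E (u : E) = 1 := by
      have := Valuation.map_one_add_of_lt (v := valuation E) hu
      rwa [add_sub_cancel] at this
    have : ((u⁻¹ : Eˣ) : E) - 1 = -((u : E)⁻¹ * (u - 1)) := by
      rw [Units.val_inv_eq_inv_val]
      field_simp
      ring
    rw [this, Valuation.map_neg, map_mul, map_inv₀, h1, inv_one, one_mul]
    exact hu

/-- `E¹_1 = E¹ ∩ (1 + P_E)`. -/
def E11 (σ : E ≃ₐ[F] E) : Subgroup (E1 σ) := (oneUnits E).subgroupOf (E1 σ)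

/-- `E¹_0 = E¹ ∩ Fˣ (1 + P_E)`. -/
def E10 (σ : E ≃ₐ[F] E) : Subgroup (E1 σ) :=
  ((Units.map (algebraMap F E).toMonoidHom).range ⊔ oneUnits E).subgroupOf (E1 σ)

/-- The diagonal matrix `diag(a, b)`, for `a, b ∈ E¹`. -/
def diagE1 (σ : E ≃ₐ[F] E) : E1 σ × E1 σ →* GL (Fin 2) E where
  toFun p :=
    { val := !![((p.1 : Eˣ) : E), 0; 0, ((p.2 : Eˣ) : E)]
      inv := !![((p.1 : Eˣ) : E)⁻¹, 0; 0, ((p.2 : Eˣ) : E)⁻¹]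
      val_inv := by
        rw [Matrix.mul_fin_two, Matrix.one_fin_two]
        simp only [mul_inv_cancel₀ (Units.ne_zero _), mul_zero, add_zero, zero_add, zero_mul]
      inv_val := by
        rw [Matrix.mul_fin_two, Matrix.one_fin_two]
        simp only [inv_mul_cancel₀ (Units.ne_zero _), mul_zero, add_zero, zero_add, zero_mul] }
  map_one' := by
    ext i j
    fin_cases i <;> fin_cases j <;> simp
  map_mul' p q := by
    ext i j
    fin_cases i <;> fin_cases j <;> simp

/-- The copy of `E¹` in `D¹`: the element `a` of `E ⊆ D` is `diag(a, σ(a)) = diag(a, a⁻¹)`. -/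
def torus (σ : E ≃ₐ[F] E) : E1 σ →* GL (Fin 2) E :=
  (diagE1 σ).comp ((MonoidHom.id _).prod invMonoidHom)

/-- The semidirect factor `E¹` of `U(2) = D¹ ⋊ E¹`, consisting of the matrices `diag(1, b)`. -/
def semi (σ : E ≃ₐ[F] E) : E1 σ →* GL (Fin 2) E :=
  (diagE1 σ).comp (MonoidHom.prod 1 (MonoidHom.id _))

/-- The group `D¹_k` of elements `x` of `D` of norm one such that `x - 1 ∈ P_D^k`. -/
def D1 (σ : E ≃ₐ[F] E) (ϖ : UnramifiedUniformizer F E) (k : ℕ) : Subgroup (GL (Fin 2) E) where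
  carrier := {g | (g : Matrix (Fin 2) (Fin 2) E) ∈ quat σ ϖ ∧
    (g : Matrix (Fin 2) (Fin 2) E).det = 1 ∧ (g : Matrix (Fin 2) (Fin 2) E) - 1 ∈ PD σ ϖ k}
  one_mem' := by
    refine ⟨one_mem _, by simp, ?_⟩
    rw [mem_PD]
    simp [PE, zero_mem]
  mul_mem' := by
    rintro g h ⟨hg0, hg1, hg2⟩ ⟨hh0, hh1, hh2⟩
    refine ⟨mul_mem hg0 hh0, by rw [Units.val_mul, Matrix.det_mul, hg1, hh1, mul_one], ?_⟩
    have : ((g * h : GL (Fin 2) E) : Matrix (Fin 2) (Fin 2) E) - 1 =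
        ((g : Matrix (Fin 2) (Fin 2) E) - 1) * ((h : Matrix (Fin 2) (Fin 2) E) - 1) +
        (((g : Matrix (Fin 2) (Fin 2) E) - 1) + ((h : Matrix (Fin 2) (Fin 2) E) - 1)) := by
      rw [Units.val_mul]; noncomm_ring
    rw [this]
    exact PD_add (PD_anti (by omega) (PD_mul hg2 hh2)) (PD_add hg2 hh2)
  inv_mem' := by
    rintro g ⟨hg0, hg1, hg2⟩
    have hinv : ((g⁻¹ : GL (Fin 2) E) : Matrix (Fin 2) (Fin 2) E) =
        !![g 1 1, -g 0 1; -g 1 0, g 0 0] := by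
      rw [Matrix.coe_units_inv, Matrix.inv_def, hg1, Matrix.adjugate_fin_two]
      simp
    rw [mem_PD] at hg2
    obtain ⟨-, h3, h4⟩ := hg2
    have hq : ((g⁻¹ : GL (Fin 2) E) : Matrix (Fin 2) (Fin 2) E) ∈ quat σ ϖ := by
      change _ ∧ _
      rw [hinv]
      simp [hg0.1, hg0.2, conj_conj]
    refine ⟨hq, ?_, ?_⟩
    · have := congrArg Matrix.det (Units.mul_inv g)
      rwa [Matrix.det_mul, hg1, one_mul, Matrix.det_one] at this
    · rw [mem_PD]
      refine ⟨sub_mem hq (one_mem _), ?_, ?_⟩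
      · rw [hinv]
        change valuation E _ ≤ _ at h3
        change valuation E _ ≤ _
        have : g 1 1 = σ (g 0 0) := hg0.1
        rw [← val_conj σ] at h3
        simpa [this] using h3
      · rw [hinv]
        change valuation E _ ≤ _ at h4
        change valuation E _ ≤ _
        simpa using h4

lemma D1_anti {σ : E ≃ₐ[F] E} {ϖ : UnramifiedUniformizer F E} {j k : ℕ} (h : j ≤ k) :
    D1 σ ϖ k ≤ D1 σ ϖ j :=
  fun _ hg ↦ ⟨hg.1, hg.2.1, PD_anti (by exact_mod_cast h) hg.2.2⟩

lemma diagE1_conj_coe {σ : E ≃ₐ[F] E} (p : E1 σ × E1 σ) (x : GL (Fin 2) E) :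
    ((diagE1 σ p * x * (diagE1 σ p)⁻¹ : GL (Fin 2) E) : Matrix (Fin 2) (Fin 2) E) =
      !![x 0 0, ((p.1 : Eˣ) : E) * x 0 1 * ((p.2 : Eˣ) : E)⁻¹;
        ((p.2 : Eˣ) : E) * x 1 0 * ((p.1 : Eˣ) : E)⁻¹, x 1 1] := by
  rw [← map_inv]
  ext i j
  fin_cases i <;> fin_cases j <;>
    simp [diagE1, Matrix.vecMul, dotProduct, Matrix.mul_apply, Fin.sum_univ_two] <;> field_simp

lemma E1_conj {σ : E ≃ₐ[F] E} (a : E1 σ) : σ ((a : Eˣ) : E) = ((a : Eˣ) : E)⁻¹ :=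
  eq_inv_of_mul_eq_one_right a.2

lemma diagE1_conj_mem {σ : E ≃ₐ[F] E} {ϖ : UnramifiedUniformizer F E} {k : ℕ} (p : E1 σ × E1 σ)
    {x : GL (Fin 2) E} (hx : x ∈ D1 σ ϖ k) : diagE1 σ p * x * (diagE1 σ p)⁻¹ ∈ D1 σ ϖ k := by
  obtain ⟨h0, h1, h2⟩ := hx
  have hq : ((diagE1 σ p * x * (diagE1 σ p)⁻¹ : GL (Fin 2) E) : Matrix (Fin 2) (Fin 2) E) ∈
      quat σ ϖ := by
    have e1 : x 1 1 = σ (x 0 0) := h0.1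
    have e2 : x 1 0 = algebraMap F E ϖ.val * σ (x 0 1) := h0.2
    change _ ∧ _
    rw [diagE1_conj_coe]
    simp [e1, e2, E1_conj]
    ring
  refine ⟨hq, ?_, ?_⟩
  · have : ((diagE1 σ p * x * (diagE1 σ p)⁻¹ : GL (Fin 2) E)).det = x.det := by
      rw [map_mul, map_mul, map_inv, mul_right_comm, mul_inv_cancel, one_mul]
    have := congrArg Units.val this
    exact this.trans h1
  · rw [mem_PD] at h2 ⊢
    refine ⟨sub_mem hq (one_mem _), ?_, ?_⟩
    · rw [diagE1_conj_coe]
      exact h2.2.1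
    · rw [diagE1_conj_coe]
      have h3 := h2.2.2
      change valuation E _ ≤ _ at h3
      change valuation E _ ≤ _
      simpa [val_norm_one σ p.1.2, val_norm_one σ p.2.2] using h3

/-- The group `A D¹_k ⋊ B`, for subgroups `A`, `B` of `E¹`: the first is placed in `D¹`, the second
in the semidirect factor. -/
def mixed (σ : E ≃ₐ[F] E) (ϖ : UnramifiedUniformizer F E) (A : Subgroup (E1 σ)) (k : ℕ)
    (B : Subgroup (E1 σ)) : Subgroup (GL (Fin 2) E) where
  carrier := {g | ∃ a ∈ A, ∃ x ∈ D1 σ ϖ k, ∃ b ∈ B, g = torus σ a * x * semi σ b}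
  one_mem' := ⟨1, one_mem _, 1, one_mem _, 1, one_mem _, by simp⟩
  mul_mem' := by
    rintro _ _ ⟨a, ha, x, hx, b, hb, rfl⟩ ⟨a', ha', x', hx', b', hb', rfl⟩
    refine ⟨a * a', mul_mem ha ha', ((torus σ a')⁻¹ * x * torus σ a') *
      (semi σ b * x' * (semi σ b)⁻¹), mul_mem ?_ ?_, b * b', mul_mem hb hb', ?_⟩
    · have := diagE1_conj_mem (a'⁻¹, a'⁻¹⁻¹) hx
      rw [← Prod.inv_mk, map_inv, inv_inv] at this
      exact this
    · exact diagE1_conj_mem (1, b) hx'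
    · have hc : semi σ b * torus σ a' = torus σ a' * semi σ b := by
        change diagE1 σ _ * diagE1 σ _ = diagE1 σ _ * diagE1 σ _
        rw [← map_mul, ← map_mul, mul_comm]
      rw [map_mul, map_mul]
      calc _ = torus σ a * x * (semi σ b * torus σ a') * x' * semi σ b' := by group
        _ = _ := by rw [hc]; group
  inv_mem' := by
    rintro _ ⟨a, ha, x, hx, b, hb, rfl⟩
    refine ⟨a⁻¹, inv_mem ha, diagE1 σ (a, a⁻¹ * b⁻¹) * x⁻¹ * (diagE1 σ (a, a⁻¹ * b⁻¹))⁻¹,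
      diagE1_conj_mem _ (inv_mem hx), b⁻¹, inv_mem hb, ?_⟩
    have h1 : diagE1 σ (a, a⁻¹ * b⁻¹) = torus σ a * (semi σ b)⁻¹ := by
      rw [← map_inv]
      change _ = diagE1 σ _ * diagE1 σ _
      rw [← map_mul]
      simp
    have h2 : torus σ a * (semi σ b)⁻¹ = (semi σ b)⁻¹ * torus σ a := by
      rw [← map_inv]
      change diagE1 σ _ * diagE1 σ _ = diagE1 σ _ * diagE1 σ _
      rw [← map_mul, ← map_mul, mul_comm]
    rw [h1, map_inv, map_inv]
    have h3 : (torus σ a * (semi σ b)⁻¹)⁻¹ = (torus σ a)⁻¹ * semi σ b := by rw [h2]; group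
    rw [h3]
    group


lemma mem_mixed_semi {σ : E ≃ₐ[F] E} {ϖ : UnramifiedUniformizer F E} (A : Subgroup (E1 σ)) (k : ℕ)
    {B : Subgroup (E1 σ)} {b : E1 σ} (hb : b ∈ B) : semi σ b ∈ mixed σ ϖ A k B :=
  ⟨1, one_mem _, 1, one_mem _, b, hb, by simp⟩

lemma mixed_mono {σ : E ≃ₐ[F] E} {ϖ : UnramifiedUniformizer F E} {A A' : Subgroup (E1 σ)}
    {k k' : ℕ} {B B' : Subgroup (E1 σ)} (hA : A ≤ A') (hk : k' ≤ k) (hB : B ≤ B') :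
    mixed σ ϖ A k B ≤ mixed σ ϖ A' k' B' := by
  rintro _ ⟨a, ha, x, hx, b, hb, rfl⟩
  exact ⟨a, hA ha, x, D1_anti hk hx, b, hB hb, rfl⟩

lemma diagE1_mem_U2 {σ : E ≃ₐ[F] E} (ϖ : UnramifiedUniformizer F E) (p : E1 σ × E1 σ) :
    diagE1 σ p ∈ U2 σ ϖ := by
  have h1 : ((p.1 : Eˣ) : E) * σ ((p.1 : Eˣ) : E) = 1 := p.1.2
  have h2 : ((p.2 : Eˣ) : E) * σ ((p.2 : Eˣ) : E) = 1 := p.2.2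
  change _ = _
  ext i j
  fin_cases i <;> fin_cases j <;>
    simp [diagE1, Matrix.mul_apply, Fin.sum_univ_two, h1]
  linear_combination (algebraMap F E ϖ.val) * h2

lemma D1_le_U2 (σ : E ≃ₐ[F] E) (ϖ : UnramifiedUniformizer F E) (k : ℕ) :
    D1 σ ϖ k ≤ U2 σ ϖ := by
  rintro g ⟨⟨h1, h2⟩, h3, -⟩
  rw [Matrix.det_fin_two, h1, h2] at h3
  change _ = _
  ext i j
  fin_cases i <;> fin_cases j <;>
    simp [Matrix.mul_apply, Fin.sum_univ_two, h1, h2, conj_conj]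
  · linear_combination h3
  · ring
  · ring
  · linear_combination (-algebraMap F E ϖ.val) * h3

lemma mixed_le_U2 (σ : E ≃ₐ[F] E) (ϖ : UnramifiedUniformizer F E) (A : Subgroup (E1 σ)) (k : ℕ)
    (B : Subgroup (E1 σ)) : mixed σ ϖ A k B ≤ U2 σ ϖ := by
  rintro _ ⟨a, -, x, hx, b, -, rfl⟩
  exact mul_mem (mul_mem (diagE1_mem_U2 ϖ _) (D1_le_U2 σ ϖ k hx)) (diagE1_mem_U2 ϖ _)

end Groups

section Characters

open scoped MatrixGroups

variable {F E : Type*} [Field F] [ValuativeRel F] [TopologicalSpace F]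
  [IsNonarchimedeanLocalField F] [Field E] [ValuativeRel E] [TopologicalSpace E]
  [IsNonarchimedeanLocalField E] [Algebra F E] [ValuativeExtension F E]
  [Algebra.IsQuadraticExtension F E]

variable (F) in
/-- The reduced trace of `D`: the element `a + c δ` has reduced trace `a + σ(a)`. -/
noncomputable def trd (M : Matrix (Fin 2) (Fin 2) E) : F := Algebra.trace F E (M 0 0)

/-- `ψ_β(x) = ψ(Tr(β (x - 1)))`. -/
noncomputable def psi (ψ : AddChar F ℂ) (β x : Matrix (Fin 2) (Fin 2) E) : ℂ :=
  ψ (trd F (β * (x - 1)))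

/-- The data from which the representations are built. -/
structure IsDatum (σ : E ≃ₐ[F] E) (ϖ : UnramifiedUniformizer F E) (ψ : AddChar F ℂ) (n r : ℕ)
    (β : Matrix (Fin 2) (Fin 2) E) (γ ζ : E1 σ →* ℂˣ) : Prop where
  /-- `σ` is the nontrivial automorphism of `E / F`. -/
  conj_ne_one : σ ≠ 1
  /-- The conductor of `ψ` is `P_F`. -/
  psi_eq_one : ∀ t : F, valuation F t < 1 → ψ t = 1
  psi_ne_one : ∃ t : F, valuation F t ≤ 1 ∧ ψ t ≠ 1
  one_le : 1 ≤ n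
  r_eq : r = (n + 2) / 2
  /-- `β` is a traceless element of `D` of valuation `-n`. -/
  mem_quat : β ∈ quat σ ϖ
  trd_eq_zero : trd F β = 0
  mem_PD : β ∈ PD σ ϖ (-n)
  not_mem_PD : β ∉ PD σ ϖ (-n + 1)
  /-- Modulo `P_D^(1-r)`, on which `ψ_β` does not depend, `β` is a traceless element of `E`. -/
  near : ∃ y : E, y + σ y = 0 ∧ β - !![y, 0; 0, σ y] ∈ PD σ ϖ (1 - r)
  /-- `γ` belongs to `Λ_β`. -/
  gamma_continuous : Continuous γ
  gamma_eq : ∀ a : E1 σ, torus σ a ∈ D1 σ ϖ r → (γ a : ℂ) = psi ψ β (torus σ a)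
  zeta_continuous : Continuous ζ

variable {σ : E ≃ₐ[F] E} {ϖ : UnramifiedUniformizer F E} {ψ : AddChar F ℂ} {n r : ℕ}
  {β : Matrix (Fin 2) (Fin 2) E} {γ ζ : E1 σ →* ℂˣ}

lemma psi_trd_eq_one (h : IsDatum σ ϖ ψ n r β γ ζ) {M : Matrix (Fin 2) (Fin 2) E}
    (hM : M ∈ PD σ ϖ 1) : ψ (trd F M) = 1 := by
  apply h.psi_eq_one
  rw [← val_lt_one_iff (E := E), trd, algebraMap_trace h.conj_ne_one]
  have h1 : valuation E (M 0 0) < 1 := by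
    have : valuation E (M 0 0) ≤ valuation E (algebraMap F E ϖ.val) ^ (((1 : ℤ) + 1) / 2) :=
      ((mem_PD σ ϖ 1 M).mp hM).2.1
    refine this.trans_lt ?_
    norm_num
    exact (val_lt_one_iff _).mpr ϖ.lt_one
  exact Valuation.map_add_lt _ h1 (by rwa [val_conj])

lemma trd_add (M N : Matrix (Fin 2) (Fin 2) E) : trd F (M + N) = trd F M + trd F N := by
  simp [trd]

lemma psi_mul (h : IsDatum σ ϖ ψ n r β γ ζ) {x y : GL (Fin 2) E} (hx : x ∈ D1 σ ϖ r)
    (hy : y ∈ D1 σ ϖ r) : psi ψ β (x * y : GL (Fin 2) E) = psi ψ β x * psi ψ β y := by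
  have h1 : β * (((x * y : GL (Fin 2) E) : Matrix (Fin 2) (Fin 2) E) - 1) =
      β * ((x - 1) * (y - 1)) + (β * (x - 1) + β * (y - 1)) := by
    rw [Units.val_mul]; noncomm_ring
  have h2 := h.r_eq
  rw [psi, h1, trd_add, trd_add, AddChar.map_add_eq_mul, AddChar.map_add_eq_mul, psi_trd_eq_one h,
    one_mul, psi, psi]
  exact PD_anti (by omega) (PD_mul h.mem_PD (PD_mul hx.2.2 hy.2.2))

lemma psi_conj (h : IsDatum σ ϖ ψ n r β γ ζ) (p : E1 σ × E1 σ) {x : GL (Fin 2) E}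
    (hx : x ∈ D1 σ ϖ r) :
    psi ψ β (diagE1 σ p * x * (diagE1 σ p)⁻¹ : GL (Fin 2) E) = psi ψ β x := by
  obtain ⟨y, -, hy⟩ := h.near
  have key : ∀ z : GL (Fin 2) E, z ∈ D1 σ ϖ r →
      psi ψ β z = ψ (Algebra.trace F E (y * ((z : Matrix (Fin 2) (Fin 2) E) 0 0 - 1))) := by
    intro z hz
    have h1 : β * ((z : Matrix (Fin 2) (Fin 2) E) - 1) =
        (β - !![y, 0; 0, σ y]) * (z - 1) + !![y, 0; 0, σ y] * (z - 1) := by noncomm_ring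
    rw [psi, h1, trd_add, AddChar.map_add_eq_mul, psi_trd_eq_one h, one_mul]
    · simp [trd, Matrix.mul_apply, Fin.sum_univ_two]
    · exact PD_anti (by omega) (PD_mul hy hz.2.2)
  rw [key _ (diagE1_conj_mem p hx), key x hx, diagE1_conj_coe]
  simp

lemma gamma_well_defined (h : IsDatum σ ϖ ψ n r β γ ζ) {a a' b b' : E1 σ} {x x' : GL (Fin 2) E}
    (hx : x ∈ D1 σ ϖ r) (hx' : x' ∈ D1 σ ϖ r)
    (he : torus σ a * x * semi σ b = torus σ a' * x' * semi σ b') :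
    (γ a : ℂ) * psi ψ β x * (ζ b : ℂ) = (γ a' : ℂ) * psi ψ β x' * (ζ b' : ℂ) := by
  have hdet : ∀ (c d : E1 σ) (z : GL (Fin 2) E), z ∈ D1 σ ϖ r →
      (torus σ c * z * semi σ d : GL (Fin 2) E).val.det = ((d : Eˣ) : E) := by
    intro c d z hz
    rw [Units.val_mul, Units.val_mul, Matrix.det_mul, Matrix.det_mul, hz.2.1]
    simp [torus, semi, diagE1]
  have hb : b = b' := by
    have := congrArg (fun g : GL (Fin 2) E ↦ g.val.det) he
    simp only [hdet _ _ _ hx, hdet _ _ _ hx'] at this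
    exact Subtype.ext (Units.ext this)
  subst hb
  have he' : torus σ (a'⁻¹ * a) = x' * x⁻¹ := by
    have h1 := mul_right_cancel he
    rw [map_mul, map_inv, inv_mul_eq_iff_eq_mul, ← mul_assoc, ← h1, mul_inv_cancel_right]
  have hm : x' * x⁻¹ ∈ D1 σ ϖ r := mul_mem hx' (inv_mem hx)
  have hγ := h.gamma_eq (a'⁻¹ * a) (he' ▸ hm)
  rw [he'] at hγ
  have h2 : psi ψ β x' = psi ψ β (x' * x⁻¹ : GL (Fin 2) E) * psi ψ β x := by
    rw [← psi_mul h hm hx, inv_mul_cancel_right]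
  rw [h2, ← hγ, map_mul, map_inv, Units.val_mul, Units.val_inv_eq_inv_val]
  field_simp

lemma exists_decomp (g : mixed σ ϖ ⊤ r ⊤) : ∃ t : E1 σ × GL (Fin 2) E × E1 σ,
    t.2.1 ∈ D1 σ ϖ r ∧ (g : GL (Fin 2) E) = torus σ t.1 * t.2.1 * semi σ t.2.2 := by
  obtain ⟨a, -, x, hx, b, -, h⟩ := g.2
  exact ⟨(a, x, b), hx, h⟩

/-- The function `a x b ↦ γ(a) ψ_β(x) ζ(b)` on `E¹ D¹_r ⋊ E¹`. -/
noncomputable def gammaFun (ψ : AddChar F ℂ) (β : Matrix (Fin 2) (Fin 2) E) (γ ζ : E1 σ →* ℂˣ)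
    (g : mixed σ ϖ ⊤ r ⊤) : ℂ :=
  (γ (exists_decomp g).choose.1 : ℂ) * psi ψ β (exists_decomp g).choose.2.1 *
    (ζ (exists_decomp g).choose.2.2 : ℂ)

lemma gammaFun_apply (h : IsDatum σ ϖ ψ n r β γ ζ) (g : mixed σ ϖ ⊤ r ⊤) {a b : E1 σ}
    {x : GL (Fin 2) E} (hx : x ∈ D1 σ ϖ r)
    (hg : (g : GL (Fin 2) E) = torus σ a * x * semi σ b) :
    gammaFun ψ β γ ζ g = (γ a : ℂ) * psi ψ β x * (ζ b : ℂ) :=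
  gamma_well_defined h (exists_decomp g).choose_spec.1 hx
    ((exists_decomp g).choose_spec.2.symm.trans hg)

/-- The character `γ_(β,ζ)` of `E¹ D¹_r ⋊ E¹`, with
`γ_(β,ζ)(a x, b) = γ(a) ψ_β(x) ζ(b)` for `a ∈ E¹`, `x ∈ D¹_r`, `b ∈ E¹`
(this is `gammaFun_apply`). -/
noncomputable def gammaChar (h : IsDatum σ ϖ ψ n r β γ ζ) : mixed σ ϖ ⊤ r ⊤ →* ℂ where
  toFun := gammaFun ψ β γ ζ
  map_one' := by
    rw [gammaFun_apply h 1 (a := 1) (b := 1) (one_mem _) (by simp)]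
    simp [psi, trd]
  map_mul' g g' := by
    obtain ⟨⟨a, x, b⟩, hx, hg⟩ := exists_decomp g
    obtain ⟨⟨a', x', b'⟩, hx', hg'⟩ := exists_decomp g'
    have h1 : (torus σ a')⁻¹ * x * torus σ a' =
        diagE1 σ (a'⁻¹, a'⁻¹⁻¹) * x * (diagE1 σ (a'⁻¹, a'⁻¹⁻¹))⁻¹ := by
      rw [← Prod.inv_mk, map_inv, inv_inv]
      rfl
    have h2 : semi σ b * x' * (semi σ b)⁻¹ = diagE1 σ (1, b) * x' * (diagE1 σ (1, b))⁻¹ := rfl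
    have hc : semi σ b * torus σ a' = torus σ a' * semi σ b := by
      change diagE1 σ _ * diagE1 σ _ = diagE1 σ _ * diagE1 σ _
      rw [← map_mul, ← map_mul, mul_comm]
    have hm1 : (torus σ a')⁻¹ * x * torus σ a' ∈ D1 σ ϖ r := h1 ▸ diagE1_conj_mem _ hx
    have hm2 : semi σ b * x' * (semi σ b)⁻¹ ∈ D1 σ ϖ r := h2 ▸ diagE1_conj_mem _ hx'
    have hgg : ((g * g' : mixed σ ϖ ⊤ r ⊤) : GL (Fin 2) E) = torus σ (a * a') *
        (((torus σ a')⁻¹ * x * torus σ a') * (semi σ b * x' * (semi σ b)⁻¹)) *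
        semi σ (b * b') := by
      rw [Subgroup.coe_mul, hg, hg', map_mul, map_mul]
      calc _ = torus σ a * x * (semi σ b * torus σ a') * x' * semi σ b' := by group
        _ = _ := by rw [hc]; group
    rw [gammaFun_apply h _ hx hg, gammaFun_apply h _ hx' hg',
      gammaFun_apply h _ (mul_mem hm1 hm2) hgg, psi_mul h hm1 hm2, h1, h2, psi_conj h _ hx,
      psi_conj h _ hx', map_mul, map_mul, Units.val_mul, Units.val_mul]
    ring

end Characters

section Representations

/-- The one-dimensional representation given by a character. -/
noncomputable def charRep {G : Type*} [Group G] (χ : G →* ℂ) : Representation ℂ G ℂ :=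
  (Module.toModuleEnd ℂ ℂ).toMonoidHom.comp χ

/-- Every vector is fixed by an open subgroup. -/
def IsSmoothRep {G V : Type*} [Group G] [TopologicalSpace G] [AddCommGroup V] [Module ℂ V]
    (τ : Representation ℂ G V) : Prop :=
  ∀ v : V, ∃ U : Subgroup G, IsOpen (U : Set G) ∧ ∀ g ∈ U, τ g v = v

/-- The representation of `K` induced from a representation of a subgroup `H`, realised on the
functions `f : K → V` such that `f (h k) = τ(h) f(k)`, with `K` acting by right translation. When
`K` is compact, `H` is open and `τ` is smooth and finite dimensional, all these functions are
smooth. -/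
noncomputable abbrev ind {G V : Type*} [Group G] [AddCommGroup V] [Module ℂ V] {H K : Subgroup G}
    (hHK : H ≤ K) (τ : Representation ℂ H V) :
    Representation ℂ K (Representation.coindV (Subgroup.inclusion hHK) τ) :=
  Representation.coind (Subgroup.inclusion hHK) τ

variable {F E : Type*} [Field F] [ValuativeRel F] [TopologicalSpace F]
  [IsNonarchimedeanLocalField F] [Field E] [ValuativeRel E] [TopologicalSpace E]
  [IsNonarchimedeanLocalField E] [Algebra F E] [ValuativeExtension F E]
  [Algebra.IsQuadraticExtension F E]
  {σ : E ≃ₐ[F] E} {ϖ : UnramifiedUniformizer F E} {ψ : AddChar F ℂ} {n r : ℕ}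
  {β : Matrix (Fin 2) (Fin 2) E} {γ ζ : E1 σ →* ℂˣ}

/-- For a subgroup `A` of `E¹`, the character of the representation of `E¹ D¹_(r-1) ⋊ E¹_1` induced
from the restriction of `γ_(β,ζ)` to `A D¹_r ⋊ E¹_1`. -/
noncomputable def indChar (h : IsDatum σ ϖ ψ n r β γ ζ) (A : Subgroup (E1 σ))
    (g : mixed σ ϖ ⊤ (r - 1) (E11 σ)) : ℂ :=
  (ind (mixed_mono (A := A) (k := r) (B := E11 σ) le_top (Nat.sub_le r 1) le_rfl)
    (charRep ((gammaChar h).comp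
      (Subgroup.inclusion (mixed_mono (A := A) (B := E11 σ) le_top le_rfl le_top))))).character g

/-- `τ` is a `q`-dimensional irreducible smooth representation of `E¹ D¹_(r-1) ⋊ E¹` whose
restriction to `E¹ D¹_(r-1) ⋊ E¹_1` has character `2 q⁻¹ g - f`, where `g` and `f` are the
characters of the representations induced from the restrictions of `γ_(β,ζ)` to
`E¹_0 D¹_r ⋊ E¹_1` and to `E¹ D¹_r ⋊ E¹_1`. -/
structure IsHeisenberg (h : IsDatum σ ϖ ψ n r β γ ζ)
    (τ : Representation ℂ (mixed σ ϖ ⊤ (r - 1) ⊤) (Fin (Nat.card 𝓀[F]) → ℂ)) : Prop where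
  irreducible : τ.IsIrreducible
  smooth : IsSmoothRep τ
  character_eq : ∀ g : mixed σ ϖ ⊤ (r - 1) (E11 σ),
    τ.character (Subgroup.inclusion (mixed_mono le_rfl le_rfl le_top) g) =
      2 * (Nat.card 𝓀[F] : ℂ)⁻¹ * indChar h (E10 σ) g - indChar h ⊤ g

/-- `τ` is `τ¹_(β,γ,ζ)`: among the representations in `IsHeisenberg`, which differ by the characters
of the semidirect factor `E¹` trivial on `E¹_1`, it is the one in whose restriction to the
semidirect factor `E¹` the character `ζ` does not occur. -/
structure IsTauOne (h : IsDatum σ ϖ ψ n r β γ ζ)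
    (τ : Representation ℂ (mixed σ ϖ ⊤ (r - 1) ⊤) (Fin (Nat.card 𝓀[F]) → ℂ)) : Prop
    extends IsHeisenberg h τ where
  not_occurs : ∀ v : Fin (Nat.card 𝓀[F]) → ℂ,
    (∀ b : E1 σ, τ ⟨semi σ b, mem_mixed_semi ⊤ (r - 1) (Subgroup.mem_top b)⟩ v = (ζ b : ℂ) • v) →
      v = 0

end Representations

end HeisenbergU2

/-!
Write `n = 4 j + 2` and `r = 2 j + 2`. Modulo terms on which `ψ_β` does not depend, `β` is an element
`y` of `E` with `σ y = -y`. The function `psiY : a + c δ ↦ ψ (Tr (y (a - 1)))` extends `ψ_β` from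
`D¹_r` to `D¹_(r-1)`, where it fails to be multiplicative by the alternating bicharacter
`(c, d) ↦ Φ (c * s d)` of the residue field of `E`; here an element of `D¹_(r-1)` is identified
modulo `D¹_r` with a class `cls` in the residue field, `s` is the conjugation and
`Φ z = ψ (Tr (y ϖ ^ (2 j + 1) z))` is an additive character with `Φ (s z) = Φ (-z)`. So
representations of `D¹_(r-1)` that are scalar on `D¹_r` are the same as projective representations
`e` of the residue field with this cocycle (`IsWeyl`). Those of dimension `q` exist
(`isWeyl_schroedinger`), are irreducible and satisfy Schur's lemma, and are unique up to equivalence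
(`IsWeyl.exists_equiv`).

The torus acts on the residue field by multiplication with elements `b` of norm one. The operators
`∑ x, e (b * x) * e (-x)` intertwine `e` with its transform by `b`, and their cocycle is computed by
the Gauss sum of the norm form, which has the value `-q`. Once normalised, they form a representation
(`IsWeyl.weil`) of the group of the `q + 1` elements of norm one, with trace `-1` off the identity;
every nontrivial character occurs in it and the trivial one does not. Together with `γ` and `ζ` they
extend the Heisenberg representation to `E¹ D¹_(r-1) ⋊ E¹` (`IsEvenDatum.exists_rep`). Its character
is compared with the two induced characters conjugate by conjugate (`IsEvenDatum.character_eq`): a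
group element with diagonal part outside `E¹_0` has exactly one conjugate by the coset
representatives that meets `E¹ D¹_r ⋊ E¹_1`, and for the other elements either none or all of the
conjugates do.

For uniqueness, a smooth representation with the same character is scalar on `D¹_r`, because the
group is compact and an operator of finite order is determined there by the traces of its powers.
Hence it is given by the same Weyl system, and by Schur's lemma it differs from the first
representation by a character on the diagonal matrices. That character is trivial where the trace
does not vanish, so it comes from a character of the residual group of norm one elements; if this
were nontrivial, it would occur in the Weil representation, and then `ζ` would occur in the
restriction to the semidirect factor (`IsEvenDatum.eq_of_apply_D1_eq`).

The induced representation is irreducible because the representation acts on the normal subgroup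
`D¹_r` of `U(2)` by `ψ_β`, and an element of `U(2)` outside `E¹ D¹_(r-1) ⋊ E¹` does not fix `ψ_β`
(`isIrreducible_ind`, `IsEvenDatum.exists_psi_conj_ne_of_notMem`).
-/

namespace HeisenbergU2
set_option linter.unusedSectionVars false

/-! ### Quadratic extensions of finite fields -/

section FiniteField

variable {L : Type*} [Field L]

/-- A pair consisting of an involution `s` of a field `L` of characteristic different from two and
of a nontrivial additive character `Φ` of `L` that is odd with respect to `s`. The function
`(c, d) ↦ Φ (c * s d)` is then an alternating nondegenerate bicharacter of `L`. -/
structure IsOddCharacter (s : L ≃+* L) (Φ : AddChar L ℂ) : Prop where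
  two_ne_zero : (2 : L) ≠ 0
  involutive : ∀ x, s (s x) = x
  map_conj : ∀ x, Φ (s x) = Φ (-x)
  exists_ne_one : ∃ x, Φ x ≠ 1

/-- The subfield of fixed points of an automorphism. -/
def fixedField (s : L ≃+* L) : Subfield L := RingHom.eqLocusField (s : L →+* L) (RingHom.id L)

lemma mem_fixedField {s : L ≃+* L} {x : L} : x ∈ fixedField s ↔ s x = x := Iff.rfl

/-- The group of elements `u` such that `u * s u = 1`. -/
def normOne (s : L ≃+* L) : Subgroup Lˣ where
  carrier := {u | (u : L) * s u = 1}
  one_mem' := by simp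
  mul_mem' := by
    intro u v hu hv
    simp only [Set.mem_ofPred_eq, Units.val_mul, map_mul] at *
    linear_combination (v : L) * s v * hu + hv
  inv_mem' := by
    intro u hu
    simp only [Set.mem_ofPred_eq] at *
    rw [Units.val_inv_eq_inv_val, map_inv₀, ← mul_inv, hu, inv_one]

lemma mem_normOne {s : L ≃+* L} {u : Lˣ} : u ∈ normOne s ↔ (u : L) * s u = 1 := Iff.rfl

namespace IsOddCharacter

variable {s : L ≃+* L} {Φ : AddChar L ℂ}

lemma map_fixed (h : IsOddCharacter s Φ) {x : L} (hx : s x = x) : Φ x = 1 := by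
  have h2 : ∀ z : L, s z = z → Φ (2 * z) = 1 := by
    intro z hz
    have h1 := h.map_conj z
    rw [hz] at h1
    rw [two_mul, AddChar.map_add_eq_mul]
    nth_rewrite 1 [h1]
    rw [← AddChar.map_add_eq_mul, neg_add_cancel, AddChar.map_zero_eq_one]
  have := h2 (x / 2) (by rw [map_div₀, hx, map_ofNat])
  rwa [mul_div_cancel₀ _ h.two_ne_zero] at this

lemma map_mul_conj_self (h : IsOddCharacter s Φ) (c : L) : Φ (c * s c) = 1 :=
  h.map_fixed (by rw [map_mul, h.involutive, mul_comm])

lemma map_mul_conj_swap (h : IsOddCharacter s Φ) (c d : L) : Φ (d * s c) = Φ (-(c * s d)) := by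
  rw [← h.map_conj, map_mul s, h.involutive, mul_comm]

lemma exists_anti (h : IsOddCharacter s Φ) : ∃ ε : L, ε ≠ 0 ∧ s ε = -ε := by
  obtain ⟨x, hx⟩ := h.exists_ne_one
  refine ⟨x - s x, fun h0 ↦ hx (h.map_fixed (sub_eq_zero.mp h0).symm), ?_⟩
  rw [map_sub, h.involutive, neg_sub]

variable [Finite L]

lemma two_le_card_fixedField (s : L ≃+* L) : 2 ≤ Nat.card (fixedField s) := by
  have := Finite.one_lt_card (α := fixedField s)
  omega

lemma exists_decomp (h : IsOddCharacter s Φ) {ε : L} (h0 : ε ≠ 0) (hε : s ε = -ε) :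
    Function.Bijective (fun p : fixedField s × fixedField s ↦ (p.1 : L) + p.2 * ε) := by
  have h2 := h.two_ne_zero
  constructor
  · rintro ⟨⟨a, ha⟩, ⟨b, hb⟩⟩ ⟨⟨a', ha'⟩, ⟨b', hb'⟩⟩ he
    rw [mem_fixedField] at ha hb ha' hb'
    simp only at he
    have he' := congrArg s he
    simp only [map_add, map_mul, ha, hb, ha', hb', hε] at he'
    have h3 : a = a' := by
      apply mul_left_cancel₀ h2
      linear_combination he + he'
    have h4 : b = b' := by
      apply mul_left_cancel₀ (mul_ne_zero h2 h0)
      linear_combination he - he'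
    simp [h3, h4]
  · intro x
    refine ⟨⟨⟨(x + s x) / 2, ?_⟩, ⟨(x - s x) / (2 * ε), ?_⟩⟩, ?_⟩
    · rw [mem_fixedField, map_div₀, map_add, h.involutive, map_ofNat, add_comm]
    · rw [mem_fixedField, map_div₀, map_sub, h.involutive, map_mul, map_ofNat, hε]
      field_simp
      ring
    · simp only
      field_simp
      ring

lemma card_eq (h : IsOddCharacter s Φ) : Nat.card L = Nat.card (fixedField s) ^ 2 := by
  obtain ⟨ε, h0, hε⟩ := h.exists_anti
  rw [← Nat.card_congr (Equiv.ofBijective _ (h.exists_decomp h0 hε)), Nat.card_prod, sq]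

/-- Hilbert 90: an element of norm one is of the form `x / s x`. -/
lemma exists_div_conj (h : IsOddCharacter s Φ) (u : Lˣ) (hu : u ∈ normOne s) :
    ∃ x : Lˣ, (x : L) / s x = u := by
  rw [mem_normOne] at hu
  by_cases h1 : (1 : L) + u = 0
  · obtain ⟨ε, h0, hε⟩ := h.exists_anti
    refine ⟨Units.mk0 ε h0, ?_⟩
    rw [Units.val_mk0, hε, div_neg, div_self h0, eq_neg_of_add_eq_zero_right h1]
  · refine ⟨Units.mk0 _ h1, ?_⟩
    rw [Units.val_mk0, div_eq_iff ((map_ne_zero s).mpr h1), map_add, map_one, mul_add, hu]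
    ring

lemma card_units_fixedField (s : L ≃+* L) :
    Nat.card (fixedField s)ˣ = Nat.card (fixedField s) - 1 := Nat.card_units _

lemma card_normOne (h : IsOddCharacter s Φ) :
    Nat.card (normOne s) = Nat.card (fixedField s) + 1 := by
  let f : Lˣ →* Lˣ := MonoidHom.id _ / Units.map (s : L →* L)
  have hf : ∀ x : Lˣ, (f x : L) = x / s x := fun x ↦ by
    simp [f, div_eq_mul_inv]
  have hr : f.range = normOne s := by
    ext u
    constructor
    · rintro ⟨x, rfl⟩
      rw [mem_normOne, hf, map_div₀, h.involutive]
      have : s (x : L) ≠ 0 := by simp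
      field_simp
    · intro hu
      obtain ⟨x, hx⟩ := h.exists_div_conj u hu
      exact ⟨x, Units.ext ((hf x).trans hx)⟩
  have hk : f.ker = (Units.map (fixedField s).subtype.toMonoidHom).range := by
    ext x
    rw [MonoidHom.mem_ker, Units.ext_iff, hf, Units.val_one, div_eq_one_iff_eq (by simp)]
    constructor
    · intro hx
      have hx' : (x : L) ∈ fixedField s := hx.symm
      exact ⟨Units.mk0 ⟨x, hx'⟩ (by simp [Subtype.ext_iff]), Units.ext rfl⟩
    · rintro ⟨y, rfl⟩
      exact (show s ((y : fixedField s) : L) = _ from (y : fixedField s).2).symm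
  have h1 := f.ker.card_mul_index
  rw [Subgroup.index_ker, hr, hk, Nat.card_units, h.card_eq] at h1
  have h3 : Nat.card (Units.map (fixedField s).subtype.toMonoidHom).range =
      Nat.card (fixedField s) - 1 := by
    rw [← card_units_fixedField s]
    refine (Nat.card_congr (MonoidHom.ofInjective ?_).toEquiv).symm
    exact Units.map_injective (fixedField s).subtype.injective
  rw [h3] at h1
  have h4 := two_le_card_fixedField s
  obtain ⟨m, hm⟩ : ∃ m, Nat.card (fixedField s) = m + 2 := ⟨_, (Nat.sub_add_cancel h4).symm⟩
  rw [hm] at h1 ⊢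
  apply Nat.eq_of_mul_eq_mul_left (Nat.succ_pos m)
  have h5 : (m + 2) ^ 2 - 1 = (m + 1) * (m + 2 + 1) := by
    rw [Nat.sub_eq_iff_eq_add (Nat.one_le_pow _ _ (by omega))]; ring
  rw [h5] at h1
  exact h1

/-- The norm map from `Lˣ` to the units of the fixed field. -/
def normHom (h : IsOddCharacter s Φ) : Lˣ →* (fixedField s)ˣ where
  toFun x := Units.mk0 ⟨x * s x, by rw [mem_fixedField, map_mul, h.involutive, mul_comm]⟩
    (by simp [Subtype.ext_iff])
  map_one' := by ext; simp
  map_mul' x y := by ext; simp; ring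

lemma card_ker_normHom (h : IsOddCharacter s Φ) :
    Nat.card h.normHom.ker = Nat.card (fixedField s) + 1 := by
  rw [← h.card_normOne]
  congr 2
  ext u
  simp [MonoidHom.mem_ker, mem_normOne, normHom, Units.ext_iff, Subtype.ext_iff]

lemma normHom_surjective (h : IsOddCharacter s Φ) : Function.Surjective h.normHom := by
  rw [← MonoidHom.range_eq_top]
  apply Subgroup.eq_top_of_card_eq
  have h1 := h.normHom.ker.card_mul_index
  rw [Subgroup.index_ker, card_ker_normHom, Nat.card_units, h.card_eq] at h1
  rw [card_units_fixedField]
  have h4 := two_le_card_fixedField s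
  obtain ⟨m, hm⟩ : ∃ m, Nat.card (fixedField s) = m + 2 := ⟨_, (Nat.sub_add_cancel h4).symm⟩
  rw [hm] at h1 ⊢
  apply Nat.eq_of_mul_eq_mul_left (Nat.succ_pos (m + 2))
  have h5 : (m + 2) ^ 2 - 1 = (m + 2 + 1) * (m + 2 - 1) := by
    rw [Nat.sub_eq_iff_eq_add (Nat.one_le_pow _ _ (by omega)), show m + 2 - 1 = m + 1 by omega]
    ring
  rw [h5] at h1
  exact h1

/-- The restriction of `Φ` to a nonzero multiple of the fixed field by an odd element is a
nontrivial character. -/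
lemma exists_fixed_ne_one (h : IsOddCharacter s Φ) {t : L} (ht : s t = -t) (ht0 : t ≠ 0) :
    ∃ a : fixedField s, Φ (t * a) ≠ 1 := by
  obtain ⟨x, hx⟩ := h.exists_ne_one
  obtain ⟨⟨u, v⟩, rfl⟩ := (h.exists_decomp ht0 ht).2 x
  refine ⟨v, ?_⟩
  simp only at hx
  rwa [AddChar.map_add_eq_mul, h.map_fixed u.2, one_mul, mul_comm] at hx

/-- The Gauss sum of the anisotropic quadratic form `y ↦ t * (y * s y)` in two variables. -/
lemma gauss_sum [Fintype L] (h : IsOddCharacter s Φ) {t : L} (ht : s t = -t) (ht0 : t ≠ 0) :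
    ∑ y : L, Φ (t * (y * s y)) = -(Nat.card (fixedField s) : ℂ) := by
  classical
  have := Fintype.ofFinite (fixedField s)
  let f : fixedField s → ℂ := fun a ↦ Φ (t * a)
  have hf : ∑ a, f a = 0 := by
    let χ : AddChar (fixedField s) ℂ :=
      Φ.compAddMonoidHom ((AddMonoidHom.mulLeft t).comp (fixedField s).subtype.toAddMonoidHom)
    have : χ ≠ 1 := by
      obtain ⟨a, ha⟩ := h.exists_fixed_ne_one ht ht0
      intro h1
      exact ha (DFunLike.congr_fun h1 a)
    exact AddChar.sum_eq_zero_of_ne_one this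
  have hu : ∀ {K : Type _} [Field K] [Fintype K] [DecidableEq K] (g : K → ℂ),
      ∑ x, g x = g 0 + ∑ u : Kˣ, g u := by
    intro K _ _ _ g
    rw [← Finset.add_sum_erase _ _ (Finset.mem_univ (0 : K))]
    congr 1
    symm
    refine Finset.sum_bij (fun u _ ↦ (u : K)) (by simp) (fun _ _ _ _ h ↦ Units.ext h) ?_
      (fun _ _ ↦ rfl)
    intro x hx
    exact ⟨Units.mk0 x (Finset.ne_of_mem_erase hx), Finset.mem_univ _, rfl⟩
  have hfib : ∀ v : (fixedField s)ˣ,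
      (Finset.univ.filter fun x : Lˣ ↦ h.normHom x = v).card = Nat.card (fixedField s) + 1 := by
    intro v
    rw [MonoidHom.card_fiber_eq_of_mem_range h.normHom (h.normHom_surjective v)
      (h.normHom_surjective 1), ← h.card_ker_normHom, Nat.card_eq_fintype_card,
      ← Fintype.card_subtype]
    exact Fintype.card_congr (Equiv.refl _)
  have h1 : ∑ u : Lˣ, Φ (t * ((u : L) * s u)) = ∑ u : Lˣ, f (h.normHom u : fixedField s) := rfl
  rw [hu] at hf
  have hf0 : f 0 = 1 := by simp [f]
  rw [hu, h1, ← Finset.sum_fiberwise Finset.univ h.normHom]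
  have h2 : ∀ v : (fixedField s)ˣ, ∑ x with h.normHom x = v, f (h.normHom x : fixedField s) =
      (Nat.card (fixedField s) + 1 : ℂ) * f v := by
    intro v
    rw [Finset.sum_congr rfl (g := fun _ ↦ f v)
      (fun x hx ↦ by rw [(Finset.mem_filter.mp hx).2]), Finset.sum_const, hfib]
    simp
  rw [Finset.sum_congr rfl (fun v _ ↦ h2 v), ← Finset.mul_sum]
  simp only [map_zero, mul_zero, AddChar.map_zero_eq_one]
  linear_combination (Nat.card (fixedField s) + 1 : ℂ) * hf - (Nat.card (fixedField s) + 1 : ℂ) * hf0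

end IsOddCharacter

end FiniteField

/-! ### Weyl systems and the Weil representation of a finite unitary group in one variable -/

section Weyl

variable {L : Type*} [Field L] {V V' : Type*} [AddCommGroup V] [Module ℂ V]
  [AddCommGroup V'] [Module ℂ V'] {s : L ≃+* L} {Φ : AddChar L ℂ}

/-- A projective representation `e` of the additive group of `L` whose cocycle is the bicharacter
`(c, d) ↦ Φ (c * s d)`. -/
structure IsWeyl (s : L ≃+* L) (Φ : AddChar L ℂ) (e : L → Module.End ℂ V) : Prop where
  apply_zero : e 0 = 1
  mul : ∀ c d, e c * e d = Φ (c * s d) • e (c + d)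

namespace IsWeyl

variable {e : L → Module.End ℂ V} {e' : L → Module.End ℂ V'}

lemma mul_apply_neg (h : IsOddCharacter s Φ) (he : IsWeyl s Φ e) (c : L) : e c * e (-c) = 1 := by
  rw [he.mul, add_neg_cancel, he.apply_zero, map_neg, mul_neg,
    ← h.map_conj, map_mul s, h.involutive, mul_comm, h.map_mul_conj_self, one_smul]

lemma apply_neg_mul (h : IsOddCharacter s Φ) (he : IsWeyl s Φ e) (c : L) : e (-c) * e c = 1 := by
  simpa using he.mul_apply_neg h (-c)

lemma conj (h : IsOddCharacter s Φ) (he : IsWeyl s Φ e) (c d : L) :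
    e d * e c * e (-d) = Φ (2 * (d * s c)) • e c := by
  rw [he.mul, smul_mul_assoc, he.mul, smul_smul, add_comm d c, add_neg_cancel_right,
    ← AddChar.map_add_eq_mul, map_neg, add_mul, AddChar.map_add_eq_mul, AddChar.map_add_eq_mul]
  have h1 : Φ (d * -s d) = 1 := h.map_fixed (by
    rw [map_mul, map_neg, h.involutive]; ring)
  have h2 : Φ (c * -s d) = Φ (d * s c) := by rw [h.map_mul_conj_swap c d, mul_neg]
  rw [h1, h2, mul_one, ← AddChar.map_add_eq_mul, ← two_mul]

lemma trace_eq_zero (h : IsOddCharacter s Φ) (he : IsWeyl s Φ e) {c : L} (hc : c ≠ 0) :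
    LinearMap.trace ℂ V (e c) = 0 := by
  obtain ⟨x, hx⟩ := h.exists_ne_one
  have hs : s c ≠ 0 := (map_ne_zero s).mpr hc
  have h2 := h.two_ne_zero
  have h1 := congrArg (LinearMap.trace ℂ V) (he.conj h c (x / (2 * s c)))
  rw [LinearMap.trace_mul_comm, ← mul_assoc, he.apply_neg_mul h, one_mul, map_smul, smul_eq_mul] at h1
  have h3 : 2 * (x / (2 * s c) * s c) = x := by field_simp
  rw [h3] at h1
  by_contra h0
  exact hx (mul_right_cancel₀ h0 (by rw [← h1, one_mul]))

variable [FiniteDimensional ℂ V] [FiniteDimensional ℂ V'] [Fintype L]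

lemma span_eq_top (h : IsOddCharacter s Φ) (he : IsWeyl s Φ e)
    (hV : Module.finrank ℂ V = Nat.card (fixedField s)) :
    Submodule.span ℂ (Set.range e) = ⊤ := by
  have hq : (Nat.card (fixedField s) : ℂ) ≠ 0 := by
    have := IsOddCharacter.two_le_card_fixedField s
    exact_mod_cast (by omega : Nat.card (fixedField s) ≠ 0)
  refine LinearIndependent.span_eq_top_of_card_eq_finrank' ?_ ?_
  · rw [Fintype.linearIndependent_iff]
    intro g hg i
    have h1 := congrArg (fun T ↦ LinearMap.trace ℂ V (T * e (-i))) hg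
    simp only [Finset.sum_mul, map_sum, smul_mul_assoc, map_smul, zero_mul, map_zero] at h1
    rw [Finset.sum_eq_single i] at h1
    · rw [he.mul_apply_neg h, LinearMap.trace_one, hV, smul_eq_mul] at h1
      exact (mul_eq_zero.mp h1).resolve_right hq
    · intro b _ hb
      rw [he.mul, map_smul, he.trace_eq_zero h, smul_zero, smul_zero]
      rwa [← sub_eq_add_neg, sub_ne_zero]
    · simp
  · rw [Module.finrank_linearMap, hV, ← Nat.card_eq_fintype_card, h.card_eq, sq]

/-- Schur's lemma for a Weyl system of minimal dimension. -/
lemma exists_smul_of_commute (h : IsOddCharacter s Φ) (he : IsWeyl s Φ e)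
    (hV : Module.finrank ℂ V = Nat.card (fixedField s)) {T : Module.End ℂ V}
    (hT : ∀ c, T * e c = e c * T) : ∃ a : ℂ, T = a • 1 := by
  have h1 : ∀ M : Module.End ℂ V, M * T = T * M := by
    intro M
    have hM : M ∈ Submodule.span ℂ (Set.range e) := he.span_eq_top h hV ▸ Submodule.mem_top
    induction hM using Submodule.span_induction with
    | mem x hx => obtain ⟨c, rfl⟩ := hx; exact (hT c).symm
    | zero => simp
    | add x y _ _ hx hy => rw [add_mul, mul_add, hx, hy]
    | smul a x _ hx => rw [smul_mul_assoc, mul_smul_comm, hx]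
  obtain ⟨a, ha⟩ := Module.End.mem_center_iff.mp (Semigroup.mem_center_iff.mpr h1)
  obtain ⟨-, rfl⟩ := ha
  exact ⟨a, LinearMap.ext fun v ↦ rfl⟩

/-- Irreducibility of a Weyl system of minimal dimension. -/
lemma stable_eq_bot_or_top (h : IsOddCharacter s Φ) (he : IsWeyl s Φ e)
    (hV : Module.finrank ℂ V = Nat.card (fixedField s)) (W : Submodule ℂ V)
    (hW : ∀ c, ∀ v ∈ W, e c v ∈ W) : W = ⊥ ∨ W = ⊤ := by
  have h1 : ∀ M : Module.End ℂ V, ∀ v ∈ W, M v ∈ W := by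
    intro M
    have hM : M ∈ Submodule.span ℂ (Set.range e) := he.span_eq_top h hV ▸ Submodule.mem_top
    induction hM using Submodule.span_induction with
    | mem x hx => obtain ⟨c, rfl⟩ := hx; exact hW c
    | zero => intro v _; exact W.zero_mem
    | add x y _ _ hx hy => intro v hv; exact W.add_mem (hx v hv) (hy v hv)
    | smul a x _ hx => intro v hv; exact W.smul_mem a (hx v hv)
  rw [or_iff_not_imp_left]
  intro hne
  obtain ⟨v, hv, hv0⟩ := W.ne_bot_iff.mp hne
  rw [eq_top_iff]
  intro w _
  obtain ⟨f, hf⟩ := Module.Projective.exists_dual_eq_one ℂ hv0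
  have := h1 (f.smulRight w) v hv
  simpa [hf] using this

/-- Uniqueness of the Weyl system of minimal dimension. -/
lemma exists_equiv (h : IsOddCharacter s Φ) (he : IsWeyl s Φ e) (he' : IsWeyl s Φ e')
    (hV : Module.finrank ℂ V = Nat.card (fixedField s))
    (hV' : Module.finrank ℂ V' = Nat.card (fixedField s)) :
    ∃ P : V ≃ₗ[ℂ] V', ∀ c v, P (e c v) = e' c (P v) := by
  classical
  have hq : (Nat.card (fixedField s) : ℂ) ≠ 0 := by
    have := IsOddCharacter.two_le_card_fixedField s
    exact_mod_cast (by omega : Nat.card (fixedField s) ≠ 0)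
  -- averaging a linear map over the Weyl system
  let A : (V →ₗ[ℂ] V') → V →ₗ[ℂ] V' := fun M ↦ ∑ c, e' c ∘ₗ M ∘ₗ e (-c)
  have hA : ∀ M d, A M ∘ₗ e d = e' d ∘ₗ A M := by
    intro M d
    have hA1 : A M ∘ₗ e d = ∑ c, e' c ∘ₗ M ∘ₗ (e (-c) * e d) := by
      ext v; simp [A, LinearMap.sum_apply]
    have hA2 : e' d ∘ₗ A M = ∑ c, (e' d * e' c) ∘ₗ M ∘ₗ e (-c) := by
      ext v; simp [A, LinearMap.sum_apply]
    rw [hA1, hA2, ← Equiv.sum_comp (Equiv.addLeft d)]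
    refine Finset.sum_congr rfl fun c _ ↦ ?_
    rw [Equiv.coe_addLeft, he.mul, he'.mul, show -(d + c) + d = -c by ring]
    have h1 : Φ (-(d + c) * s d) = Φ (d * s c) := by
      rw [neg_mul, add_mul, neg_add, AddChar.map_add_eq_mul, h.map_mul_conj_swap c d,
        ← neg_mul, h.map_fixed (x := -d * s d), one_mul]
      rw [map_mul, map_neg, h.involutive]; ring
    rw [h1]
    ext v; simp
  have hne : ∃ M, A M ≠ 0 := by
    by_contra! h0
    let bV := Module.finBasis ℂ V
    let bV' := Module.finBasis ℂ V'
    -- matrix coefficients of the averages of the elementary matrices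
    have h1 : ∀ i j, ∑ c, LinearMap.toMatrix bV bV (e (-c)) i i *
        LinearMap.toMatrix bV' bV' (e' c) j j = 0 := by
      intro i j
      have h2 := congrArg (fun T : V →ₗ[ℂ] V' ↦ bV'.repr (T (bV i)) j)
        (h0 ((bV.coord i).smulRight (bV' j)))
      simpa [A, LinearMap.sum_apply, Finsupp.finsetSum_apply, LinearMap.toMatrix_apply] using h2
    have h3 : ∑ c, LinearMap.trace ℂ V (e (-c)) * LinearMap.trace ℂ V' (e' c) = 0 := by
      simp_rw [LinearMap.trace_eq_matrix_trace ℂ bV, LinearMap.trace_eq_matrix_trace ℂ bV',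
        Matrix.trace, Matrix.diag, Finset.sum_mul_sum]
      rw [Finset.sum_comm]
      refine Finset.sum_eq_zero fun i _ ↦ ?_
      rw [Finset.sum_comm]
      exact Finset.sum_eq_zero fun j _ ↦ h1 i j
    rw [Finset.sum_eq_single 0 (fun c _ hc ↦ by rw [he'.trace_eq_zero h hc, mul_zero])
      (by simp), neg_zero, he.apply_zero, he'.apply_zero, LinearMap.trace_one, LinearMap.trace_one,
      hV, hV'] at h3
    exact hq (mul_self_eq_zero.mp h3)
  obtain ⟨M, hM⟩ := hne
  have hker : LinearMap.ker (A M) = ⊥ := by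
    refine (he.stable_eq_bot_or_top h hV _ ?_).resolve_right
      fun h1 ↦ hM (LinearMap.ker_eq_top.mp h1)
    intro c v hv
    rw [LinearMap.mem_ker] at hv ⊢
    have := LinearMap.congr_fun (hA M c) v
    simpa [hv] using this
  refine ⟨LinearEquiv.ofInjectiveOfFinrankEq (A M) (LinearMap.ker_eq_bot.mp hker)
    (hV.trans hV'.symm), fun c v ↦ ?_⟩
  exact LinearMap.congr_fun (hA M c) v

/-- The (unnormalised) operator intertwining `e` and `e ∘ (b * ·)`. -/
noncomputable def twist (e : L → Module.End ℂ V) (b : L) : Module.End ℂ V :=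
  ∑ x, e (b * x) * e (-x)

lemma twist_mul (h : IsOddCharacter s Φ) (he : IsWeyl s Φ e) {b : L} (hb : b * s b = 1) (y : L) :
    twist e b * e y = e (b * y) * twist e b := by
  rw [twist, Finset.sum_mul, Finset.mul_sum, ← Equiv.sum_comp (Equiv.addLeft y)]
  refine Finset.sum_congr rfl fun x _ ↦ ?_
  rw [Equiv.coe_addLeft, mul_assoc, he.mul (-(y + x)), ← mul_assoc, he.mul (b * y),
    show -(y + x) + y = -x by ring, ← mul_add, mul_smul_comm, smul_mul_assoc]
  congr 1
  have h1 : b * y * s (b * x) = y * s x := by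
    rw [map_mul]; linear_combination y * s x * hb
  rw [h1, neg_mul, add_mul, neg_add, AddChar.map_add_eq_mul, h.map_mul_conj_swap x y,
    ← neg_mul, h.map_fixed (x := -y * s y), one_mul]
  rw [map_mul, map_neg, h.involutive]; ring

/-- Conjugation by `e y` multiplies `e c` by a character of `y`, which is nontrivial for
`c ≠ 0`. -/
lemma sum_conj [DecidableEq L] (h : IsOddCharacter s Φ) (he : IsWeyl s Φ e) (c : L) :
    ∑ y, e y * e c * e (-y) = if c = 0 then ((Nat.card (fixedField s) : ℂ) ^ 2) • 1 else 0 := by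
  simp only [he.conj h]
  rw [← Finset.sum_smul]
  split_ifs with hc
  · subst hc
    simp only [map_zero, mul_zero, AddChar.map_zero_eq_one, Finset.sum_const, Finset.card_univ,
      he.apply_zero]
    rw [← Nat.card_eq_fintype_card, h.card_eq]
    simp
  · have : ∑ y, Φ (2 * (y * s c)) = 0 := by
      have h1 : ∀ y, Φ (2 * (y * s c)) = Φ.mulShift (2 * s c) y := fun y ↦ by
        rw [AddChar.mulShift_apply]; ring_nf
      simp only [h1]
      apply AddChar.sum_eq_zero_of_ne_one
      intro h2
      obtain ⟨x, hx⟩ := h.exists_ne_one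
      have hs : 2 * s c ≠ 0 := mul_ne_zero h.two_ne_zero ((map_ne_zero s).mpr hc)
      have := DFunLike.congr_fun h2 (x / (2 * s c))
      rw [AddChar.mulShift_apply, mul_div_cancel₀ _ hs] at this
      exact hx this
    rw [this, zero_smul]

lemma twist_mul_twist_eq_sum (h : IsOddCharacter s Φ) (he : IsWeyl s Φ e) {b : L}
    (hb : b * s b = 1) (b' : L) : twist e b * twist e b' =
      ∑ y, e (b * b' * y) * twist e b * e (-y) := by
  rw [twist.eq_1 e b', Finset.mul_sum]
  refine Finset.sum_congr rfl fun y _ ↦ ?_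
  rw [← mul_assoc, he.twist_mul h hb, mul_assoc b]

lemma trace_twist (h : IsOddCharacter s Φ) (he : IsWeyl s Φ e)
    (hV : Module.finrank ℂ V = Nat.card (fixedField s)) {b : L} (hb1 : b ≠ 1) :
    LinearMap.trace ℂ V (twist e b) = Nat.card (fixedField s) := by
  rw [twist, map_sum, Finset.sum_eq_single 0]
  · rw [mul_zero, neg_zero, he.apply_zero, one_mul, LinearMap.trace_one, hV]
  · intro x _ hx
    rw [he.mul, map_smul, he.trace_eq_zero h, smul_zero]
    rw [← sub_eq_add_neg, ← sub_one_mul]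
    exact mul_ne_zero (sub_ne_zero.mpr hb1) hx
  · simp

/-- The twists by mutually inverse `b` and `b'` multiply to a scalar. The general product is reduced to
this case by showing that `twist e b * twist e b'` is proportional to `twist e (b * b')`. -/
lemma twist_mul_twist_inv (h : IsOddCharacter s Φ) (he : IsWeyl s Φ e) {b b' : L}
    (hb : b * s b = 1) (hbb : b * b' = 1) (hb1 : b ≠ 1) :
    twist e b * twist e b' = ((Nat.card (fixedField s) : ℂ) ^ 2) • 1 := by
  classical
  rw [he.twist_mul_twist_eq_sum h hb, hbb]
  have h1 : ∀ y, e (1 * y) * twist e b * e (-y) =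
      ∑ x, Φ (b * x * s (-x)) • (e y * e (b * x + -x) * e (-y)) := by
    intro y
    rw [twist, one_mul, Finset.mul_sum, Finset.sum_mul]
    refine Finset.sum_congr rfl fun x _ ↦ ?_
    rw [he.mul, mul_smul_comm, smul_mul_assoc]
  simp only [h1]
  rw [Finset.sum_comm]
  simp only [← Finset.smul_sum, he.sum_conj h]
  rw [Finset.sum_eq_single 0]
  · simp
  · intro x _ hx
    rw [if_neg, smul_zero]
    rw [← sub_eq_add_neg, ← sub_one_mul]
    exact mul_ne_zero (sub_ne_zero.mpr hb1) hx
  · simp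

/-- The cocycle of the operators `twist` is computed by a Gauss sum. -/
lemma twist_mul_twist (h : IsOddCharacter s Φ) (he : IsWeyl s Φ e)
    (hV : Module.finrank ℂ V = Nat.card (fixedField s)) {b b' : L}
    (hb : b * s b = 1) (hb' : b' * s b' = 1) (hb1 : b ≠ 1) (hb1' : b' ≠ 1) (hbb : b * b' ≠ 1) :
    twist e b * twist e b' = -(Nat.card (fixedField s) : ℂ) • twist e (b * b') := by
  classical
  have hq : (Nat.card (fixedField s) : ℂ) ≠ 0 := by
    have := IsOddCharacter.two_le_card_fixedField s
    exact_mod_cast (by omega : Nat.card (fixedField s) ≠ 0)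
  have hbbn : b * b' * s (b * b') = 1 := by
    rw [map_mul]; linear_combination b' * s b' * hb + hb'
  have hb0 : b ≠ 0 := left_ne_zero_of_mul_eq_one hb
  have hb0' : b' ≠ 0 := left_ne_zero_of_mul_eq_one hb'
  have hsb : s b = b⁻¹ := eq_inv_of_mul_eq_one_right hb
  have hsb' : s b' = b'⁻¹ := eq_inv_of_mul_eq_one_right hb'
  have e1 : 1 - b ≠ 0 := sub_ne_zero.mpr hb1.symm
  have e2 : 1 - b' ≠ 0 := sub_ne_zero.mpr hb1'.symm
  have e3 : 1 - b * b' ≠ 0 := sub_ne_zero.mpr hbb.symm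
  have e4 : b - 1 ≠ 0 := sub_ne_zero.mpr hb1
  -- both sides intertwine `e` with its transform under `b * b'`, hence they are proportional
  obtain ⟨a, ha⟩ := he.exists_smul_of_commute h hV
    (T := twist e (b * b')⁻¹ * (twist e b * twist e b')) (by
      intro c
      have hin : (b * b')⁻¹ * s (b * b')⁻¹ = 1 := by rw [map_inv₀, ← mul_inv, hbbn, inv_one]
      rw [mul_assoc, mul_assoc, he.twist_mul h hb', ← mul_assoc (twist e b), he.twist_mul h hb,
        ← mul_assoc, ← mul_assoc, he.twist_mul h hin, ← mul_assoc b,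
        inv_mul_cancel_left₀ (mul_ne_zero hb0 hb0'), mul_assoc, mul_assoc])
  have hprop : twist e b * twist e b' =
      (a / (Nat.card (fixedField s) : ℂ) ^ 2) • twist e (b * b') := by
    have h1 := he.twist_mul_twist_inv h hbbn (mul_inv_cancel₀ (mul_ne_zero hb0 hb0')) hbb
    have h2 := congrArg (twist e (b * b') * ·) ha
    simp only [← mul_assoc, h1, smul_mul_assoc, one_mul, mul_smul_comm, mul_one] at h2
    rw [div_eq_inv_mul, mul_smul, ← h2, smul_smul, inv_mul_cancel₀ (pow_ne_zero 2 hq), one_smul]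
  -- the constant is determined by the trace
  let k : L := (b * b' - 1) / (1 - b)
  let t : L := k * (1 - s b')
  have hsk : s (k * (1 - s b')) = -(k * (1 - s b')) := by
    simp only [k, map_mul, map_div₀, map_sub, map_one, hsb, hsb', map_inv₀]
    field_simp
    have e5 : b - 1 = -(1 - b) := by ring
    rw [e5]
    field_simp
    ring
  have ht : s t = -t := hsk
  have ht0 : t ≠ 0 := by
    have : 1 - s b' ≠ 0 := by
      rw [sub_ne_zero, ← map_one s]
      exact fun h1 ↦ hb1' (s.injective h1).symm
    refine mul_ne_zero (div_ne_zero ?_ e1) this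
    exact sub_ne_zero.mpr hbb
  have htr : LinearMap.trace ℂ V (twist e b * twist e b') =
      Nat.card (fixedField s) * ∑ y, Φ (t * (y * s y)) := by
    rw [he.twist_mul_twist_eq_sum h hb, map_sum, Finset.mul_sum]
    refine Finset.sum_congr rfl fun y _ ↦ ?_
    rw [twist, Finset.mul_sum, Finset.sum_mul, map_sum, Finset.sum_eq_single (k * y)]
    · rw [← mul_assoc, he.mul, smul_mul_assoc, smul_mul_assoc, mul_assoc (e _), he.mul (-_), mul_smul_comm,
        map_smul, map_smul, smul_smul]
      have h1 : b * b' * y + b * (k * y) = y + k * y := by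
        simp only [k]; field_simp; ring
      rw [h1, show -(k * y) + -y = -(y + k * y) by ring, he.mul_apply_neg h, LinearMap.trace_one, hV,
        smul_eq_mul, mul_comm, ← AddChar.map_add_eq_mul]
      congr 1
      have h2 : b * b' * y * s (b * (k * y)) = s k * b' * (y * s y) := by
        simp only [map_mul, hsb]
        field_simp
      have h3 : -(k * y) * s (-y) = k * (y * s y) := by rw [map_neg]; ring
      have h4 : s k * b' * (y * s y) + k * (y * s y) =
          (s k * b' + s (s k * b')) * (y * s y) + t * (y * s y) := by
        simp only [t, map_mul, h.involutive]; ring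
      rw [h2, h3, h4, AddChar.map_add_eq_mul, h.map_fixed, one_mul]
      simp only [map_mul, map_add, h.involutive]; ring
    · intro x _ hx
      rw [← mul_assoc, he.mul, smul_mul_assoc, smul_mul_assoc, mul_assoc (e _), he.mul (-_), mul_smul_comm,
        map_smul, map_smul, he.mul, map_smul, he.trace_eq_zero h, smul_zero, smul_zero, smul_zero]
      intro h0
      apply hx
      simp only [k]
      rw [div_mul_eq_mul_div, eq_div_iff e1]
      linear_combination -h0
    · simp
  have := congrArg (LinearMap.trace ℂ V) hprop
  rw [htr, map_smul, he.trace_twist h hV hbb, h.gauss_sum ht ht0, smul_eq_mul] at this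
  rw [hprop]
  congr 1
  apply mul_right_cancel₀ hq
  rw [← this]; ring

open scoped Classical in
/-- The operator intertwining `e` and `e ∘ (b * ·)`, normalised so that it is multiplicative in `b`
and has trace `-1` for `b ≠ 1`. For `b = 1` the scalar would be different, since the Gauss sum that
computes the cocycle of the operators `twist` degenerates. -/
noncomputable def weil (s : L ≃+* L) (e : L → Module.End ℂ V) (b : L) : Module.End ℂ V :=
  if b = 1 then 1 else -(Nat.card (fixedField s) : ℂ)⁻¹ • twist e b

lemma weil_one (s : L ≃+* L) (e : L → Module.End ℂ V) : weil s e 1 = 1 := if_pos rfl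

lemma weil_mul_apply (h : IsOddCharacter s Φ) (he : IsWeyl s Φ e) {b : L} (hb : b * s b = 1)
    (y : L) : weil s e b * e y = e (b * y) * weil s e b := by
  rw [weil]
  split_ifs with h1
  · rw [h1, one_mul, one_mul, mul_one]
  · rw [smul_mul_assoc, he.twist_mul h hb, mul_smul_comm]

lemma trace_weil (h : IsOddCharacter s Φ) (he : IsWeyl s Φ e)
    (hV : Module.finrank ℂ V = Nat.card (fixedField s)) {b : L} (hb1 : b ≠ 1) :
    LinearMap.trace ℂ V (weil s e b) = -1 := by
  rw [weil, if_neg hb1, map_smul, he.trace_twist h hV hb1, smul_eq_mul, neg_mul, inv_mul_cancel₀]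
  have := IsOddCharacter.two_le_card_fixedField s
  exact_mod_cast (by omega : Nat.card (fixedField s) ≠ 0)

lemma weil_mul (h : IsOddCharacter s Φ) (he : IsWeyl s Φ e)
    (hV : Module.finrank ℂ V = Nat.card (fixedField s)) {b b' : L}
    (hb : b * s b = 1) (hb' : b' * s b' = 1) :
    weil s e (b * b') = weil s e b * weil s e b' := by
  have hq : (Nat.card (fixedField s) : ℂ) ≠ 0 := by
    have := IsOddCharacter.two_le_card_fixedField s
    exact_mod_cast (by omega : Nat.card (fixedField s) ≠ 0)
  by_cases h1 : b = 1
  · rw [h1, one_mul, weil_one, one_mul]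
  by_cases h2 : b' = 1
  · rw [h2, mul_one, weil_one, mul_one]
  rw [weil.eq_1 s e b, weil.eq_1 s e b', if_neg h1, if_neg h2, smul_mul_smul_comm]
  by_cases h3 : b * b' = 1
  · rw [h3, weil_one, he.twist_mul_twist_inv h hb h3 h1, smul_smul]
    field_simp
    simp
  · rw [he.twist_mul_twist h hV hb hb' h1 h2 h3, smul_smul, weil, if_neg h3]
    congr 1
    field_simp

/-- The operators `weil s e b` as a representation of the group of elements of norm one. -/
noncomputable def weilHom (h : IsOddCharacter s Φ) (he : IsWeyl s Φ e)
    (hV : Module.finrank ℂ V = Nat.card (fixedField s)) : normOne s →* Module.End ℂ V where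
  toFun b := weil s e ((b : Lˣ) : L)
  map_one' := weil_one s e
  map_mul' b b' := he.weil_mul h hV b.2 b'.2

/-- The trivial character does not occur among the operators `weil s e b`: the traces are `q` for
`b = 1` and `-1` for the `q` other elements `b`, so that the average of the operators has trace
zero. -/
lemma eq_zero_of_weil_fixed (h : IsOddCharacter s Φ) (he : IsWeyl s Φ e)
    (hV : Module.finrank ℂ V = Nat.card (fixedField s)) {v : V}
    (hv : ∀ b : normOne s, weil s e ((b : Lˣ) : L) v = v) : v = 0 := by
  classical
  have := Fintype.ofFinite (normOne s)
  have hcard : (Nat.card (normOne s) : ℂ) ≠ 0 := by exact_mod_cast Nat.card_pos.ne'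
  have : Invertible (Fintype.card (normOne s) : ℂ) :=
    invertibleOfNonzero (by rwa [← Nat.card_eq_fintype_card])
  have hch := (Representation.isProj_averageMap (he.weilHom h hV)).trace
  have hsum : ∑ g : normOne s, LinearMap.trace ℂ V (he.weilHom h hV g) = 0 := by
    rw [← Finset.add_sum_erase _ _ (Finset.mem_univ 1), map_one, LinearMap.trace_one, hV,
      Finset.sum_congr rfl (g := fun _ ↦ (-1 : ℂ))]
    · rw [Finset.sum_const, Finset.card_erase_of_mem (Finset.mem_univ _), Finset.card_univ,
        ← Nat.card_eq_fintype_card, h.card_normOne]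
      simp
    · intro b hb
      refine he.trace_weil h hV fun h1 ↦ Finset.ne_of_mem_erase hb ?_
      exact Subtype.ext (Units.ext h1)
  have h0 : Module.finrank ℂ (Representation.invariants (he.weilHom h hV)) = 0 := by
    have h3 : (Module.finrank ℂ (Representation.invariants (he.weilHom h hV)) : ℂ) = 0 := by
      rw [← hch, Representation.averageMap, GroupAlgebra.average, map_smul, map_smul, map_sum,
        map_sum]
      simp only [Representation.asAlgebraHom_of]
      rw [hsum, smul_zero]
    exact_mod_cast h3
  have h4 : v ∈ Representation.invariants (he.weilHom h hV) := hv
  rw [Submodule.finrank_eq_zero.mp h0] at h4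
  exact h4

/-- Every nontrivial character occurs among the operators `weil s e b`. -/
lemma exists_weil_eigenvector (h : IsOddCharacter s Φ) (he : IsWeyl s Φ e)
    (hV : Module.finrank ℂ V = Nat.card (fixedField s)) {χ : normOne s →* ℂˣ} (hχ : χ ≠ 1) :
    ∃ v : V, v ≠ 0 ∧ ∀ b : normOne s, weil s e ((b : Lˣ) : L) v = (χ b : ℂ) • v := by
  classical
  have := Fintype.ofFinite (normOne s)
  let P : Module.End ℂ V := ∑ b : normOne s, ((χ b)⁻¹ : ℂˣ).val • he.weilHom h hV b
  have hP : ∀ b, he.weilHom h hV b * P = (χ b : ℂ) • P := by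
    intro b
    simp only [P]
    rw [Finset.mul_sum, Finset.smul_sum, ← Equiv.sum_comp (Equiv.mulLeft b) (fun c ↦
      (χ b : ℂ) • ((χ c)⁻¹ : ℂˣ).val • he.weilHom h hV c)]
    refine Finset.sum_congr rfl fun c _ ↦ ?_
    rw [Equiv.coe_mulLeft, map_mul, map_mul, mul_smul_comm, smul_smul, mul_inv, Units.val_mul,
      ← mul_assoc, Units.mul_inv, one_mul]
  have hχ0 : ∑ b : normOne s, ((χ b)⁻¹ : ℂˣ).val = 0 := by
    have := sum_hom_units_eq_zero ((Units.coeHom ℂ).comp χ⁻¹) (by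
      intro h1
      apply hχ
      ext b
      have := DFunLike.congr_fun h1 b
      simpa using this)
    simpa using this
  have hne : P ≠ 0 := by
    intro h0
    have h1 := congrArg (LinearMap.trace ℂ V) h0
    simp only [P, map_sum, map_smul, smul_eq_mul, LinearMap.map_zero] at h1
    rw [← Finset.add_sum_erase _ _ (Finset.mem_univ 1)] at h1 hχ0
    rw [map_one, map_one, LinearMap.trace_one, hV, Finset.sum_congr rfl (g := fun b : normOne s ↦
      -((χ b)⁻¹ : ℂˣ).val)] at h1
    · rw [Finset.sum_neg_distrib] at h1
      simp only [map_one, inv_one, Units.val_one] at h1 hχ0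
      have h2 : (Nat.card (fixedField s) : ℂ) + 1 = 0 := by linear_combination h1 + hχ0
      exact absurd h2 (Nat.cast_add_one_ne_zero _)
    · intro b hb
      have : LinearMap.trace ℂ V (he.weilHom h hV b) = -1 :=
        he.trace_weil h hV fun h1 ↦ Finset.ne_of_mem_erase hb (Subtype.ext (Units.ext h1))
      rw [this, mul_neg, mul_one]
  obtain ⟨w, hw⟩ : ∃ w, P w ≠ 0 := by
    by_contra! h1
    exact hne (LinearMap.ext h1)
  exact ⟨P w, hw, fun b ↦ LinearMap.congr_fun (hP b) w⟩

end IsWeyl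

/-- The Schrödinger model of the Weyl system, on the functions on the fixed field: the even part
`(c + s c) / 2` of `c` acts by translation and the odd part `(c - s c) / 2` by multiplication with a
character. The shift by `(c + s c) / 4` is what makes the cocycle equal to `Φ (c * s d)`. -/
noncomputable def schroedinger (h : IsOddCharacter s Φ) (c : L) :
    Module.End ℂ (fixedField s → ℂ) where
  toFun f t := Φ (-(c - s c) * (t + (c + s c) / 4)) *
    f (t + ⟨(c + s c) / 2, by
      rw [mem_fixedField, map_div₀, map_add, h.involutive, map_ofNat, add_comm]⟩)
  map_add' f g := by ext t; simp [mul_add]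
  map_smul' a f := by ext t; simp; ring

lemma isWeyl_schroedinger (h : IsOddCharacter s Φ) : IsWeyl s Φ (schroedinger h) where
  apply_zero := by
    refine LinearMap.ext fun f ↦ funext fun t ↦ ?_
    simp only [schroedinger, LinearMap.coe_mk, AddHom.coe_mk, map_zero, sub_zero, neg_zero,
      zero_mul, AddChar.map_zero_eq_one, one_mul, add_zero, zero_div, Module.End.one_apply]
    congr 1
    exact Subtype.ext (by simp)
  mul c d := by
    refine LinearMap.ext fun f ↦ funext fun t ↦ ?_
    have h2 := h.two_ne_zero
    have h4 : (4 : L) ≠ 0 := by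
      have : (4 : L) = 2 * 2 := by norm_num
      rw [this]; exact mul_ne_zero h2 h2
    simp only [schroedinger, LinearMap.coe_mk, AddHom.coe_mk, Module.End.mul_apply,
      LinearMap.smul_apply, Pi.smul_apply, smul_eq_mul]
    rw [← mul_assoc, ← mul_assoc, ← AddChar.map_add_eq_mul, ← AddChar.map_add_eq_mul]
    congr 1
    · rw [← one_mul (Φ (c * s d + _)), ← h.map_fixed (x := -(c * s d + d * s c) / 2),
        ← AddChar.map_add_eq_mul]
      · congr 1
        simp only [Subfield.coe_add, map_add]
        field_simp
        ring
      · simp only [map_div₀, map_neg, map_add, map_mul, h.involutive, map_ofNat]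
        ring
    · congr 1
      refine Subtype.ext ?_
      simp only [Subfield.coe_add, map_add]
      field_simp
      ring

/-- A Weyl system on a standard vector space. -/
lemma exists_isWeyl [Finite L] (h : IsOddCharacter s Φ) {m : ℕ}
    (hm : m = Nat.card (fixedField s)) :
    ∃ e : L → Module.End ℂ (Fin m → ℂ), IsWeyl s Φ e := by
  let i : fixedField s ≃ Fin m := (Finite.equivFin _).trans (finCongr hm.symm)
  let l : (fixedField s → ℂ) ≃ₗ[ℂ] (Fin m → ℂ) := LinearEquiv.funCongrLeft ℂ ℂ i.symm
  have hw := isWeyl_schroedinger h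
  refine ⟨fun c ↦ l.conjRingEquiv (schroedinger h c), ?_, ?_⟩
  · rw [hw.apply_zero, map_one]
  · intro c d
    rw [← map_mul, hw.mul]
    exact LinearMap.ext fun v ↦ by simp

end Weyl

/-! ### Induced representations -/

section InducedRepresentations

open scoped Classical in
/-- The extension by zero of a function on a subgroup. -/
noncomputable def extendZero {G : Type*} [Group G] {H : Subgroup G} (χ : H → ℂ) (x : G) : ℂ :=
  if hx : x ∈ H then χ ⟨x, hx⟩ else 0

lemma extendZero_of_mem {G : Type*} [Group G] {H : Subgroup G} (χ : H → ℂ) {x : G} (hx : x ∈ H) :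
    extendZero χ x = χ ⟨x, hx⟩ := dif_pos hx

lemma extendZero_of_notMem {G : Type*} [Group G] {H : Subgroup G} (χ : H → ℂ) {x : G}
    (hx : x ∉ H) : extendZero χ x = 0 := dif_neg hx

/-- The character of a representation induced from a one-dimensional one, for a system `t` of
representatives of the right cosets. -/
lemma character_ind {G : Type*} [Group G] {H K : Subgroup G} (hHK : H ≤ K) (χ : H →* ℂ)
    {S : Type*} [Fintype S] (t : S → K) (ht : ∀ k : K, ∃! i, ((k : G) * (t i : G)⁻¹) ∈ H) (g : K) :
    (ind hHK (charRep χ)).character g = ∑ i, extendZero χ ((t i : G) * g * (t i : G)⁻¹) := by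
  classical
  choose ι hι hι' using ht
  have hι1 : ∀ i, ι (t i) = i := fun i ↦ (hι' (t i) i (by simp [one_mem])).symm
  have hιmul : ∀ (x : H) (k : K), ι (Subgroup.inclusion hHK x * k) = ι k := fun x k ↦ by
    refine (hι' _ _ ?_).symm
    simp only [Subgroup.coe_mul, Subgroup.coe_inclusion, mul_assoc]
    exact mul_mem x.2 (hι k)
  let E : Representation.coindV (Subgroup.inclusion hHK) (charRep χ) ≃ₗ[ℂ] (S → ℂ) :=
    { toFun := fun f i ↦ f.1 (t i)
      map_add' := fun _ _ ↦ rfl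
      map_smul' := fun _ _ ↦ rfl
      invFun := fun a ↦ ⟨fun k ↦ extendZero χ ((k : G) * (t (ι k) : G)⁻¹) * a (ι k), fun x k ↦ by
        change extendZero χ _ * a _ = χ x * (extendZero χ _ * a _)
        rw [hιmul, ← mul_assoc, extendZero_of_mem χ (hι k), ← map_mul, extendZero_of_mem χ]
        · congr 2
          exact Subtype.ext (mul_assoc _ _ _)
        · have := mul_mem x.2 (hι k)
          rwa [← mul_assoc] at this⟩
      left_inv := fun f ↦ by
        refine Subtype.ext (funext fun k ↦ ?_)
        change extendZero χ _ * _ = _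
        rw [extendZero_of_mem χ (hι k)]
        have := f.2 ⟨_, hι k⟩ (t (ι k))
        refine this.symm.trans (congrArg f.1 ?_)
        exact Subtype.ext (by simp)
      right_inv := fun a ↦ funext fun i ↦ by
        change extendZero χ _ * a (ι (t i)) = a i
        rw [hι1, mul_inv_cancel, extendZero_of_mem χ (one_mem H)]
        exact (congrArg (· * a i) (map_one χ)).trans (one_mul _) }
  rw [Representation.character, ← LinearMap.trace_conj' _ E,
    LinearMap.trace_eq_matrix_trace ℂ (Pi.basisFun ℂ S), Matrix.trace]
  refine Finset.sum_congr rfl fun i _ ↦ ?_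
  rw [Matrix.diag, LinearMap.toMatrix_apply, Pi.basisFun_repr, Pi.basisFun_apply]
  change extendZero χ _ * (Pi.single i 1 : S → ℂ) (ι (t i * g)) = _
  by_cases h1 : ι (t i * g) = i
  · rw [h1, Pi.single_eq_same, mul_one]
    rfl
  · rw [Pi.single_eq_of_ne h1, mul_zero, extendZero_of_notMem]
    intro h2
    exact h1 (hι' (t i * g) i (by simpa using h2)).symm

/-- An operator of finite order all of whose powers have the same trace as the identity is the
identity. -/
lemma eq_one_of_trace_pow {V : Type*} [AddCommGroup V] [Module ℂ V] [FiniteDimensional ℂ V]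
    {T : Module.End ℂ V} {N : ℕ} (hN : N ≠ 0) (hT : T ^ N = 1)
    (htr : ∀ k : ℕ, LinearMap.trace ℂ V (T ^ k) = Module.finrank ℂ V) : T = 1 := by
  have hN' : (N : ℂ) ≠ 0 := by exact_mod_cast hN
  -- the average of the powers of `T` is an idempotent of full rank
  let P : Module.End ℂ V := (N : ℂ)⁻¹ • ∑ k ∈ Finset.range N, T ^ k
  have hTP : T * P = P := by
    simp only [P]
    rw [mul_smul_comm, Finset.mul_sum]
    congr 1
    have h1 := Finset.sum_range_succ' (fun k ↦ T ^ k) N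
    rw [Finset.sum_range_succ, hT, pow_zero] at h1
    rw [add_right_cancel h1]
    exact Finset.sum_congr rfl fun k _ ↦ (pow_succ' T k).symm
  have hPP : P * P = P := by
    have h1 : ∀ k : ℕ, T ^ k * P = P := by
      intro k
      induction k with
      | zero => rw [pow_zero, one_mul]
      | succ k ih => rw [pow_succ, mul_assoc, hTP, ih]
    nth_rewrite 1 [show P = (N : ℂ)⁻¹ • ∑ k ∈ Finset.range N, T ^ k from rfl]
    rw [smul_mul_assoc, Finset.sum_mul, Finset.sum_congr rfl (fun k _ ↦ h1 k), Finset.sum_const,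
      Finset.card_range, ← Nat.cast_smul_eq_nsmul ℂ, smul_smul, inv_mul_cancel₀ hN', one_smul]
  have hPtr : LinearMap.trace ℂ V P = Module.finrank ℂ V := by
    simp only [P]
    rw [map_smul, map_sum, Finset.sum_congr rfl (fun k _ ↦ htr k), Finset.sum_const,
      Finset.card_range, nsmul_eq_mul, smul_eq_mul, inv_mul_cancel_left₀ hN']
  have hproj : LinearMap.IsProj (LinearMap.range P) P := by
    refine ⟨fun v ↦ LinearMap.mem_range_self P v, ?_⟩
    rintro _ ⟨v, rfl⟩
    exact LinearMap.congr_fun hPP v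
  have hr : LinearMap.range P = ⊤ := by
    apply Submodule.eq_top_of_finrank_eq
    have := hproj.trace
    rw [hPtr] at this
    exact_mod_cast this.symm
  have hP1 : P = 1 := LinearMap.ext fun v ↦ hproj.map_id v (hr ▸ Submodule.mem_top)
  rw [← mul_one T, ← hP1, hTP]

variable {G V : Type*} [Group G] [AddCommGroup V] [Module ℂ V] {J K : Subgroup G}

open scoped Classical in
/-- The function in the induced representation that is supported on `J` and takes the value `v`
at `1`. -/
noncomputable def indSingle (hJK : J ≤ K) (τ : Representation ℂ J V) :
    V →ₗ[ℂ] Representation.coindV (Subgroup.inclusion hJK) τ where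
  toFun v := ⟨fun k ↦ if hk : (k : G) ∈ J then τ ⟨k, hk⟩ v else 0, fun j k ↦ by
    have hiff : ((Subgroup.inclusion hJK j * k : K) : G) ∈ J ↔ (k : G) ∈ J :=
      Subgroup.mul_mem_cancel_left J j.2
    by_cases hk : (k : G) ∈ J
    · simp only
      rw [dif_pos (hiff.mpr hk), dif_pos hk, ← Module.End.mul_apply, ← map_mul]
      rfl
    · simp only
      rw [dif_neg (hiff.not.mpr hk), dif_neg hk, map_zero]⟩
  map_add' v w := by
    refine Subtype.ext (funext fun k ↦ ?_)
    by_cases hk : (k : G) ∈ J <;> simp [hk]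
  map_smul' a v := by
    refine Subtype.ext (funext fun k ↦ ?_)
    by_cases hk : (k : G) ∈ J <;> simp [hk]

lemma indSingle_of_mem (hJK : J ≤ K) (τ : Representation ℂ J V) (v : V) {k : K}
    (hk : (k : G) ∈ J) : (indSingle hJK τ v).1 k = τ ⟨k, hk⟩ v := dif_pos hk

lemma indSingle_of_notMem (hJK : J ≤ K) (τ : Representation ℂ J V) (v : V) {k : K}
    (hk : (k : G) ∉ J) : (indSingle hJK τ v).1 k = 0 := dif_neg hk

/-- A criterion for the irreducibility of an induced representation: `τ` is irreducible and acts
on a `K`-stable subset `N` of `J` by a scalar function `θ`, which no element of `K` outside `J`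
stabilizes. -/
lemma isIrreducible_ind (hJK : J ≤ K) (τ : Representation ℂ J V) (hτ : τ.IsIrreducible)
    [Finite (Quotient (QuotientGroup.rightRel (J.subgroupOf K)))] (N : Set G) (hNJ : ∀ d ∈ N, d ∈ J)
    (hN : ∀ k ∈ K, ∀ d ∈ N, k * d * k⁻¹ ∈ N) (θ : G → ℂ)
    (hθ : ∀ d (hd : d ∈ N) v, τ ⟨d, hNJ d hd⟩ v = θ d • v)
    (hK : ∀ k ∈ K, k ∉ J → ∃ d ∈ N, θ (k * d * k⁻¹) ≠ θ d) :
    (ind hJK τ).IsIrreducible := by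
  classical
  have hout : ∀ k : K, ((k : G) * ((Quotient.out
      (Quotient.mk (QuotientGroup.rightRel (J.subgroupOf K)) k) : K) : G)⁻¹) ∈ J := fun k ↦ by
    have := Quotient.mk_out (s := QuotientGroup.rightRel (J.subgroupOf K)) k
    exact (QuotientGroup.rightRel_apply (s := J.subgroupOf K)).mp this
  have hmk : ∀ k l : K, Quotient.mk (QuotientGroup.rightRel (J.subgroupOf K)) k =
      Quotient.mk (QuotientGroup.rightRel (J.subgroupOf K)) l ↔ (l : G) * (k : G)⁻¹ ∈ J :=
    fun k l ↦ Quotient.eq.trans (QuotientGroup.rightRel_apply (s := J.subgroupOf K))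
  have hsmul : ∀ (f : Representation.coindV (Subgroup.inclusion hJK) τ) (g k : K),
      (ind hJK τ g f).1 k = f.1 (k * g) := fun _ _ _ ↦ rfl
  have heq : ∀ (f : Representation.coindV (Subgroup.inclusion hJK) τ) (j k : K)
      (hj : (j : G) ∈ J), f.1 (j * k) = τ ⟨j, hj⟩ (f.1 k) := fun f j k hj ↦ f.2 ⟨j, hj⟩ k
  have hact : ∀ (f : Representation.coindV (Subgroup.inclusion hJK) τ) (k d : K)
      (_ : (d : G) ∈ N), f.1 (k * d) = θ (k * d * (k : G)⁻¹) • f.1 k := by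
    intro f k d hd
    have h1 := heq f (k * d * k⁻¹) k (hNJ _ (hN k k.2 d hd))
    rw [inv_mul_cancel_right] at h1
    exact h1.trans (hθ _ (hN k k.2 d hd) _)
  have hnt : Nontrivial V := by
    obtain ⟨⟨a, b, hab⟩⟩ := hτ.toNontrivial
    by_contra h1
    rw [not_nontrivial_iff_subsingleton] at h1
    exact hab (Subrepresentation.toSubmodule_injective (Subsingleton.elim _ _))
  refine
    { exists_pair_ne := ⟨⊥, ⊤, fun h0 ↦ ?_⟩
      eq_bot_or_eq_top := fun W ↦ ?_ }
  · obtain ⟨v, hv⟩ := exists_ne (0 : V)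
    have h1 : indSingle hJK τ v ∈ (⊥ : Subrepresentation (ind hJK τ)).toSubmodule := by
      rw [h0]; exact Submodule.mem_top
    have h2 := congrArg (fun f ↦ f.1 1) ((Submodule.mem_bot ℂ).mp h1)
    have h3 := (indSingle_of_mem hJK τ v (k := 1) (one_mem J)).symm.trans h2
    exact hv ((LinearMap.congr_fun (map_one τ) v).symm.trans h3)
  rw [or_iff_not_imp_left]
  intro hW
  -- some element of `W` does not vanish at `1`
  have hex : ∃ f ∈ W.toSubmodule, f.1 1 ≠ 0 := by
    have h1 : W.toSubmodule ≠ ⊥ := fun h ↦ hW (Subrepresentation.toSubmodule_injective h)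
    obtain ⟨f, hf, hf0⟩ := W.toSubmodule.ne_bot_iff.mp h1
    obtain ⟨k, hk⟩ : ∃ k, f.1 k ≠ 0 := by
      by_contra! h2
      exact hf0 (Subtype.ext (funext h2))
    exact ⟨ind hJK τ k f, W.apply_mem_toSubmodule k hf, by rwa [hsmul, one_mul]⟩
  let S : Representation.coindV (Subgroup.inclusion hJK) τ →
      Set (Quotient (QuotientGroup.rightRel (J.subgroupOf K))) :=
    fun f ↦ {c | f.1 c.out ≠ 0}
  -- one with minimal support is supported on `J`
  obtain ⟨f, ⟨hf, hf1⟩, hmin⟩ := exists_minimalFor_of_wellFoundedLT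
    (fun f ↦ f ∈ W.toSubmodule ∧ f.1 1 ≠ 0) (fun f ↦ (S f).ncard) hex
  have hsupp : ∀ k : K, (k : G) ∉ J → f.1 k = 0 := by
    intro k hk
    by_contra hfk
    obtain ⟨d, hd, hne⟩ := hK k k.2 hk
    let d' : K := ⟨d, hJK (hNJ d hd)⟩
    let f' := ind hJK τ d' f - θ (k * d * (k : G)⁻¹) • f
    have hf'v : ∀ x : K, f'.1 x = (θ (x * d * (x : G)⁻¹) - θ (k * d * (k : G)⁻¹)) • f.1 x := by
      intro x
      rw [sub_smul, ← hact f x d' hd]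
      rfl
    have hf'W : f' ∈ W.toSubmodule :=
      W.toSubmodule.sub_mem (W.apply_mem_toSubmodule d' hf) (W.toSubmodule.smul_mem _ hf)
    have hf'1 : f'.1 1 ≠ 0 := by
      rw [hf'v]
      refine smul_ne_zero ?_ hf1
      simpa [sub_eq_zero] using hne.symm
    have hsub : S f' ⊂ S f := by
      refine ⟨fun c hc hc0 ↦ hc ?_, fun h1 ↦ ?_⟩
      · rw [hf'v, hc0, smul_zero]
      · let o : K := Quotient.out (Quotient.mk (QuotientGroup.rightRel (J.subgroupOf K)) k)
        have hko : k = (k * o⁻¹) * o := by group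
        have h2 : f.1 o ≠ 0 := by
          intro h0
          apply hfk
          rw [hko, heq f _ _ (hout k), h0, map_zero]
        have h3 : f'.1 o ≠ 0 := h1 h2
        apply h3
        have h4 : o = (k * o⁻¹)⁻¹ * k := by group
        have h5 : ((k * o⁻¹ : K)⁻¹ : G) ∈ J := inv_mem (hout k)
        rw [h4, heq f' _ _ h5, hf'v, sub_self, zero_smul, map_zero]
    exact (Set.ncard_lt_ncard hsub (Set.toFinite _)).not_ge
      (hmin ⟨hf'W, hf'1⟩ (Set.ncard_lt_ncard hsub (Set.toFinite _)).le)
  have hsingle : ∀ v, indSingle hJK τ v ∈ W.toSubmodule := by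
    let U : Subrepresentation τ :=
      { toSubmodule := W.toSubmodule.comap (indSingle hJK τ)
        apply_mem_toSubmodule := fun j v hv ↦ by
          have h1 : indSingle hJK τ (τ j v) =
              ind hJK τ (Subgroup.inclusion hJK j) (indSingle hJK τ v) := by
            refine Subtype.ext (funext fun k ↦ ?_)
            rw [hsmul]
            by_cases hk : (k : G) ∈ J
            · rw [indSingle_of_mem hJK τ _ hk, indSingle_of_mem hJK τ _
                (k := k * Subgroup.inclusion hJK j) (mul_mem hk j.2), ← Module.End.mul_apply,
                ← map_mul]
              rfl
            · rw [indSingle_of_notMem hJK τ _ hk, indSingle_of_notMem]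
              exact fun h2 ↦ hk ((Subgroup.mul_mem_cancel_right J j.2).mp h2)
          change indSingle hJK τ (τ j v) ∈ W.toSubmodule
          rw [h1]
          exact W.apply_mem_toSubmodule _ hv }
    have hfs : f = indSingle hJK τ (f.1 1) := by
      refine Subtype.ext (funext fun k ↦ ?_)
      by_cases hk : (k : G) ∈ J
      · rw [indSingle_of_mem hJK τ _ hk, ← heq f k 1 hk, mul_one]
      · rw [indSingle_of_notMem hJK τ _ hk, hsupp k hk]
    have hU : U = ⊤ := by
      refine (hτ.eq_bot_or_eq_top U).resolve_left fun h0 ↦ hf1 ?_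
      have h1 : f.1 1 ∈ U.toSubmodule := by
        change indSingle hJK τ (f.1 1) ∈ W.toSubmodule
        rwa [← hfs]
      rw [h0] at h1
      exact (Submodule.mem_bot ℂ).mp h1
    intro v
    have : v ∈ U.toSubmodule := by rw [hU]; exact Submodule.mem_top
    exact this
  -- every function is a sum of translates of functions supported on `J`
  have := Fintype.ofFinite (Quotient (QuotientGroup.rightRel (J.subgroupOf K)))
  refine Subrepresentation.toSubmodule_injective (eq_top_iff.mpr fun f _ ↦ ?_)
  have hfsum : f = ∑ c : Quotient (QuotientGroup.rightRel (J.subgroupOf K)),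
      ind hJK τ (c.out)⁻¹ (indSingle hJK τ (f.1 c.out)) := by
    refine Subtype.ext (funext fun k ↦ ?_)
    rw [AddSubmonoidClass.coe_finsetSum, Finset.sum_apply, Finset.sum_eq_single
      (Quotient.mk (QuotientGroup.rightRel (J.subgroupOf K)) k)]
    · rw [hsmul, indSingle_of_mem hJK τ _ (hout k), ← heq f _ _ (hout k), inv_mul_cancel_right]
    · intro c _ hc
      rw [hsmul, indSingle_of_notMem]
      intro h1
      apply hc
      rw [← Quotient.out_eq c]
      exact (hmk _ _).mpr h1
    · simp
  rw [hfsum]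
  exact W.toSubmodule.sum_mem fun c _ ↦ W.apply_mem_toSubmodule _ (hsingle _)

/-- Induction from an open subgroup of finite index preserves smoothness. -/
lemma isSmoothRep_ind [TopologicalSpace G] [IsTopologicalGroup G] (hJK : J ≤ K)
    (τ : Representation ℂ J V) (hτ : IsSmoothRep τ)
    [Finite (Quotient (QuotientGroup.rightRel (J.subgroupOf K)))]
    (hJ : IsOpen (J.subgroupOf K : Set K)) : IsSmoothRep (ind hJK τ) := by
  intro f
  let st : Subgroup K :=
    { carrier := {u | ind hJK τ u f = f}
      one_mem' := LinearMap.congr_fun (map_one (ind hJK τ)) f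
      mul_mem' := fun {a b} ha hb ↦ by
        simp only [Set.mem_ofPred_eq] at *
        rw [map_mul, Module.End.mul_apply, hb, ha]
      inv_mem' := fun {a} ha ↦ by
        simp only [Set.mem_ofPred_eq] at *
        nth_rewrite 1 [← ha]
        rw [← Module.End.mul_apply, ← map_mul, inv_mul_cancel, map_one, Module.End.one_apply] }
  refine ⟨st, st.isOpen_of_mem_nhds (g := 1) ?_, fun g hg ↦ hg⟩
  choose U hU hUf using hτ
  have hA : ∀ c : Quotient (QuotientGroup.rightRel (J.subgroupOf K)),
      {u : K | ∃ h : ((c.out * u * c.out⁻¹ : K) : G) ∈ J, (⟨_, h⟩ : J) ∈ U (f.1 c.out)} ∈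
        nhds (1 : K) := by
    intro c
    obtain ⟨O, hO, hO'⟩ := isOpen_induced_iff.mp (hU (f.1 c.out))
    have hcont : Continuous (fun u : K ↦ c.out * u * c.out⁻¹) := by fun_prop
    have hopen : IsOpen ((J.subgroupOf K : Set K) ∩ Subtype.val ⁻¹' O) :=
      hJ.inter (hO.preimage continuous_subtype_val)
    refine Filter.mem_of_superset ((hopen.preimage hcont).mem_nhds ?_) ?_
    · have h1 : (1 : J) ∈ (Subtype.val ⁻¹' O : Set J) := by
        rw [hO']; exact one_mem _
      refine ⟨?_, ?_⟩
      · simp [one_mem]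
      · simpa using h1
    · rintro u ⟨hu1, hu2⟩
      refine ⟨hu1, ?_⟩
      have h1 : (⟨_, hu1⟩ : J) ∈ (Subtype.val ⁻¹' O : Set J) := hu2
      rw [hO'] at h1
      exact h1
  refine Filter.mem_of_superset (Filter.iInter_mem.mpr hA) fun u hu ↦ ?_
  refine Subtype.ext (funext fun k ↦ ?_)
  change f.1 (k * u) = f.1 k
  let c := Quotient.mk (QuotientGroup.rightRel (J.subgroupOf K)) k
  obtain ⟨h1, h2⟩ := Set.mem_iInter.mp hu c
  have h3 : (k * c.out⁻¹ : G) ∈ J := by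
    have := Quotient.mk_out (s := QuotientGroup.rightRel (J.subgroupOf K)) k
    exact (QuotientGroup.rightRel_apply (s := J.subgroupOf K)).mp this
  have h4 : f.1 (c.out * u) = f.1 c.out := by
    have h5 := f.2 ⟨_, h1⟩ c.out
    rw [hUf _ _ h2] at h5
    refine (congrArg f.1 (Subtype.ext ?_)).trans h5
    exact (inv_mul_cancel_right ((c.out : K) * u : G) _).symm
  have h6 := f.2 ⟨_, h3⟩ (c.out * u)
  have h7 := f.2 ⟨_, h3⟩ c.out
  rw [h4, ← h7] at h6
  have h8 : (Subgroup.inclusion hJK ⟨_, h3⟩ : K) = k * c.out⁻¹ := Subtype.ext rfl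
  rw [h8, inv_mul_cancel_right, ← mul_assoc, inv_mul_cancel_right] at h6
  exact h6

/-- The multiplicative group of `ℂ` has no small subgroups. -/
lemma eq_one_of_norm_pow_sub_one_lt {z : ℂ} (hz : ∀ n : ℕ, ‖z ^ n - 1‖ < 1 / 2) : z = 1 := by
  by_contra h1
  have h0 : 0 < ‖z - 1‖ := norm_pos_iff.mpr (sub_ne_zero.mpr h1)
  have h2 : ∀ n : ℕ, (3 / 2 : ℝ) ^ n * ‖z - 1‖ ≤ ‖z ^ (2 ^ n) - 1‖ := by
    intro n
    induction n with
    | zero => simp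
    | succ n ih =>
      have h3 : z ^ (2 ^ (n + 1)) - 1 = (z ^ (2 ^ n) + 1) * (z ^ (2 ^ n) - 1) := by
        rw [pow_succ 2 n, pow_mul]; ring
      have h4 : (3 / 2 : ℝ) ≤ ‖z ^ (2 ^ n) + 1‖ := by
        have h5 : (2 : ℂ) = (z ^ (2 ^ n) + 1) - (z ^ (2 ^ n) - 1) := by ring
        have h6 := norm_sub_le (z ^ (2 ^ n) + 1) (z ^ (2 ^ n) - 1)
        rw [← h5, Complex.norm_ofNat] at h6
        have := hz (2 ^ n)
        linarith
      rw [h3, norm_mul, pow_succ, mul_comm _ (3 / 2 : ℝ), mul_assoc]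
      exact mul_le_mul h4 ih (by positivity) (by positivity)
  obtain ⟨n, hn⟩ := pow_unbounded_of_one_lt (‖z - 1‖⁻¹) (by norm_num : (1 : ℝ) < 3 / 2)
  have h3 := (h2 n).trans_lt (hz (2 ^ n))
  have h4 : 1 < (3 / 2 : ℝ) ^ n * ‖z - 1‖ := by
    rw [← inv_mul_cancel₀ h0.ne']
    exact mul_lt_mul_of_pos_right hn h0
  linarith

end InducedRepresentations

/-! ### Lattices and elements of norm one in the local field -/

section LocalField

variable {F E : Type*} [Field F] [ValuativeRel F] [TopologicalSpace F]
  [IsNonarchimedeanLocalField F] [Field E] [ValuativeRel E] [TopologicalSpace E]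
  [IsNonarchimedeanLocalField E] [Algebra F E] [ValuativeExtension F E]
  [Algebra.IsQuadraticExtension F E] {σ : E ≃ₐ[F] E} {ϖ : UnramifiedUniformizer F E}

lemma mem_PE {k : ℤ} {x : E} :
    x ∈ PE ϖ k ↔ valuation E x ≤ valuation E (algebraMap F E ϖ.val) ^ k := Iff.rfl

lemma PE_zero_mem (k : ℤ) : (0 : E) ∈ PE ϖ k := by
  rw [mem_PE, map_zero]; exact zero_le

lemma PE_neg {k : ℤ} {x : E} (hx : x ∈ PE ϖ k) : -x ∈ PE ϖ k := by
  rw [mem_PE, Valuation.map_neg]; exact hx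

lemma PE_sub {k : ℤ} {x y : E} (hx : x ∈ PE ϖ k) (hy : y ∈ PE ϖ k) : x - y ∈ PE ϖ k := by
  rw [sub_eq_add_neg]; exact PE_add hx (PE_neg hy)

lemma PE_conj (σ : E ≃ₐ[F] E) {k : ℤ} {x : E} (hx : x ∈ PE ϖ k) : σ x ∈ PE ϖ k := by
  rw [mem_PE, val_conj]; exact hx

lemma val_unif_lt_one (ϖ : UnramifiedUniformizer F E) :
    valuation E (algebraMap F E ϖ.val) < 1 := (val_lt_one_iff _).mpr ϖ.lt_one

lemma unif_ne_zero (ϖ : UnramifiedUniformizer F E) : algebraMap F E ϖ.val ≠ 0 := by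
  simpa using ϖ.ne_zero

lemma mem_PE_zero {x : E} : x ∈ PE ϖ 0 ↔ valuation E x ≤ 1 := by rw [mem_PE, zpow_zero]

lemma mem_PE_one {x : E} : x ∈ PE ϖ 1 ↔ valuation E x < 1 := by
  rw [mem_PE, zpow_one]
  exact ⟨fun h ↦ h.trans_lt (val_unif_lt_one ϖ), ϖ.le_ext x⟩

lemma unif_zpow_mem_PE (ϖ : UnramifiedUniformizer F E) (k : ℤ) :
    (algebraMap F E ϖ.val) ^ k ∈ PE ϖ k := by
  rw [mem_PE, map_zpow₀]

lemma unif_mem_PE (ϖ : UnramifiedUniformizer F E) : algebraMap F E ϖ.val ∈ PE ϖ 1 := by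
  simpa using unif_zpow_mem_PE ϖ 1

lemma mul_unif_zpow_mem_PE {j k : ℤ} {x : E} :
    x * (algebraMap F E ϖ.val) ^ j ∈ PE ϖ k ↔ x ∈ PE ϖ (k - j) := by
  constructor
  · intro h
    have := PE_mul h (unif_zpow_mem_PE ϖ (-j))
    rwa [mul_assoc, ← zpow_add₀ (unif_ne_zero ϖ), add_neg_cancel, zpow_zero, mul_one,
      ← sub_eq_add_neg] at this
  · intro h
    have := PE_mul h (unif_zpow_mem_PE ϖ j)
    rwa [sub_add_cancel] at this

lemma le_val_of_notMem_PE {k : ℤ} {x : E} (hx : x ∉ PE ϖ (k + 1)) :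
    valuation E (algebraMap F E ϖ.val) ^ k ≤ valuation E x := by
  have h0 : x ≠ 0 := by
    rintro rfl
    exact hx (PE_zero_mem _)
  have hv : valuation E x ≠ 0 := by simpa using h0
  by_contra hlt
  rw [not_le] at hlt
  apply hx
  have h1 : x * (algebraMap F E ϖ.val) ^ (-k) ∈ PE ϖ 1 := by
    rw [mem_PE_one, map_mul, map_zpow₀, zpow_neg,
      mul_inv_lt_iff₀ (zpow_pos (val_unif_pos ϖ) k), one_mul]
    exact hlt
  have := mul_unif_zpow_mem_PE.mp h1
  rwa [sub_neg_eq_add, add_comm] at this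

lemma inv_mem_PE {k : ℤ} {x : E} (hx : valuation E (algebraMap F E ϖ.val) ^ k ≤ valuation E x) :
    x⁻¹ ∈ PE ϖ (-k) := by
  rw [mem_PE, map_inv₀, zpow_neg]
  exact inv_anti₀ (zpow_pos (val_unif_pos ϖ) k) hx

lemma val_two (hp : ringChar 𝓀[F] ≠ 2) : valuation E (2 : E) = 1 := by
  have hF : valuation F (2 : F) = 1 := by
    have h2 : ((2 : 𝒪[F]) : F) = 2 := rfl
    have hu : IsUnit (2 : 𝒪[F]) := by
      by_contra hu
      have h1 : IsLocalRing.residue 𝒪[F] 2 = 0 :=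
        (IsLocalRing.residue_eq_zero_iff _).mpr ((IsLocalRing.mem_maximalIdeal _).mpr hu)
      exact Ring.two_ne_zero hp (by rw [← h1, map_ofNat])
    rw [← h2]
    exact (Valuation.Integers.isUnit_iff_valuation_eq_one
      (Valuation.integer.integers (valuation F))).mp hu
  have h1 := (val_le_one_iff (E := E) (2 : F)).mpr hF.le
  have h2 := (val_lt_one_iff (E := E) (2 : F)).not.mpr hF.not_lt
  rw [map_ofNat] at h1 h2
  exact le_antisymm h1 (not_lt.mp h2)

/-- Near an element whose norm is close to one there is an element of norm one. -/
lemma exists_normOne_near (h2 : valuation E (2 : E) = 1) {k : ℤ} (hk : 1 ≤ k) {a : E}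
    (ha : a * σ a - 1 ∈ PE ϖ k) : ∃ b : E1 σ, a - ((b : Eˣ) : E) ∈ PE ϖ k := by
  have h1 : valuation E (a * σ a) = 1 := by
    have := Valuation.map_one_add_of_lt (v := valuation E) (mem_PE_one.mp (PE_anti hk ha))
    rwa [add_sub_cancel] at this
  have hva : valuation E a = 1 := by
    rw [map_mul, val_conj] at h1
    rcases lt_trichotomy (valuation E a) 1 with h | h | h
    · exact absurd h1 (mul_lt_one_of_lt_of_le h h.le).ne
    · exact h
    · exact absurd h1 (one_lt_mul_of_lt_of_le' h h.le).ne'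
  -- for a sign `e` the element `w = 1 + e a` is a unit, and `e w / σ w` is the required element
  have hsign : ∃ e : E, σ e = e ∧ e * e = 1 ∧ valuation E (1 + e * a) = 1 := by
    by_contra! h0
    have h3 : ∀ e : E, e * e = 1 → σ e = e → valuation E (1 + e * a) < 1 := by
      intro e he he'
      refine lt_of_le_of_ne (Valuation.map_add_le _ (by simp) ?_) (h0 e he' he)
      have : valuation E e * valuation E e = 1 := by rw [← map_mul, he, map_one]
      have he1 : valuation E e ≤ 1 := by
        by_contra hlt
        rw [not_le] at hlt
        exact absurd this (one_lt_mul_of_lt_of_le' hlt hlt.le).ne'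
      rw [map_mul, hva, mul_one]
      exact he1
    have h4 := Valuation.map_add_lt _ (h3 1 (by ring) (map_one σ)) (h3 (-1) (by ring) (by simp))
    have h5 : (1 + 1 * a) + (1 + -1 * a) = (2 : E) := by ring
    rw [h5, h2] at h4
    exact lt_irrefl _ h4
  obtain ⟨e, he, hee, hw⟩ := hsign
  have hw0 : 1 + e * a ≠ 0 := by
    rw [← (valuation E).ne_zero_iff, hw]; exact one_ne_zero
  have hσw : σ (1 + e * a) ≠ 0 := (map_ne_zero σ).mpr hw0
  have he0 : e ≠ 0 := left_ne_zero_of_mul_eq_one hee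
  have hn : e * (1 + e * a) / σ (1 + e * a) * σ (e * (1 + e * a) / σ (1 + e * a)) = 1 := by
    rw [map_div₀, map_mul, conj_conj, he]
    field_simp
    linear_combination hee
  refine ⟨⟨Units.mk0 _ (div_ne_zero (mul_ne_zero he0 hw0) hσw), hn⟩, ?_⟩
  rw [Units.val_mk0]
  have h6 : a - e * (1 + e * a) / σ (1 + e * a) = e * (a * σ a - 1) * (σ (1 + e * a))⁻¹ := by
    have hσ1 : σ (1 + e * a) = 1 + e * σ a := by rw [map_add, map_one, map_mul, he]
    rw [hσ1] at hσw ⊢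
    field_simp
    linear_combination (-a) * hee
  rw [h6, mem_PE, map_mul, map_mul, map_inv₀, val_conj, hw, inv_one, mul_one]
  have hve : valuation E e = 1 := by
    apply val_norm_one σ; rw [he, hee]
  rw [hve, one_mul]
  exact ha

/-! ### Reduction to the residue field -/

open scoped Classical in
/-- The image in the residue field of an integral element, and `0` for other elements. -/
noncomputable def red (x : E) : 𝓀[E] :=
  if hx : valuation E x ≤ 1 then IsLocalRing.residue 𝒪[E] ⟨x, hx⟩ else 0

lemma red_of_le {x : E} (hx : valuation E x ≤ 1) :
    red x = IsLocalRing.residue 𝒪[E] ⟨x, hx⟩ := dif_pos hx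

lemma red_add {x y : E} (hx : valuation E x ≤ 1) (hy : valuation E y ≤ 1) :
    red (x + y) = red x + red y := by
  rw [red_of_le hx, red_of_le hy, red_of_le (Valuation.map_add_le _ hx hy), ← map_add]
  rfl

lemma red_mul {x y : E} (hx : valuation E x ≤ 1) (hy : valuation E y ≤ 1) :
    red (x * y) = red x * red y := by
  have hxy : valuation E (x * y) ≤ 1 := by
    rw [map_mul]; exact mul_le_one' hx hy
  rw [red_of_le hx, red_of_le hy, red_of_le hxy, ← map_mul]
  rfl

lemma red_one : red (1 : E) = 1 := by
  rw [red_of_le (by simp), ← map_one (IsLocalRing.residue 𝒪[E])]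
  rfl

lemma red_eq_zero_iff {x : E} (hx : valuation E x ≤ 1) : red x = 0 ↔ valuation E x < 1 := by
  rw [red_of_le hx, IsLocalRing.residue_eq_zero_iff, IsLocalRing.mem_maximalIdeal,
    mem_nonunits_iff, Valuation.Integers.isUnit_iff_valuation_eq_one
      (Valuation.integer.integers (valuation E))]
  exact ⟨fun h ↦ lt_of_le_of_ne hx h, fun h ↦ h.ne⟩

lemma red_neg {x : E} (hx : valuation E x ≤ 1) : red (-x) = -red x := by
  have h1 : valuation E (-x) ≤ 1 := by rwa [Valuation.map_neg]
  rw [eq_neg_iff_add_eq_zero, ← red_add h1 hx, neg_add_cancel, red_eq_zero_iff (by simp)]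
  simp

lemma red_eq_iff {x y : E} (hx : valuation E x ≤ 1) (hy : valuation E y ≤ 1) :
    red x = red y ↔ valuation E (x - y) < 1 := by
  have h1 : valuation E (-y) ≤ 1 := by rwa [Valuation.map_neg]
  rw [← sub_eq_zero, sub_eq_add_neg, ← red_neg hy, ← red_add hx h1, ← sub_eq_add_neg,
    red_eq_zero_iff]
  rw [sub_eq_add_neg]
  exact Valuation.map_add_le _ hx h1

lemma exists_red_eq (z : 𝓀[E]) : ∃ x : E, valuation E x ≤ 1 ∧ red x = z := by
  obtain ⟨x, rfl⟩ := IsLocalRing.residue_surjective z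
  exact ⟨x, x.2, red_of_le x.2⟩

lemma conj_mem_integer (σ : E ≃ₐ[F] E) (x : 𝒪[E]) : σ x ∈ 𝒪[E] :=
  (Valuation.mem_integer_iff _ _).mpr
    ((val_conj σ (x : E)).trans_le ((Valuation.mem_integer_iff _ _).mp x.2))

/-- The automorphism of the residue field induced by `σ`. -/
noncomputable def resConj (σ : E ≃ₐ[F] E) : 𝓀[E] ≃+* 𝓀[E] :=
  IsLocalRing.ResidueField.mapEquiv
    { toFun := fun x ↦ (⟨σ x, conj_mem_integer σ x⟩ : 𝒪[E])
      invFun := fun x ↦ (⟨σ x, conj_mem_integer σ x⟩ : 𝒪[E])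
      left_inv := fun x ↦ Subtype.ext (conj_conj σ x)
      right_inv := fun x ↦ Subtype.ext (conj_conj σ x)
      map_mul' := fun _ _ ↦ Subtype.ext (map_mul σ _ _)
      map_add' := fun _ _ ↦ Subtype.ext (map_add σ _ _) }

lemma resConj_red {x : E} (hx : valuation E x ≤ 1) : resConj σ (red x) = red (σ x) := by
  rw [red_of_le hx, red_of_le ((val_conj σ x).trans_le hx)]
  rfl

lemma resConj_resConj (σ : E ≃ₐ[F] E) (z : 𝓀[E]) : resConj σ (resConj σ z) = z := by
  obtain ⟨x, hx, rfl⟩ := exists_red_eq z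
  rw [resConj_red hx, resConj_red ((val_conj σ x).trans_le hx), conj_conj]

/-- The residue field of `F` is the fixed field of the conjugation on the residue field of `E`. -/
lemma card_residueField (hσ : σ ≠ 1) (h2 : valuation E (2 : E) = 1) :
    Nat.card 𝓀[F] = Nat.card (fixedField (resConj σ)) := by
  have hint : ∀ a : 𝒪[F], valuation E (algebraMap F E a) ≤ 1 := fun a ↦
    (val_le_one_iff _).mpr a.2
  have h20 : (2 : E) ≠ 0 := by
    rw [← (valuation E).ne_zero_iff, h2]; exact one_ne_zero
  let f : 𝒪[F] →+* 𝓀[E] :=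
    { toFun := fun a ↦ red (algebraMap F E a)
      map_one' := by simp [red_one]
      map_mul' := fun a b ↦ by
        rw [← red_mul (hint a) (hint b), ← map_mul]; rfl
      map_zero' := by simp [red_eq_zero_iff]
      map_add' := fun a b ↦ by
        rw [← red_add (hint a) (hint b), ← map_add]; rfl }
  have hf : ∀ a : 𝒪[F], f a = red (algebraMap F E a) := fun _ ↦ rfl
  have : IsLocalHom f := ⟨fun a ha ↦ by
    have h1 := ha.ne_zero
    rw [hf, Ne, red_eq_zero_iff (hint a), val_lt_one_iff, not_lt] at h1
    exact (Valuation.Integers.isUnit_iff_valuation_eq_one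
      (Valuation.integer.integers (valuation F))).mpr (le_antisymm a.2 h1)⟩
  let g : 𝓀[F] →+* 𝓀[E] := IsLocalRing.ResidueField.lift f
  refine (Nat.card_range_of_injective g.injective).symm.trans ?_
  refine Nat.card_congr (Equiv.setCongr ?_)
  ext z
  constructor
  · rintro ⟨a, rfl⟩
    obtain ⟨a, rfl⟩ := IsLocalRing.residue_surjective a
    change resConj σ (red _) = red _
    rw [resConj_red (hint a), AlgEquiv.commutes]
  · intro hz
    obtain ⟨x, hx, rfl⟩ := exists_red_eq z
    have hσx : valuation E (σ x) ≤ 1 := (val_conj σ x).trans_le hx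
    have hz' : red (σ x) = red x := by rw [← resConj_red hx]; exact hz
    obtain ⟨a, ha⟩ := mem_range_of_fixed hσ (x := (x + σ x) / 2)
      (by rw [map_div₀, map_add, conj_conj, map_ofNat, add_comm])
    have hv : valuation E (algebraMap F E a) ≤ 1 := by
      rw [ha, map_div₀, h2, div_one]
      exact Valuation.map_add_le _ hx hσx
    refine ⟨IsLocalRing.residue 𝒪[F] ⟨a, (val_le_one_iff a).mp hv⟩, ?_⟩
    change red (algebraMap F E a) = red x
    rw [red_eq_iff hv hx, ha]
    have h3 : (x + σ x) / 2 - x = (σ x - x) / 2 := by field_simp; ring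
    rw [h3, map_div₀, h2, div_one]
    exact (red_eq_iff hσx hx).mp hz'

end LocalField

/-! ### The norm one group of the quaternion algebra -/

section Reduction

variable {F E : Type*} [Field F] [ValuativeRel F] [TopologicalSpace F]
  [IsNonarchimedeanLocalField F] [Field E] [ValuativeRel E] [TopologicalSpace E]
  [IsNonarchimedeanLocalField E] [Algebra F E] [ValuativeExtension F E]
  [Algebra.IsQuadraticExtension F E] {σ : E ≃ₐ[F] E} {ϖ : UnramifiedUniformizer F E}

lemma mem_D1 {k : ℕ} {x : GL (Fin 2) E} : x ∈ D1 σ ϖ k ↔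
    (x : Matrix (Fin 2) (Fin 2) E) ∈ quat σ ϖ ∧ (x : Matrix (Fin 2) (Fin 2) E).det = 1 ∧
      x 0 0 - 1 ∈ PE ϖ (((k : ℤ) + 1) / 2) ∧ x 0 1 ∈ PE ϖ ((k : ℤ) / 2) := by
  change _ ∧ _ ∧ _ ↔ _
  refine and_congr_right fun h1 ↦ and_congr_right fun h2 ↦ ?_
  rw [mem_PD]
  simp only [Matrix.sub_apply, Matrix.one_apply_eq, Matrix.one_apply_ne zero_ne_one, sub_zero]
  exact and_iff_right (sub_mem h1 (one_mem _))

lemma D1_entry_11 {k : ℕ} {x : GL (Fin 2) E} (hx : x ∈ D1 σ ϖ k) : x 1 1 = σ (x 0 0) := hx.1.1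

lemma D1_entry_10 {k : ℕ} {x : GL (Fin 2) E} (hx : x ∈ D1 σ ϖ k) :
    x 1 0 = algebraMap F E ϖ.val * σ (x 0 1) := hx.1.2

lemma D1_mul_00 {k : ℕ} (x : GL (Fin 2) E) {x' : GL (Fin 2) E} (hx' : x' ∈ D1 σ ϖ k) :
    (x * x') 0 0 = x 0 0 * x' 0 0 + x 0 1 * (algebraMap F E ϖ.val * σ (x' 0 1)) := by
  rw [Units.val_mul, Matrix.mul_apply, Fin.sum_univ_two, D1_entry_10 hx']

lemma D1_mul_01 {k : ℕ} (x : GL (Fin 2) E) {x' : GL (Fin 2) E} (hx' : x' ∈ D1 σ ϖ k) :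
    (x * x') 0 1 = x 0 0 * x' 0 1 + x 0 1 * σ (x' 0 0) := by
  rw [Units.val_mul, Matrix.mul_apply, Fin.sum_univ_two, D1_entry_11 hx']

lemma D1_det {k : ℕ} {x : GL (Fin 2) E} (hx : x ∈ D1 σ ϖ k) :
    x 0 0 * σ (x 0 0) - algebraMap F E ϖ.val * (x 0 1 * σ (x 0 1)) = 1 := by
  have := hx.2.1
  rw [Matrix.det_fin_two, D1_entry_11 hx, D1_entry_10 hx] at this
  linear_combination this

/-- The matrix of an element `a + c δ` of norm one. -/
lemma exists_quat {a c : E} (h : a * σ a - algebraMap F E ϖ.val * (c * σ c) = 1) :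
    ∃ x : GL (Fin 2) E, (x : Matrix (Fin 2) (Fin 2) E) ∈ quat σ ϖ ∧
      (x : Matrix (Fin 2) (Fin 2) E).det = 1 ∧ x 0 0 = a ∧ x 0 1 = c := by
  have hdet : (!![a, c; algebraMap F E ϖ.val * σ c, σ a] : Matrix (Fin 2) (Fin 2) E).det = 1 := by
    rw [Matrix.det_fin_two_of]; linear_combination h
  refine ⟨Matrix.GeneralLinearGroup.mkOfDetNeZero _ (by rw [hdet]; exact one_ne_zero), ?_, hdet,
    rfl, rfl⟩
  exact ⟨rfl, rfl⟩

/-- The Cayley transform `(1 + t δ) / (1 - t δ)`. -/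
lemma exists_cayley (h2 : valuation E (2 : E) = 1) {k : ℕ} {t : E} (ht : t ∈ PE ϖ k) :
    ∃ x ∈ D1 σ ϖ (2 * k + 1), σ (x 0 0) = x 0 0 ∧
      ∃ e : E, σ e = e ∧ valuation E e < 1 ∧ x 0 1 = 2 * t * (1 + e) := by
  let s : E := algebraMap F E ϖ.val * (t * σ t)
  have hs : s ∈ PE ϖ (k + 1) := by
    refine PE_anti (by omega) (PE_mul (unif_mem_PE ϖ) (PE_mul ht (PE_conj σ ht)))
  have hσs : σ s = s := by
    simp only [s, map_mul, AlgEquiv.commutes, conj_conj]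
    ring
  have hs1 : valuation E s < 1 := mem_PE_one.mp (PE_anti (by omega) hs)
  have hv : valuation E (1 - s) = 1 := by
    rw [sub_eq_add_neg]
    exact Valuation.map_one_add_of_lt (v := valuation E) ((Valuation.map_neg _ s).trans_lt hs1)
  have h0 : 1 - s ≠ 0 := by
    rw [← (valuation E).ne_zero_iff, hv]; exact one_ne_zero
  have hσ1 : σ ((1 + s) / (1 - s)) = (1 + s) / (1 - s) := by
    rw [map_div₀, map_add, map_sub, map_one, hσs]
  have h3 : (1 + s) / (1 - s) * σ ((1 + s) / (1 - s)) -
      algebraMap F E ϖ.val * (2 * t / (1 - s) * σ (2 * t / (1 - s))) = 1 := by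
    rw [hσ1, map_div₀, map_mul, map_ofNat, map_sub, map_one, hσs]
    have h4 : algebraMap F E ϖ.val * (2 * t / (1 - s) * (2 * σ t / (1 - s))) =
        4 * s / (1 - s) ^ 2 := by
      simp only [s]; field_simp; ring
    rw [h4]
    field_simp
    ring
  obtain ⟨x, hq, hd, hx0, hx1⟩ := exists_quat h3
  have hval : ∀ {z : E} {l : ℤ}, z ∈ PE ϖ l → z / (1 - s) ∈ PE ϖ l := fun hz ↦ by
    rw [mem_PE, map_div₀, hv, div_one]; exact hz
  have htwo : ∀ {z : E} {l : ℤ}, z ∈ PE ϖ l → 2 * z ∈ PE ϖ l := fun hz ↦ by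
    rw [mem_PE, map_mul, h2, one_mul]; exact hz
  refine ⟨x, mem_D1.mpr ⟨hq, hd, ?_, ?_⟩, by rw [hx0, hσ1], s / (1 - s), ?_, ?_, ?_⟩
  · have h5 : (1 + s) / (1 - s) - 1 = 2 * s / (1 - s) := by field_simp; ring
    rw [hx0, h5]
    exact PE_anti (by push_cast; omega) (hval (htwo hs))
  · rw [hx1]
    exact PE_anti (by push_cast; omega) (hval (htwo ht))
  · rw [map_div₀, map_sub, map_one, hσs]
  · rw [map_div₀, hv, div_one]; exact hs1
  · rw [hx1]; field_simp; ring

/-- The reduction of elements of norm one modulo the maximal ideal. -/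
noncomputable def redHom (σ : E ≃ₐ[F] E) : E1 σ →* normOne (resConj σ) where
  toFun a := ⟨Units.mk0 (red ((a : Eˣ) : E)) (by
      rw [Ne, red_eq_zero_iff (val_norm_one σ a.2).le, val_norm_one σ a.2]
      exact lt_irrefl _), by
    rw [mem_normOne, Units.val_mk0, resConj_red (val_norm_one σ a.2).le,
      ← red_mul (val_norm_one σ a.2).le ((val_conj σ _).trans_le (val_norm_one σ a.2).le), a.2,
      red_one]⟩
  map_one' := Subtype.ext (Units.ext red_one)
  map_mul' a b := Subtype.ext (Units.ext
    (red_mul (val_norm_one σ a.2).le (val_norm_one σ b.2).le))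

lemma redHom_coe (a : E1 σ) : ((redHom σ a : 𝓀[E]ˣ) : 𝓀[E]) = red ((a : Eˣ) : E) := rfl

lemma redHom_eq_one_iff {a : E1 σ} : redHom σ a = 1 ↔ a ∈ E11 σ := by
  rw [Subtype.ext_iff, Units.ext_iff, redHom_coe]
  change red _ = 1 ↔ valuation E (((a : Eˣ) : E) - 1) < 1
  rw [← red_one, red_eq_iff (val_norm_one σ a.2).le (by simp)]

lemma redHom_surjective (h2 : valuation E (2 : E) = 1) (ϖ : UnramifiedUniformizer F E) :
    Function.Surjective (redHom σ) := by
  rintro ⟨u, hu⟩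
  obtain ⟨a, ha, hau⟩ := exists_red_eq (u : 𝓀[E])
  have hσa : valuation E (σ a) ≤ 1 := (val_conj σ a).trans_le ha
  rw [mem_normOne, ← hau, resConj_red ha, ← red_mul ha hσa, ← red_one, red_eq_iff
    (by rw [map_mul]; exact mul_le_one' ha hσa) (by simp), ← mem_PE_one (ϖ := ϖ)] at hu
  obtain ⟨b, hb⟩ := exists_normOne_near h2 le_rfl hu
  refine ⟨b, Subtype.ext (Units.ext ?_)⟩
  rw [redHom_coe, ← hau]
  exact ((red_eq_iff ha (val_norm_one σ b.2).le).mpr (mem_PE_one.mp hb)).symm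

lemma mem_E10_iff {a : E1 σ} :
    a ∈ E10 σ ↔ redHom σ (a * a) = 1 := by
  rw [redHom_eq_one_iff]
  change (a : Eˣ) ∈ (Units.map (algebraMap F E).toMonoidHom).range ⊔ oneUnits E ↔ valuation E (((a : Eˣ) : E) * ((a : Eˣ) : E) - 1) < 1
  have ha := val_norm_one σ a.2
  have ha' : ((a : Eˣ) : E) * σ ((a : Eˣ) : E) = 1 := a.2
  constructor
  · intro h
    obtain ⟨_, ⟨f, rfl⟩, u, hu, hfu⟩ := Subgroup.mem_sup.mp h
    have hu' : valuation E ((u : E) - 1) < 1 := hu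
    have hvu : valuation E (u : E) = 1 := by
      have := Valuation.map_one_add_of_lt (v := valuation E) hu'
      rwa [add_sub_cancel] at this
    have hfu' : ((a : Eˣ) : E) = algebraMap F E f * u := congrArg Units.val hfu.symm
    have hf0 : algebraMap F E f ≠ 0 := by simp
    have hu0 : (σ (u : E)) ≠ 0 := by simp
    -- `a² = a / σ a = u / σ u`
    have h1 : ((a : Eˣ) : E) * ((a : Eˣ) : E) = u / σ (u : E) := by
      have h3 : σ ((a : Eˣ) : E) ≠ 0 := right_ne_zero_of_mul_eq_one ha'
      have h2 : ((a : Eˣ) : E) = ((a : Eˣ) : E) / σ ((a : Eˣ) : E) / ((a : Eˣ) : E) := by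
        field_simp
        linear_combination ha'
      have h4 : ((a : Eˣ) : E) * ((a : Eˣ) : E) = ((a : Eˣ) : E) / σ ((a : Eˣ) : E) := by
        rw [eq_div_iff h3]; linear_combination ((a : Eˣ) : E) * ha'
      rw [h4, hfu', map_mul, AlgEquiv.commutes, mul_div_mul_left _ _ hf0]
    have h5 : (u : E) / σ (u : E) - 1 = ((u - 1) - σ (u - 1 : E)) / σ (u : E) := by
      rw [map_sub, map_one]; field_simp; ring
    rw [h1, h5, map_div₀, val_conj, hvu, div_one]
    exact Valuation.map_sub_lt _ hu' ((val_conj σ _).trans_lt hu')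
  · intro h
    have h1 : valuation E (((a : Eˣ) : E) - 1) < 1 ∨ valuation E (((a : Eˣ) : E) + 1) < 1 := by
      by_contra! h0
      have h3 : ((a : Eˣ) : E) * ((a : Eˣ) : E) - 1 =
        (((a : Eˣ) : E) - 1) * (((a : Eˣ) : E) + 1) := by ring
      rw [h3, map_mul] at h
      exact absurd h (not_lt.mpr (one_le_mul h0.1 h0.2))
    rcases h1 with h1 | h1
    · exact Subgroup.mem_sup_right h1
    · have h3 : (a : Eˣ) = (-1) * (-(a : Eˣ)) := by simp
      rw [h3]
      refine Subgroup.mul_mem_sup ⟨-1, Units.ext (by simp)⟩ ?_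
      change valuation E (-((a : Eˣ) : E) - 1) < 1
      rwa [← neg_add', Valuation.map_neg]

lemma E11_le_E10 (σ : E ≃ₐ[F] E) : E11 σ ≤ E10 σ := fun a ha ↦ by
  rw [mem_E10_iff, map_mul, redHom_eq_one_iff.mpr ha, one_mul]

end Reduction

/-! ### The bicharacter attached to the datum -/

section EvenDatum

variable {F E : Type*} [Field F] [ValuativeRel F] [TopologicalSpace F]
  [IsNonarchimedeanLocalField F] [Field E] [ValuativeRel E] [TopologicalSpace E]
  [IsNonarchimedeanLocalField E] [Algebra F E] [ValuativeExtension F E]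
  [Algebra.IsQuadraticExtension F E] {σ : E ≃ₐ[F] E} {ϖ : UnramifiedUniformizer F E}
  {ψ : AddChar F ℂ} {n r : ℕ} {β : Matrix (Fin 2) (Fin 2) E} {γ ζ : E1 σ →* ℂˣ}

/-- The case `n = 4 j + 2`, `r = 2 j + 2` of the data, with a traceless element `y` of `E` near
`β`. -/
structure IsEvenDatum (h : IsDatum σ ϖ ψ n r β γ ζ) (j : ℕ) (y : E) : Prop where
  r_eq_add : r = 2 * j + 2
  n_eq_add : n = 4 * j + 2
  val_two_eq : valuation E (2 : E) = 1
  conj_y : σ y = -y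
  near_y : β - !![y, 0; 0, σ y] ∈ PD σ ϖ (1 - r)
  val_y : valuation E y = valuation E (algebraMap F E ϖ.val) ^ (-(2 * j + 1) : ℤ)

lemma exists_isEvenDatum (hp : ringChar 𝓀[F] ≠ 2) (h : IsDatum σ ϖ ψ n r β γ ζ) (hn : Even n)
    (hr : Even r) : ∃ j y, IsEvenDatum h j y := by
  have hr' := h.r_eq
  have hn' := h.one_le
  obtain ⟨m, hm⟩ := hn
  obtain ⟨l, hl⟩ := hr
  obtain ⟨j, rfl⟩ : ∃ j, l = j + 1 := ⟨l - 1, by omega⟩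
  obtain ⟨y, hy, hβy⟩ := h.near
  have hr2 : r = 2 * j + 2 := by omega
  have hn2 : n = 4 * j + 2 := by omega
  have hσy : σ y = -y := by linear_combination hy
  refine ⟨j, y, hr2, hn2, val_two hp, hσy, hβy, ?_⟩
  obtain ⟨hβ1, hβ2, hβ3⟩ := (mem_PD σ ϖ _ _).mp h.mem_PD
  obtain ⟨hd1, hd2, hd3⟩ := (mem_PD σ ϖ _ _).mp hβy
  simp only [Matrix.sub_apply, Matrix.of_apply, Matrix.cons_val', Matrix.cons_val_zero,
    Matrix.cons_val_one, Matrix.cons_val_fin_one, sub_zero] at hd2 hd3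
  have hy1 : y ∈ PE ϖ (-(2 * j + 1) : ℤ) := by
    have := PE_sub (PE_anti (j := (-(2 * j + 1) : ℤ)) (by omega) hβ2)
      (PE_anti (j := (-(2 * j + 1) : ℤ)) (by omega) hd2)
    rwa [sub_sub_cancel] at this
  refine le_antisymm hy1 (le_val_of_notMem_PE fun hy2 ↦ h.not_mem_PD ?_)
  rw [mem_PD]
  refine ⟨hβ1, ?_, PE_anti (by omega) hd3⟩
  have := PE_add (PE_anti (j := (-(n : ℤ) + 1 + 1) / 2) (by omega) hd2)
    (PE_anti (j := (-(n : ℤ) + 1 + 1) / 2) (by omega) hy2)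
  rwa [sub_add_cancel] at this

/-- The function `a + c δ ↦ ψ (Tr (y (a - 1)))`, which extends `ψ_β` to a larger group on which it
is no longer multiplicative. -/
noncomputable def psiY (ψ : AddChar F ℂ) (y : E) (x : GL (Fin 2) E) : ℂ :=
  ψ (Algebra.trace F E (y * (x 0 0 - 1)))

/-- The class of `c ϖ⁻ʲ` in the residue field, for an element `a + c δ`. -/
noncomputable def cls (ϖ : UnramifiedUniformizer F E) (j : ℕ) (x : GL (Fin 2) E) : 𝓀[E] :=
  red (x 0 1 * (algebraMap F E ϖ.val) ^ (-j : ℤ))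

lemma IsDatum.psi_trace_eq_one (h : IsDatum σ ϖ ψ n r β γ ζ) {z : E} (hz : valuation E z < 1) :
    ψ (Algebra.trace F E z) = 1 := by
  apply h.psi_eq_one
  rw [← val_lt_one_iff (E := E), algebraMap_trace h.conj_ne_one]
  exact Valuation.map_add_lt _ hz ((val_conj σ z).trans_lt hz)

lemma IsDatum.trace_conj (h : IsDatum σ ϖ ψ n r β γ ζ) (z : E) :
    Algebra.trace F E (σ z) = Algebra.trace F E z := by
  apply (algebraMap F E).injective
  rw [algebraMap_trace h.conj_ne_one, algebraMap_trace h.conj_ne_one, conj_conj, add_comm]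

namespace IsEvenDatum

variable {h : IsDatum σ ϖ ψ n r β γ ζ} {j : ℕ} {y : E}

/-- The unit `y ϖ ^ (2 j + 1)`. -/
noncomputable def unit (_ : IsEvenDatum h j y) : E := y * (algebraMap F E ϖ.val) ^ (2 * j + 1 : ℤ)

variable (H : IsEvenDatum h j y)
include H

lemma val_unit : valuation E H.unit = 1 := by
  rw [unit, map_mul, H.val_y, map_zpow₀, ← zpow_add₀ (val_unif_pos ϖ).ne', neg_add_cancel, zpow_zero]

lemma val_unit_mul (x : E) : valuation E (H.unit * x) = valuation E x := by
  rw [map_mul, H.val_unit, one_mul]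

lemma conj_unit : σ H.unit = -H.unit := by
  rw [unit, map_mul, map_zpow₀, AlgEquiv.commutes, H.conj_y, neg_mul]

lemma psi_unit_congr {x x' : E} (hx : valuation E (x - x') < 1) :
    ψ (Algebra.trace F E (H.unit * x)) = ψ (Algebra.trace F E (H.unit * x')) := by
  have h1 : H.unit * x = H.unit * (x - x') + H.unit * x' := by ring
  rw [h1, map_add, AddChar.map_add_eq_mul, h.psi_trace_eq_one ((H.val_unit_mul _).trans_lt hx),
    one_mul]

/-- The additive character `z ↦ ψ (Tr (y ϖ ^ (2 j + 1) z))` of the residue field of `E`. -/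
noncomputable def resChar : AddChar 𝓀[E] ℂ where
  toFun z := ψ (Algebra.trace F E (H.unit * (exists_red_eq z).choose))
  map_zero_eq_one' := by
    obtain ⟨h1, h2⟩ := (exists_red_eq (0 : 𝓀[E])).choose_spec
    rw [red_eq_zero_iff h1] at h2
    exact h.psi_trace_eq_one ((H.val_unit_mul _).trans_lt h2)
  map_add_eq_mul' a b := by
    obtain ⟨h1, h2⟩ := (exists_red_eq a).choose_spec
    obtain ⟨h3, h4⟩ := (exists_red_eq b).choose_spec
    obtain ⟨h5, h6⟩ := (exists_red_eq (a + b)).choose_spec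
    rw [← AddChar.map_add_eq_mul, ← map_add, ← mul_add]
    apply H.psi_unit_congr
    rw [← red_eq_iff h5 (Valuation.map_add_le _ h1 h3), red_add h1 h3, h2, h4, h6]

lemma resChar_red {x : E} (hx : valuation E x ≤ 1) :
    H.resChar (red x) = ψ (Algebra.trace F E (H.unit * x)) := by
  obtain ⟨h1, h2⟩ := (exists_red_eq (red x)).choose_spec
  exact H.psi_unit_congr ((red_eq_iff h1 hx).mp h2)

lemma isOddCharacter : IsOddCharacter (resConj σ) H.resChar where
  two_ne_zero := by
    have h1 : red (2 : E) = 2 := by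
      have : (2 : E) = 1 + 1 := by norm_num
      rw [this, red_add (by simp) (by simp), red_one]
      norm_num
    rw [← h1, Ne, red_eq_zero_iff H.val_two_eq.le, H.val_two_eq]
    exact lt_irrefl _
  involutive := resConj_resConj σ
  map_conj z := by
    obtain ⟨x, hx, rfl⟩ := exists_red_eq z
    have h1 : valuation E (-x) ≤ 1 := by rwa [Valuation.map_neg]
    rw [resConj_red hx, ← red_neg hx, H.resChar_red ((val_conj σ x).trans_le hx),
      H.resChar_red h1, ← h.trace_conj, map_mul σ, conj_conj, H.conj_unit]
    congr 2
    ring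
  exists_ne_one := by
    obtain ⟨t, ht, hψ⟩ := h.psi_ne_one
    have h0 : H.unit ≠ 0 := by
      rw [← (valuation E).ne_zero_iff, H.val_unit]; exact one_ne_zero
    have h20 : (2 : E) ≠ 0 := by
      rw [← (valuation E).ne_zero_iff, H.val_two_eq]; exact one_ne_zero
    refine ⟨red (algebraMap F E t / (2 * H.unit)), ?_⟩
    rw [H.resChar_red]
    · have h1 : H.unit * (algebraMap F E t / (2 * H.unit)) = algebraMap F E t / 2 := by
        field_simp
      have h2 : Algebra.trace F E (algebraMap F E t / 2) = t := by
        apply (algebraMap F E).injective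
        rw [algebraMap_trace h.conj_ne_one, map_div₀, AlgEquiv.commutes, map_ofNat]
        field_simp
        norm_num
      rwa [h1, h2]
    · rw [map_div₀, map_mul, H.val_two_eq, H.val_unit, one_mul, div_one]
      exact (val_le_one_iff t).mpr ht

lemma mem_D1_pred {x : GL (Fin 2) E} : x ∈ D1 σ ϖ (r - 1) ↔
    (x : Matrix (Fin 2) (Fin 2) E) ∈ quat σ ϖ ∧ (x : Matrix (Fin 2) (Fin 2) E).det = 1 ∧
      x 0 0 - 1 ∈ PE ϖ (j + 1) ∧ x 0 1 ∈ PE ϖ j := by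
  have := H.r_eq_add
  rw [mem_D1, show (((r - 1 : ℕ) : ℤ) + 1) / 2 = j + 1 by omega,
    show ((r - 1 : ℕ) : ℤ) / 2 = j by omega]

lemma mem_D1_r {x : GL (Fin 2) E} : x ∈ D1 σ ϖ r ↔
    (x : Matrix (Fin 2) (Fin 2) E) ∈ quat σ ϖ ∧ (x : Matrix (Fin 2) (Fin 2) E).det = 1 ∧
      x 0 0 - 1 ∈ PE ϖ (j + 1) ∧ x 0 1 ∈ PE ϖ (j + 1) := by
  have := H.r_eq_add
  rw [mem_D1, show ((r : ℤ) + 1) / 2 = j + 1 by omega, show (r : ℤ) / 2 = j + 1 by omega]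

lemma val_cls_arg {x : GL (Fin 2) E} (hx : x ∈ D1 σ ϖ (r - 1)) :
    valuation E (x 0 1 * (algebraMap F E ϖ.val) ^ (-j : ℤ)) ≤ 1 := by
  rw [← mem_PE_zero (ϖ := ϖ), mul_unif_zpow_mem_PE, zero_sub, neg_neg]
  exact (H.mem_D1_pred.mp hx).2.2.2

lemma cls_eq_zero_iff {x : GL (Fin 2) E} (hx : x ∈ D1 σ ϖ (r - 1)) :
    cls ϖ j x = 0 ↔ x ∈ D1 σ ϖ r := by
  rw [cls, red_eq_zero_iff (H.val_cls_arg hx), ← mem_PE_one (ϖ := ϖ), mul_unif_zpow_mem_PE,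
    sub_neg_eq_add, add_comm, H.mem_D1_r]
  obtain ⟨h1, h2, h3, -⟩ := H.mem_D1_pred.mp hx
  exact ⟨fun h4 ↦ ⟨h1, h2, h3, h4⟩, fun h4 ↦ h4.2.2.2⟩

lemma cls_mul {x x' : GL (Fin 2) E} (hx : x ∈ D1 σ ϖ (r - 1)) (hx' : x' ∈ D1 σ ϖ (r - 1)) :
    cls ϖ j (x * x') = cls ϖ j x + cls ϖ j x' := by
  rw [cls, cls, cls, ← red_add (H.val_cls_arg hx) (H.val_cls_arg hx'),
    red_eq_iff (H.val_cls_arg (mul_mem hx hx'))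
      (Valuation.map_add_le _ (H.val_cls_arg hx) (H.val_cls_arg hx')), D1_mul_01 x hx']
  obtain ⟨-, -, h1, h2⟩ := H.mem_D1_pred.mp hx
  obtain ⟨-, -, h3, h4⟩ := H.mem_D1_pred.mp hx'
  have h5 : (x 0 0 * x' 0 1 + x 0 1 * σ (x' 0 0)) * (algebraMap F E ϖ.val) ^ (-j : ℤ) -
      (x 0 1 * (algebraMap F E ϖ.val) ^ (-j : ℤ) + x' 0 1 * (algebraMap F E ϖ.val) ^ (-j : ℤ)) =
      ((x 0 0 - 1) * x' 0 1 + x 0 1 * σ (x' 0 0 - 1)) * (algebraMap F E ϖ.val) ^ (-j : ℤ) := by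
    rw [map_sub, map_one]; ring
  rw [h5, ← mem_PE_one (ϖ := ϖ), mul_unif_zpow_mem_PE]
  exact PE_add (PE_anti (by omega) (PE_mul h1 h4)) (PE_anti (by omega) (PE_mul h2 (PE_conj σ h3)))

lemma y_mem_PE : y ∈ PE ϖ (-(2 * j + 1) : ℤ) := H.val_y.le

/-- The function `psiY` fails to be multiplicative by the bicharacter attached to `resChar`. -/
lemma psiY_mul {x x' : GL (Fin 2) E} (hx : x ∈ D1 σ ϖ (r - 1)) (hx' : x' ∈ D1 σ ϖ (r - 1)) :
    psiY ψ y (x * x') = psiY ψ y x * psiY ψ y x' *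
      H.resChar (cls ϖ j x * resConj σ (cls ϖ j x')) := by
  have hσv : valuation E (σ (x' 0 1 * (algebraMap F E ϖ.val) ^ (-j : ℤ))) ≤ 1 :=
    (val_conj σ _).trans_le (H.val_cls_arg hx')
  rw [cls, cls, resConj_red (H.val_cls_arg hx'), ← red_mul (H.val_cls_arg hx) hσv, H.resChar_red
    (by rw [map_mul]; exact mul_le_one' (H.val_cls_arg hx) hσv), psiY, psiY, psiY,
    D1_mul_00 x hx']
  obtain ⟨-, -, h1, h2⟩ := H.mem_D1_pred.mp hx
  obtain ⟨-, -, h3, h4⟩ := H.mem_D1_pred.mp hx'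
  have h5 : y * (x 0 0 * x' 0 0 + x 0 1 * (algebraMap F E ϖ.val * σ (x' 0 1)) - 1) =
      y * ((x 0 0 - 1) * (x' 0 0 - 1)) + (y * (x 0 0 - 1) + (y * (x' 0 0 - 1) +
        H.unit * (x 0 1 * (algebraMap F E ϖ.val) ^ (-j : ℤ) *
          σ (x' 0 1 * (algebraMap F E ϖ.val) ^ (-j : ℤ))))) := by
    have h6 : H.unit * (x 0 1 * (algebraMap F E ϖ.val) ^ (-j : ℤ) *
        σ (x' 0 1 * (algebraMap F E ϖ.val) ^ (-j : ℤ))) =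
        y * (x 0 1 * σ (x' 0 1)) * ((algebraMap F E ϖ.val) ^ (2 * j + 1 : ℤ) *
          ((algebraMap F E ϖ.val) ^ (-j : ℤ) * (algebraMap F E ϖ.val) ^ (-j : ℤ))) := by
      rw [unit, map_mul, map_zpow₀, AlgEquiv.commutes]; ring
    rw [h6, ← zpow_add₀ (unif_ne_zero ϖ), ← zpow_add₀ (unif_ne_zero ϖ),
      show (2 * j + 1 + (-j + -j) : ℤ) = 1 by ring, zpow_one]
    ring
  rw [h5, map_add (Algebra.trace F E), map_add (Algebra.trace F E), map_add (Algebra.trace F E),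
    AddChar.map_add_eq_mul, AddChar.map_add_eq_mul,
    AddChar.map_add_eq_mul, h.psi_trace_eq_one, one_mul, ← mul_assoc (ψ _)]
  rw [← mem_PE_one (ϖ := ϖ)]
  exact PE_anti (by omega) (PE_mul H.y_mem_PE (PE_mul h1 h3))

lemma psi_eq_psiY {x : GL (Fin 2) E} (hx : x ∈ D1 σ ϖ r) : psi ψ β x = psiY ψ y x := by
  have h1 : β * ((x : Matrix (Fin 2) (Fin 2) E) - 1) =
      (β - !![y, 0; 0, σ y]) * (x - 1) + !![y, 0; 0, σ y] * (x - 1) := by noncomm_ring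
  rw [psi, h1, trd_add, AddChar.map_add_eq_mul, psi_trd_eq_one h, one_mul]
  · simp [trd, psiY, Matrix.mul_apply, Fin.sum_univ_two]
  · exact PD_anti (by omega) (PD_mul H.near_y hx.2.2)

lemma exists_cls_eq (z : 𝓀[E]) : ∃ x ∈ D1 σ ϖ (r - 1), cls ϖ j x = z := by
  obtain ⟨w, hw, rfl⟩ := exists_red_eq z
  have h20 : (2 : E) ≠ 0 := by
    rw [← (valuation E).ne_zero_iff, H.val_two_eq]; exact one_ne_zero
  have ht : w / 2 * (algebraMap F E ϖ.val) ^ (j : ℤ) ∈ PE ϖ j := by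
    rw [mul_unif_zpow_mem_PE, sub_self, mem_PE_zero, map_div₀, H.val_two_eq, div_one]
    exact hw
  obtain ⟨x, hx, -, e, -, he, hxe⟩ := exists_cayley (σ := σ) H.val_two_eq ht
  have hr : 2 * j + 1 = r - 1 := by have := H.r_eq_add; omega
  rw [hr] at hx
  refine ⟨x, hx, ?_⟩
  rw [cls, red_eq_iff (H.val_cls_arg hx) hw, hxe]
  have h1 : 2 * (w / 2 * (algebraMap F E ϖ.val) ^ (j : ℤ)) * (1 + e) *
      (algebraMap F E ϖ.val) ^ (-j : ℤ) - w = w * e := by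
    have h3 := unif_ne_zero ϖ
    rw [zpow_neg]
    field_simp
    ring
  rw [h1, mul_comm, map_mul]
  exact mul_lt_one_of_lt_of_le he hw

lemma psiY_conj (p : E1 σ × E1 σ) (x : GL (Fin 2) E) :
    psiY ψ y (diagE1 σ p * x * (diagE1 σ p)⁻¹) = psiY ψ y x := by
  rw [psiY, psiY, diagE1_conj_coe]
  simp

lemma cls_conj (p : E1 σ × E1 σ) {x : GL (Fin 2) E} (hx : x ∈ D1 σ ϖ (r - 1)) :
    cls ϖ j (diagE1 σ p * x * (diagE1 σ p)⁻¹) =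
      ((redHom σ (p.1 * p.2⁻¹) : 𝓀[E]ˣ) : 𝓀[E]) * cls ϖ j x := by
  rw [redHom_coe, cls, cls, ← red_mul (val_norm_one σ (p.1 * p.2⁻¹).2).le (H.val_cls_arg hx),
    diagE1_conj_coe]
  congr 1
  simp
  ring

end IsEvenDatum

end EvenDatum

/-! ### The groups generated by diagonal matrices and unit groups of the quaternion algebra -/

section Mixed

variable {F E : Type*} [Field F] [ValuativeRel F] [TopologicalSpace F]
  [IsNonarchimedeanLocalField F] [Field E] [ValuativeRel E] [TopologicalSpace E]
  [IsNonarchimedeanLocalField E] [Algebra F E] [ValuativeExtension F E]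
  [Algebra.IsQuadraticExtension F E] {σ : E ≃ₐ[F] E} {ϖ : UnramifiedUniformizer F E}

lemma torus_mul_mul_semi (a b : E1 σ) (x : GL (Fin 2) E) :
    torus σ a * x * semi σ b =
      diagE1 σ (a, a⁻¹ * b) * (diagE1 σ (1, b⁻¹) * x * (diagE1 σ (1, b⁻¹))⁻¹) := by
  have h1 : torus σ a = diagE1 σ (a, a⁻¹) := rfl
  have h2 : semi σ b = diagE1 σ (1, b) := rfl
  rw [h1, h2, ← map_inv, ← mul_assoc, ← mul_assoc, ← map_mul]
  simp

/-- The group `A D¹_k ⋊ B` in terms of all diagonal matrices with entries in `E¹`. -/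
lemma mem_mixed_iff {A B : Subgroup (E1 σ)} {k : ℕ} {g : GL (Fin 2) E} :
    g ∈ mixed σ ϖ A k B ↔
      ∃ p : E1 σ × E1 σ, p.1 ∈ A ∧ p.1 * p.2 ∈ B ∧ ∃ x ∈ D1 σ ϖ k, g = diagE1 σ p * x := by
  constructor
  · rintro ⟨a, ha, x, hx, b, hb, rfl⟩
    exact ⟨(a, a⁻¹ * b), ha, by simpa using hb, _, diagE1_conj_mem _ hx,
      torus_mul_mul_semi a b x⟩
  · rintro ⟨⟨a, c⟩, ha, hb, x, hx, rfl⟩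
    refine ⟨a, ha, diagE1 σ (1, a * c) * x * (diagE1 σ (1, a * c))⁻¹, diagE1_conj_mem _ hx,
      a * c, hb, ?_⟩
    rw [torus_mul_mul_semi, ← map_inv, ← map_inv]
    have h1 : diagE1 σ (1, (a * c)⁻¹) * (diagE1 σ (1, a * c) * x * diagE1 σ (1, a * c)⁻¹) *
        diagE1 σ (1, (a * c)⁻¹)⁻¹ = (diagE1 σ (1, (a * c)⁻¹) * diagE1 σ (1, a * c)) * x *
          (diagE1 σ (1, a * c)⁻¹ * diagE1 σ (1, (a * c)⁻¹)⁻¹) := by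
      simp only [mul_assoc]
    rw [h1, ← map_mul, ← map_mul]
    simp [Prod.mk_one_one]

lemma diagE1_det (p : E1 σ × E1 σ) :
    ((diagE1 σ p : GL (Fin 2) E) : Matrix (Fin 2) (Fin 2) E).det =
      ((p.1 * p.2 : E1 σ) : Eˣ) := by
  simp [diagE1]

lemma eq_inv_of_diagE1_mem_D1 {k : ℕ} {p : E1 σ × E1 σ} (hp : diagE1 σ p ∈ D1 σ ϖ k) :
    p = (p.1, p.1⁻¹) := by
  have h1 := hp.2.1
  rw [diagE1_det] at h1
  have h2 : p.1 * p.2 = 1 := Subtype.ext (Units.ext h1)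
  rw [← eq_inv_of_mul_eq_one_right h2]

lemma diagE1_mul_mem_mixed {A B : Subgroup (E1 σ)} {k : ℕ} {p : E1 σ × E1 σ} (h1 : p.1 ∈ A)
    (h2 : p.1 * p.2 ∈ B) {x : GL (Fin 2) E} (hx : x ∈ D1 σ ϖ k) :
    diagE1 σ p * x ∈ mixed σ ϖ A k B :=
  mem_mixed_iff.mpr ⟨p, h1, h2, x, hx, rfl⟩

/-- A homomorphism on the group of diagonal matrices and a homomorphism on `D¹_k` that are
compatible define a homomorphism on `E¹ D¹_k ⋊ E¹`. -/
lemma exists_mixedLift {M : Type*} [Monoid M] {k : ℕ} (T : E1 σ × E1 σ →* M)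
    (X : GL (Fin 2) E → M) (hX1 : X 1 = 1)
    (hX : ∀ x ∈ D1 σ ϖ k, ∀ x' ∈ D1 σ ϖ k, X (x * x') = X x * X x')
    (hTX : ∀ p, ∀ x ∈ D1 σ ϖ k, X (diagE1 σ p * x * (diagE1 σ p)⁻¹) * T p = T p * X x)
    (hint : ∀ a, diagE1 σ (a, a⁻¹) ∈ D1 σ ϖ k → X (diagE1 σ (a, a⁻¹)) = T (a, a⁻¹)) :
    ∃ f : mixed σ ϖ ⊤ k ⊤ →* M, ∀ p, ∀ x ∈ D1 σ ϖ k, ∀ hpx,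
      f ⟨diagE1 σ p * x, hpx⟩ = T p * X x := by
  have hdec : ∀ g : mixed σ ϖ ⊤ k ⊤, ∃ t : (E1 σ × E1 σ) × GL (Fin 2) E,
      t.2 ∈ D1 σ ϖ k ∧ (g : GL (Fin 2) E) = diagE1 σ t.1 * t.2 := fun g ↦ by
    obtain ⟨p, -, -, x, hx, h⟩ := mem_mixed_iff.mp g.2
    exact ⟨(p, x), hx, h⟩
  choose t ht htg using hdec
  have hwd : ∀ p x p' x', x ∈ D1 σ ϖ k → x' ∈ D1 σ ϖ k →
      diagE1 σ p * x = diagE1 σ p' * x' → T p * X x = T p' * X x' := by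
    intro p x p' x' hx hx' he
    have h1 : diagE1 σ (p'⁻¹ * p) = x' * x⁻¹ := by
      rw [map_mul, map_inv, inv_mul_eq_iff_eq_mul, ← mul_assoc, ← he, mul_inv_cancel_right]
    have h2 : diagE1 σ (p'⁻¹ * p) ∈ D1 σ ϖ k := h1 ▸ mul_mem hx' (inv_mem hx)
    have h3 := eq_inv_of_diagE1_mem_D1 h2
    have h4 : X (diagE1 σ (p'⁻¹ * p)) = T (p'⁻¹ * p) := by
      rw [h3] at h2 ⊢
      exact hint _ h2
    have h5 : p = p' * (p'⁻¹ * p) := by rw [mul_inv_cancel_left]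
    rw [h5, map_mul, ← h4, mul_assoc, ← hX _ h2 _ hx, h1, inv_mul_cancel_right]
  refine ⟨{ toFun := fun g ↦ T (t g).1 * X (t g).2, map_one' := ?_, map_mul' := ?_ }, ?_⟩
  · rw [hwd _ _ 1 1 (ht 1) (one_mem _) (by rw [← htg]; simp), map_one, hX1, one_mul]
  · intro g g'
    have h1 : ∀ p : E1 σ × E1 σ, ∀ x : GL (Fin 2) E, (diagE1 σ p)⁻¹ * x * diagE1 σ p =
        diagE1 σ p⁻¹ * x * (diagE1 σ p⁻¹)⁻¹ := fun p x ↦ by rw [map_inv, inv_inv]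
    have h2 : (diagE1 σ (t g').1)⁻¹ * (t g).2 * diagE1 σ (t g').1 ∈ D1 σ ϖ k := by
      rw [h1]; exact diagE1_conj_mem _ (ht g)
    have h3 := hTX (t g').1 _ h2
    rw [show diagE1 σ (t g').1 * ((diagE1 σ (t g').1)⁻¹ * (t g).2 * diagE1 σ (t g').1) *
      (diagE1 σ (t g').1)⁻¹ = (t g).2 by group] at h3
    rw [hwd _ _ ((t g).1 * (t g').1)
      ((diagE1 σ (t g').1)⁻¹ * (t g).2 * diagE1 σ (t g').1 * (t g').2) (ht _)
      (mul_mem h2 (ht g')), map_mul, hX _ h2 _ (ht g')]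
    · generalize (diagE1 σ (t g').1)⁻¹ * (t g).2 * diagE1 σ (t g').1 = u at h3
      rw [mul_assoc, ← mul_assoc (T (t g').1), ← h3]
      simp only [mul_assoc]
    · rw [← htg, Subgroup.coe_mul, htg g, htg g', map_mul]
      group
  · intro p x hx hpx
    exact hwd _ _ _ _ (ht _) hx (htg ⟨_, hpx⟩).symm

end Mixed

/-! ### The extension of the Heisenberg representation -/

section TauOne

variable {F E : Type*} [Field F] [ValuativeRel F] [TopologicalSpace F]
  [IsNonarchimedeanLocalField F] [Field E] [ValuativeRel E] [TopologicalSpace E]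
  [IsNonarchimedeanLocalField E] [Algebra F E] [ValuativeExtension F E]
  [Algebra.IsQuadraticExtension F E] {σ : E ≃ₐ[F] E} {ϖ : UnramifiedUniformizer F E}
  {ψ : AddChar F ℂ} {n r : ℕ} {β : Matrix (Fin 2) (Fin 2) E} {γ ζ : E1 σ →* ℂˣ}

/-- The residue field of `E` as a finite type. -/
noncomputable abbrev fintypeResidueField (E : Type*) [Field E] [ValuativeRel E] [TopologicalSpace E]
    [IsNonarchimedeanLocalField E] : Fintype 𝓀[E] := Fintype.ofFinite _

attribute [local instance] fintypeResidueField

/-- The value of `γ_(β,ζ)` at an element written as the product of a diagonal matrix and of an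
element of `D¹_r`. -/
lemma gammaChar_diag_mul (h : IsDatum σ ϖ ψ n r β γ ζ) (p : E1 σ × E1 σ) {x : GL (Fin 2) E}
    (hx : x ∈ D1 σ ϖ r) (hpx : diagE1 σ p * x ∈ mixed σ ϖ ⊤ r ⊤) :
    gammaChar h ⟨diagE1 σ p * x, hpx⟩ = γ p.1 * ζ (p.1 * p.2) * psi ψ β x := by
  have h1 : diagE1 σ p * x = torus σ p.1 * (diagE1 σ (1, p.1 * p.2) * x *
      (diagE1 σ (1, p.1 * p.2))⁻¹) * semi σ (p.1 * p.2) := by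
    have h2 : semi σ (p.1 * p.2) = diagE1 σ (1, p.1 * p.2) := rfl
    have h3 : torus σ p.1 = diagE1 σ (p.1, p.1⁻¹) := rfl
    rw [h2, h3, ← mul_assoc, inv_mul_cancel_right, ← mul_assoc, ← map_mul]
    simp
  have h4 := gammaFun_apply h ⟨diagE1 σ p * x, hpx⟩ (diagE1_conj_mem _ hx) h1
  rw [psi_conj h _ hx] at h4
  exact h4.trans (by ring)

namespace IsEvenDatum

variable {h : IsDatum σ ϖ ψ n r β γ ζ} {j : ℕ} {y : E} (H : IsEvenDatum h j y)
include H

lemma psiY_one : psiY ψ y 1 = 1 := by simp [psiY]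

lemma psiY_ne_zero {x : GL (Fin 2) E} (hx : x ∈ D1 σ ϖ (r - 1)) : psiY ψ y x ≠ 0 := by
  intro h0
  have h2 := H.psiY_mul hx (inv_mem hx)
  rw [h0, mul_inv_cancel, H.psiY_one, zero_mul, zero_mul] at h2
  exact one_ne_zero h2

lemma cls_one : cls ϖ j (1 : GL (Fin 2) E) = 0 := by
  rw [H.cls_eq_zero_iff (one_mem _)]; exact one_mem _

/-- A diagonal matrix in `D¹_(r-1)` is in `D¹_r`. -/
lemma diagE1_mem_pred {p : E1 σ × E1 σ} (hp : diagE1 σ p ∈ D1 σ ϖ (r - 1)) :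
    p.1 ∈ E11 σ ∧ p.1 * p.2 = 1 ∧ diagE1 σ p ∈ D1 σ ϖ r := by
  obtain ⟨h1, h2, h3, -⟩ := H.mem_D1_pred.mp hp
  refine ⟨?_, ?_, H.mem_D1_r.mpr ⟨h1, h2, h3, PE_zero_mem _⟩⟩
  · exact mem_PE_one.mp (PE_anti (j := 1) (by omega) h3)
  · have h4 := eq_inv_of_diagE1_mem_D1 hp
    rw [h4, mul_inv_cancel]

lemma mem_D1_pred_of_r {x : GL (Fin 2) E} (hx : x ∈ D1 σ ϖ r) : x ∈ D1 σ ϖ (r - 1) :=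
  D1_anti (Nat.sub_le r 1) hx

/-- Membership of the product of a diagonal matrix and of an element of `D¹_(r-1)` in a group
`A D¹_r ⋊ B`. -/
lemma diagE1_mul_mem_mixed_iff {A B : Subgroup (E1 σ)} (hA : E11 σ ≤ A) {p : E1 σ × E1 σ}
    {x : GL (Fin 2) E} (hx : x ∈ D1 σ ϖ (r - 1)) :
    diagE1 σ p * x ∈ mixed σ ϖ A r B ↔ p.1 ∈ A ∧ p.1 * p.2 ∈ B ∧ cls ϖ j x = 0 := by
  constructor
  · intro hm
    obtain ⟨p', h1, h2, x', hx', he⟩ := mem_mixed_iff.mp hm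
    have hx'p := H.mem_D1_pred_of_r hx'
    have h3 : diagE1 σ (p'⁻¹ * p) = x' * x⁻¹ := by
      rw [map_mul, map_inv, inv_mul_eq_iff_eq_mul, ← mul_assoc, ← he, mul_inv_cancel_right]
    obtain ⟨h4, h5, h6⟩ := H.diagE1_mem_pred
      (h3 ▸ mul_mem hx'p (inv_mem hx) : diagE1 σ (p'⁻¹ * p) ∈ D1 σ ϖ (r - 1))
    refine ⟨?_, ?_, ?_⟩
    · have := mul_mem h1 (hA h4)
      simpa using this
    · have h7 : p.1 * p.2 = p'.1 * p'.2 := by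
        have : (p'.1 * p'.2)⁻¹ * (p.1 * p.2) = 1 := by
          rw [← h5, mul_inv, mul_mul_mul_comm]; rfl
        exact (inv_mul_eq_one.mp this).symm
      rw [h7]; exact h2
    · rw [H.cls_eq_zero_iff hx]
      have h8 : x = (diagE1 σ (p'⁻¹ * p))⁻¹ * x' := by rw [h3]; group
      rw [h8]
      exact mul_mem (inv_mem h6) hx'
  · rintro ⟨h1, h2, h3⟩
    exact diagE1_mul_mem_mixed h1 h2 ((H.cls_eq_zero_iff hx).mp h3)

lemma psiY_eq_gamma {a : E1 σ} (ha : diagE1 σ (a, a⁻¹) ∈ D1 σ ϖ r) :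
    psiY ψ y (diagE1 σ (a, a⁻¹)) = γ a := by
  rw [← H.psi_eq_psiY ha]
  exact (h.gamma_eq a ha).symm

omit H in
/-- The representation `τ` of `E¹ D¹_(r-1) ⋊ E¹` is given by the operators `psiY x • e (cls x)` on
`D¹_(r-1)`, and by the operators `weil`, up to the scalars prescribed by `γ` and `ζ`, on the diagonal
matrices. -/
def IsWeilExtension {V : Type*} [AddCommGroup V] [Module ℂ V] (_ : IsEvenDatum h j y)
    (e : 𝓀[E] → Module.End ℂ V) (τ : Representation ℂ (mixed σ ϖ ⊤ (r - 1) ⊤) V) : Prop :=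
  ∀ p, ∀ x ∈ D1 σ ϖ (r - 1), ∀ hpx,
    τ ⟨diagE1 σ p * x, hpx⟩ = ((γ p.1 * ζ (p.1 * p.2) : ℂˣ) * psiY ψ y x : ℂ) •
      (IsWeyl.weil (resConj σ) e ((redHom σ (p.1 * p.2⁻¹) : 𝓀[E]ˣ) : 𝓀[E]) * e (cls ϖ j x))

/-- The representation of `E¹ D¹_(r-1) ⋊ E¹` attached to a Weyl system of dimension `q`: the
Heisenberg representation extended by means of the operators `weil`. -/
lemma exists_rep {V : Type*} [AddCommGroup V] [Module ℂ V] [FiniteDimensional ℂ V]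
    {e : 𝓀[E] → Module.End ℂ V} (he : IsWeyl (resConj σ) H.resChar e)
    (hV : Module.finrank ℂ V = Nat.card (fixedField (resConj σ))) :
    ∃ τ : Representation ℂ (mixed σ ϖ ⊤ (r - 1) ⊤) V, H.IsWeilExtension e τ := by
  have hodd := H.isOddCharacter
  let T : E1 σ × E1 σ →* Module.End ℂ V :=
    { toFun := fun p ↦ ((γ p.1 * ζ (p.1 * p.2) : ℂˣ) : ℂ) •
        he.weilHom hodd hV (redHom σ (p.1 * p.2⁻¹))
      map_one' := by simp
      map_mul' := fun p p' ↦ by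
        rw [smul_mul_smul_comm, ← map_mul, ← map_mul, ← Units.val_mul]
        congr 2
        · rw [Prod.fst_mul, Prod.snd_mul, mul_mul_mul_comm p.1, map_mul, map_mul, mul_mul_mul_comm]
        · rw [Prod.fst_mul, Prod.snd_mul, mul_inv, mul_mul_mul_comm] }
  let X : GL (Fin 2) E → Module.End ℂ V := fun x ↦ psiY ψ y x • e (cls ϖ j x)
  have hT : ∀ p, T p = ((γ p.1 * ζ (p.1 * p.2) : ℂˣ) : ℂ) • IsWeyl.weil (resConj σ) e
      ((redHom σ (p.1 * p.2⁻¹) : 𝓀[E]ˣ) : 𝓀[E]) := fun _ ↦ rfl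
  have hX : ∀ x, X x = psiY ψ y x • e (cls ϖ j x) := fun _ ↦ rfl
  have hTX : ∀ p, ∀ x ∈ D1 σ ϖ (r - 1),
      X (diagE1 σ p * x * (diagE1 σ p)⁻¹) * T p = T p * X x := by
    intro p x hx
    rw [hT, hX, hX, smul_mul_smul_comm, smul_mul_smul_comm, mul_comm (psiY ψ y _), H.psiY_conj, H.cls_conj p hx,
      he.weil_mul_apply hodd (redHom σ (p.1 * p.2⁻¹)).2]
  obtain ⟨f, hf⟩ := exists_mixedLift T X
    (by simp only [X]; rw [H.psiY_one, H.cls_one, he.apply_zero, one_smul])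
    (fun x hx x' hx' ↦ by
      simp only [X]
      rw [H.psiY_mul hx hx', H.cls_mul hx hx', smul_mul_smul_comm, he.mul, smul_smul])
    hTX
    (fun a ha ↦ by
      obtain ⟨h1, -, h2⟩ := H.diagE1_mem_pred ha
      rw [hT, hX]
      dsimp only
      rw [(H.cls_eq_zero_iff ha).mpr h2, he.apply_zero, H.psiY_eq_gamma h2, inv_inv, map_mul (redHom σ),
        redHom_eq_one_iff.mpr (show a ∈ E11 σ from h1)]
      simp [IsWeyl.weil_one])
  refine ⟨f, fun p x hx hpx ↦ (hf p x hx hpx).trans ?_⟩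
  rw [hT, hX, smul_mul_smul_comm]

end IsEvenDatum

end TauOne

/-! ### The character of the extension -/

section CharacterFormula

variable {F E : Type*} [Field F] [ValuativeRel F] [TopologicalSpace F]
  [IsNonarchimedeanLocalField F] [Field E] [ValuativeRel E] [TopologicalSpace E]
  [IsNonarchimedeanLocalField E] [Algebra F E] [ValuativeExtension F E]
  [Algebra.IsQuadraticExtension F E] {σ : E ≃ₐ[F] E} {ϖ : UnramifiedUniformizer F E}
  {ψ : AddChar F ℂ} {n r : ℕ} {β : Matrix (Fin 2) (Fin 2) E} {γ ζ : E1 σ →* ℂˣ}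

attribute [local instance] fintypeResidueField

lemma ker_redHom_mul_self :
    ((powMonoidHom 2).comp (redHom σ)).ker = E10 σ := by
  ext a
  rw [MonoidHom.mem_ker, mem_E10_iff, map_mul, ← pow_two]
  rfl

namespace IsEvenDatum

variable {h : IsDatum σ ϖ ψ n r β γ ζ} {j : ℕ} {y : E} (H : IsEvenDatum h j y)
include H

lemma index_E10 : 2 * (E10 σ).index = Nat.card (fixedField (resConj σ)) + 1 := by
  have hodd := H.isOddCharacter
  have h1 : ((powMonoidHom 2).comp (redHom σ)).range =
      (powMonoidHom 2 : normOne (resConj σ) →* normOne (resConj σ)).range := by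
    rw [MonoidHom.range_comp, MonoidHom.range_eq_top.mpr (redHom_surjective H.val_two_eq ϖ),
      ← MonoidHom.range_eq_map]
  rw [← ker_redHom_mul_self, Subgroup.index_ker, h1, ← Subgroup.index_ker, ← hodd.card_normOne,
    ← Subgroup.card_mul_index (powMonoidHom 2 : normOne (resConj σ) →* normOne (resConj σ)).ker]
  congr 1
  symm
  have hm1 : (-1 : 𝓀[E]ˣ) ∈ normOne (resConj σ) := by
    rw [mem_normOne]; simp
  have hne : (1 : normOne (resConj σ)) ≠ ⟨-1, hm1⟩ := by
    intro h0
    have h2 : (1 : 𝓀[E]) = -1 := congrArg (fun u : normOne (resConj σ) ↦ ((u : 𝓀[E]ˣ) : 𝓀[E])) h0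
    exact hodd.two_ne_zero (by linear_combination h2)
  have hset : ((powMonoidHom 2 : normOne (resConj σ) →* normOne (resConj σ)).ker :
      Set (normOne (resConj σ))) = {1, ⟨-1, hm1⟩} := by
    ext u
    rw [SetLike.mem_coe, MonoidHom.mem_ker]
    change u ^ 2 = 1 ↔ u = 1 ∨ u = ⟨-1, hm1⟩
    have h3 : u ^ 2 = 1 ↔ ((u : 𝓀[E]ˣ) : 𝓀[E]) ^ 2 = 1 := by
      rw [Subtype.ext_iff, Units.ext_iff]; rfl
    rw [h3, sq_eq_one_iff, Subtype.ext_iff, Subtype.ext_iff, Units.ext_iff, Units.ext_iff]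
    rfl
  rw [← SetLike.coe_sort_coe, hset, Nat.card_coe_set_eq, Set.ncard_pair hne]

lemma finite_quotient_E10 : Finite (E1 σ ⧸ E10 σ) := by
  have := H.index_E10
  have : (E10 σ).FiniteIndex := ⟨by omega⟩
  exact Subgroup.finite_quotient_of_finiteIndex

lemma cls_inv {t : GL (Fin 2) E} (ht : t ∈ D1 σ ϖ (r - 1)) :
    cls ϖ j t⁻¹ = -cls ϖ j t := by
  have h1 := H.cls_mul ht (inv_mem ht)
  rw [mul_inv_cancel, H.cls_one] at h1
  exact (neg_eq_of_add_eq_zero_right h1.symm).symm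

/-- Conjugation on `E¹ D¹_(r-1) ⋊ E¹` does not change the diagonal part. -/
lemma exists_conj_eq (a : E1 σ) {t x : GL (Fin 2) E} (p : E1 σ × E1 σ)
    (ht : t ∈ D1 σ ϖ (r - 1)) (hx : x ∈ D1 σ ϖ (r - 1)) :
    ∃ x' ∈ D1 σ ϖ (r - 1), torus σ a * t * (diagE1 σ p * x) * (torus σ a * t)⁻¹ =
      diagE1 σ p * x' ∧ cls ϖ j x' = ((redHom σ (a * a) : 𝓀[E]ˣ) : 𝓀[E]) *
        ((((redHom σ (p.1 * p.2⁻¹))⁻¹ : normOne (resConj σ)) : 𝓀[E]ˣ) * cls ϖ j t +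
          cls ϖ j x - cls ϖ j t) := by
  have h1 : diagE1 σ p⁻¹ * t * (diagE1 σ p⁻¹)⁻¹ ∈ D1 σ ϖ (r - 1) := diagE1_conj_mem _ ht
  have h2 := mul_mem (mul_mem h1 hx) (inv_mem ht)
  refine ⟨diagE1 σ (a, a⁻¹) * (diagE1 σ p⁻¹ * t * (diagE1 σ p⁻¹)⁻¹ * x * t⁻¹) *
    (diagE1 σ (a, a⁻¹))⁻¹, diagE1_conj_mem _ h2, ?_, ?_⟩
  · have h3 : torus σ a = diagE1 σ (a, a⁻¹) := rfl
    have h4 : diagE1 σ (a, a⁻¹) * diagE1 σ p = diagE1 σ p * diagE1 σ (a, a⁻¹) := by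
      rw [← map_mul, ← map_mul, mul_comm]
    rw [h3, map_inv, ← mul_assoc (diagE1 σ p), ← mul_assoc (diagE1 σ p), ← h4]
    group
  · rw [H.cls_conj _ h2, H.cls_mul (mul_mem h1 hx) (inv_mem ht), H.cls_mul h1 hx, H.cls_inv ht,
      H.cls_conj _ ht, inv_inv, sub_eq_add_neg, ← map_inv, mul_inv]
    rfl

end IsEvenDatum

/-- The restriction of `γ_(β,ζ)` to `A D¹_r ⋊ E¹_1`. -/
noncomputable abbrev gammaRes (h : IsDatum σ ϖ ψ n r β γ ζ) (A : Subgroup (E1 σ)) :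
    mixed σ ϖ A r (E11 σ) →* ℂ :=
  (gammaChar h).comp (Subgroup.inclusion (mixed_mono le_top le_rfl le_top))

namespace IsEvenDatum

variable {h : IsDatum σ ϖ ψ n r β γ ζ} {j : ℕ} {y : E} (H : IsEvenDatum h j y)
include H

lemma extendZero_gammaRes {A : Subgroup (E1 σ)} {p : E1 σ × E1 σ} (h1 : p.1 ∈ A)
    (h2 : p.1 * p.2 ∈ E11 σ) {x : GL (Fin 2) E} (hx : x ∈ D1 σ ϖ (r - 1))
    (hcls : cls ϖ j x = 0) :
    extendZero (gammaRes h A) (diagE1 σ p * x) =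
      ((γ p.1 * ζ (p.1 * p.2) : ℂˣ) : ℂ) * psiY ψ y x := by
  have hxr := (H.cls_eq_zero_iff hx).mp hcls
  rw [extendZero_of_mem _ (diagE1_mul_mem_mixed h1 h2 hxr), ← H.psi_eq_psiY hxr, Units.val_mul]
  exact gammaChar_diag_mul h p hxr _

lemma extendZero_gammaRes_eq_zero {A : Subgroup (E1 σ)} (hA : E11 σ ≤ A) {p : E1 σ × E1 σ}
    {x : GL (Fin 2) E} (hx : x ∈ D1 σ ϖ (r - 1)) (hcls : p.1 ∉ A ∨ cls ϖ j x ≠ 0) :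
    extendZero (gammaRes h A) (diagE1 σ p * x) = 0 := by
  apply extendZero_of_notMem
  rw [H.diagE1_mul_mem_mixed_iff hA hx]
  tauto

/-- The character induced from `E¹ D¹_r ⋊ E¹_1` as a sum over the residue field. -/
lemma indChar_top {t : 𝓀[E] → GL (Fin 2) E} (ht : ∀ z, t z ∈ D1 σ ϖ (r - 1))
    (htz : ∀ z, cls ϖ j (t z) = z) (g : mixed σ ϖ ⊤ (r - 1) (E11 σ)) :
    indChar h ⊤ g = ∑ z, extendZero (gammaRes h ⊤) (t z * g * (t z)⁻¹) := by
  have hm : ∀ z, t z ∈ mixed σ ϖ ⊤ (r - 1) (E11 σ) := fun z ↦ by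
    have := diagE1_mul_mem_mixed (p := 1) (A := ⊤) (B := E11 σ) (Subgroup.mem_top _)
      (by simp [one_mem]) (ht z)
    simpa using this
  refine character_ind (mixed_mono (A := ⊤) (k := r) (B := E11 σ) le_top (Nat.sub_le r 1) le_rfl)
    (gammaRes h ⊤) (fun z ↦ ⟨t z, hm z⟩) (fun k ↦ ?_) g
  obtain ⟨p, -, hp, x, hx, hk⟩ := mem_mixed_iff.mp k.2
  have key : ∀ z, (k : GL (Fin 2) E) * (t z)⁻¹ ∈ mixed σ ϖ ⊤ r (E11 σ) ↔ z = cls ϖ j x := by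
    intro z
    rw [hk, mul_assoc, H.diagE1_mul_mem_mixed_iff le_top (mul_mem hx (inv_mem (ht z))),
      H.cls_mul hx (inv_mem (ht z)), H.cls_inv (ht z), htz, ← sub_eq_add_neg, sub_eq_zero]
    exact ⟨fun h0 ↦ h0.2.2.symm, fun h0 ↦ ⟨Subgroup.mem_top _, hp, h0.symm⟩⟩
  exact ⟨cls ϖ j x, (key _).mpr rfl, fun z hz ↦ (key z).mp hz⟩

/-- The character induced from `E¹_0 D¹_r ⋊ E¹_1` as a sum over the residue field and
`E¹ / E¹_0`. -/
lemma indChar_E10 [Fintype (E1 σ ⧸ E10 σ)] {t : 𝓀[E] → GL (Fin 2) E}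
    (ht : ∀ z, t z ∈ D1 σ ϖ (r - 1))
    (htz : ∀ z, cls ϖ j (t z) = z) (g : mixed σ ϖ ⊤ (r - 1) (E11 σ)) :
    indChar h (E10 σ) g = ∑ i : 𝓀[E] × (E1 σ ⧸ E10 σ), extendZero (gammaRes h (E10 σ))
      (torus σ i.2.out * t i.1 * g * (torus σ i.2.out * t i.1)⁻¹) := by
  have hm : ∀ i : 𝓀[E] × (E1 σ ⧸ E10 σ),
      torus σ i.2.out * t i.1 ∈ mixed σ ϖ ⊤ (r - 1) (E11 σ) := fun i ↦
    diagE1_mul_mem_mixed (p := (i.2.out, i.2.out⁻¹)) (A := ⊤) (B := E11 σ) (Subgroup.mem_top _)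
      (by simp [one_mem]) (ht i.1)
  refine character_ind (mixed_mono (A := E10 σ) (k := r) (B := E11 σ) le_top (Nat.sub_le r 1)
    le_rfl) (gammaRes h (E10 σ)) (fun i ↦ ⟨_, hm i⟩) (fun k ↦ ?_) g
  obtain ⟨p, -, hp, x, hx, hk⟩ := mem_mixed_iff.mp k.2
  have key : ∀ i : 𝓀[E] × (E1 σ ⧸ E10 σ), (k : GL (Fin 2) E) * (torus σ i.2.out * t i.1)⁻¹ ∈
      mixed σ ϖ (E10 σ) r (E11 σ) ↔ i = (cls ϖ j x, (p.1 : E1 σ ⧸ E10 σ)) := by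
    intro i
    have hxt := mul_mem hx (inv_mem (ht i.1))
    have h1 : (k : GL (Fin 2) E) * (torus σ i.2.out * t i.1)⁻¹ =
        diagE1 σ (p * (i.2.out, i.2.out⁻¹)⁻¹) * (diagE1 σ (i.2.out, i.2.out⁻¹) * (x * (t i.1)⁻¹) *
          (diagE1 σ (i.2.out, i.2.out⁻¹))⁻¹) := by
      have h2 : torus σ i.2.out = diagE1 σ (i.2.out, i.2.out⁻¹) := rfl
      rw [hk, h2, map_mul, map_inv]
      group
    rw [h1, H.diagE1_mul_mem_mixed_iff (E11_le_E10 σ) (diagE1_conj_mem _ hxt), H.cls_conj _ hxt,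
      H.cls_mul hx (inv_mem (ht _)), H.cls_inv (ht _), htz, ← sub_eq_add_neg, mul_eq_zero,
      or_iff_right (Units.ne_zero _), sub_eq_zero, Prod.ext_iff]
    have h3 : i.2 = (p.1 : E1 σ ⧸ E10 σ) ↔ p.1 * (i.2.out)⁻¹ ∈ E10 σ := by
      conv_lhs => rw [← Quotient.out_eq' i.2]
      change ((i.2.out : E1 σ) : E1 σ ⧸ E10 σ) = _ ↔ _
      rw [QuotientGroup.eq, mul_comm]
    rw [h3]
    have h4 : (p * (i.2.out, i.2.out⁻¹)⁻¹).1 * (p * (i.2.out, i.2.out⁻¹)⁻¹).2 = p.1 * p.2 := by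
      simp [mul_mul_mul_comm]
    rw [h4]
    exact ⟨fun h0 ↦ ⟨h0.2.2.symm, h0.1⟩, fun h0 ↦ ⟨h0.2, hp, h0.1.symm⟩⟩
  exact ⟨_, (key _).mpr rfl, fun z hz ↦ (key z).mp hz⟩

lemma redHom_div {p : E1 σ × E1 σ} (h2 : p.1 * p.2 ∈ E11 σ) :
    redHom σ (p.1 * p.2⁻¹) = redHom σ (p.1 * p.1) := by
  have h3 : p.1 * p.1 = (p.1 * p.2⁻¹) * (p.1 * p.2) := by
    rw [mul_mul_mul_comm, inv_mul_cancel, mul_one]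
  rw [h3, map_mul (redHom σ) (p.1 * p.2⁻¹), redHom_eq_one_iff.mpr h2, mul_one]

section Trace

variable {V : Type*} [AddCommGroup V] [Module ℂ V] [FiniteDimensional ℂ V]
  {e : 𝓀[E] → Module.End ℂ V} (he : IsWeyl (resConj σ) H.resChar e)
  (hV : Module.finrank ℂ V = Nat.card (fixedField (resConj σ)))
  {τ : Representation ℂ (mixed σ ϖ ⊤ (r - 1) ⊤) V}
  (hτ : H.IsWeilExtension e τ)
include he hV hτ

lemma trace_of_mem_E10 {p : E1 σ × E1 σ} (h1 : p.1 ∈ E10 σ) (h2 : p.1 * p.2 ∈ E11 σ)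
    {x : GL (Fin 2) E} (hx : x ∈ D1 σ ϖ (r - 1)) (hcls : cls ϖ j x = 0) (hpx) :
    LinearMap.trace ℂ V (τ ⟨diagE1 σ p * x, hpx⟩) = Nat.card (fixedField (resConj σ)) *
      (((γ p.1 * ζ (p.1 * p.2) : ℂˣ) : ℂ) * psiY ψ y x) := by
  rw [hτ p x hx, H.redHom_div h2, mem_E10_iff.mp h1, hcls, he.apply_zero]
  rw [show (((1 : normOne (resConj σ)) : 𝓀[E]ˣ) : 𝓀[E]) = 1 from rfl, IsWeyl.weil_one, mul_one,
    map_smul, LinearMap.trace_one, hV, smul_eq_mul, mul_comm]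

lemma trace_of_cls_ne_zero {p : E1 σ × E1 σ} (h1 : p.1 ∈ E10 σ) (h2 : p.1 * p.2 ∈ E11 σ)
    {x : GL (Fin 2) E} (hx : x ∈ D1 σ ϖ (r - 1)) (hcls : cls ϖ j x ≠ 0) (hpx) :
    LinearMap.trace ℂ V (τ ⟨diagE1 σ p * x, hpx⟩) = 0 := by
  rw [hτ p x hx, H.redHom_div h2, mem_E10_iff.mp h1,
    show (((1 : normOne (resConj σ)) : 𝓀[E]ˣ) : 𝓀[E]) = 1 from rfl, IsWeyl.weil_one, one_mul,
    map_smul, he.trace_eq_zero H.isOddCharacter hcls, smul_zero]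

lemma trace_of_notMem_E10 {p : E1 σ × E1 σ} (h1 : p.1 ∉ E10 σ) (h2 : p.1 * p.2 ∈ E11 σ)
    {x : GL (Fin 2) E} (hx : x ∈ D1 σ ϖ (r - 1)) (hcls : cls ϖ j x = 0) (hpx) :
    LinearMap.trace ℂ V (τ ⟨diagE1 σ p * x, hpx⟩) =
      -(((γ p.1 * ζ (p.1 * p.2) : ℂˣ) : ℂ) * psiY ψ y x) := by
  have h3 : ((redHom σ (p.1 * p.1) : 𝓀[E]ˣ) : 𝓀[E]) ≠ 1 := fun h0 ↦
    h1 (mem_E10_iff.mpr (Subtype.ext (Units.ext h0)))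
  rw [hτ p x hx, H.redHom_div h2, hcls, he.apply_zero, mul_one, map_smul,
    he.trace_weil H.isOddCharacter hV h3, smul_eq_mul, mul_neg_one]

/-- The character of the Heisenberg representation on `E¹ D¹_(r-1) ⋊ E¹_1`. -/
lemma character_eq (g : mixed σ ϖ ⊤ (r - 1) (E11 σ)) :
    τ.character (Subgroup.inclusion (mixed_mono le_rfl le_rfl le_top) g) =
      2 * (Nat.card (fixedField (resConj σ)) : ℂ)⁻¹ * indChar h (E10 σ) g - indChar h ⊤ g := by
  classical
  have hodd := H.isOddCharacter
  have hq0 : (Nat.card (fixedField (resConj σ)) : ℂ) ≠ 0 := by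
    have := IsOddCharacter.two_le_card_fixedField (resConj σ)
    exact_mod_cast (by omega : Nat.card (fixedField (resConj σ)) ≠ 0)
  have hfin := H.finite_quotient_E10
  have := Fintype.ofFinite (E1 σ ⧸ E10 σ)
  have hcardE : Fintype.card 𝓀[E] = Nat.card (fixedField (resConj σ)) ^ 2 := by
    rw [← hodd.card_eq, Nat.card_eq_fintype_card]
  have hidx : (2 : ℂ) * Fintype.card (E1 σ ⧸ E10 σ) = Nat.card (fixedField (resConj σ)) + 1 := by
    rw [← Nat.card_eq_fintype_card, ← Subgroup.index]
    exact_mod_cast H.index_E10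
  choose t ht htz using H.exists_cls_eq
  rw [H.indChar_top ht htz, H.indChar_E10 ht htz]
  obtain ⟨g, hg⟩ := g
  obtain ⟨p, -, hp, x, hx, rfl⟩ := mem_mixed_iff.mp hg
  have hpx : ∀ x ∈ D1 σ ϖ (r - 1), diagE1 σ p * x ∈ mixed σ ϖ ⊤ (r - 1) ⊤ := fun x hx ↦
    diagE1_mul_mem_mixed (Subgroup.mem_top _) (Subgroup.mem_top _) hx
  change LinearMap.trace ℂ V (τ ⟨diagE1 σ p * x, hpx x hx⟩) = _
  -- the character is constant on conjugacy classes
  have hcl : ∀ (a : E1 σ) (z : 𝓀[E]) (x' : GL (Fin 2) E) (hx' : x' ∈ D1 σ ϖ (r - 1)),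
      torus σ a * t z * (diagE1 σ p * x) * (torus σ a * t z)⁻¹ = diagE1 σ p * x' →
      LinearMap.trace ℂ V (τ ⟨diagE1 σ p * x', hpx x' hx'⟩) =
        LinearMap.trace ℂ V (τ ⟨diagE1 σ p * x, hpx x hx⟩) := by
    intro a z x' hx' he'
    have hs : torus σ a * t z ∈ mixed σ ϖ ⊤ (r - 1) ⊤ :=
      diagE1_mul_mem_mixed (p := (a, a⁻¹)) (Subgroup.mem_top _) (Subgroup.mem_top _) (ht z)
    have h1 : (⟨diagE1 σ p * x', hpx x' hx'⟩ : mixed σ ϖ ⊤ (r - 1) ⊤) =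
        ⟨_, hs⟩ * ⟨diagE1 σ p * x, hpx x hx⟩ * ⟨_, hs⟩⁻¹ := Subtype.ext he'.symm
    rw [h1]
    exact Representation.char_conj τ _ _
  set T := LinearMap.trace ℂ V (τ ⟨diagE1 σ p * x, hpx x hx⟩) with hT
  have htop : ∀ z, t z * (diagE1 σ p * x) * (t z)⁻¹ =
      torus σ (1 : E1 σ) * t z * (diagE1 σ p * x) * (torus σ 1 * t z)⁻¹ := fun z ↦ by simp
  by_cases h1 : p.1 ∈ E10 σ
  · have hu : redHom σ (p.1 * p.2⁻¹) = 1 := by rw [H.redHom_div hp, mem_E10_iff.mp h1]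
    by_cases h0 : cls ϖ j x = 0
    · have hval : ∀ {A : Subgroup (E1 σ)} (hA : p.1 ∈ A) (a : E1 σ) (z : 𝓀[E]),
          extendZero (gammaRes h A) (torus σ a * t z * (diagE1 σ p * x) * (torus σ a * t z)⁻¹) =
            (Nat.card (fixedField (resConj σ)) : ℂ)⁻¹ * T := by
        intro A hA a z
        obtain ⟨x', hx', he', hc⟩ := H.exists_conj_eq a p (ht z) hx
        have hc0 : cls ϖ j x' = 0 := by
          rw [hc, hu, h0, htz]; simp
        rw [he', H.extendZero_gammaRes hA hp hx' hc0, ← hcl a z x' hx' he',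
          H.trace_of_mem_E10 he hV hτ h1 hp hx' hc0, inv_mul_cancel_left₀ hq0]
      simp only [htop]
      rw [Finset.sum_congr rfl fun z _ ↦ hval (Subgroup.mem_top _) 1 z,
        Finset.sum_congr rfl fun i _ ↦ hval h1 i.2.out i.1]
      simp only [Finset.sum_const, Finset.card_univ, Fintype.card_prod, hcardE, nsmul_eq_mul]
      push_cast
      field_simp
      linear_combination (-T) * hidx
    · have hval : ∀ {A : Subgroup (E1 σ)} (hA : E11 σ ≤ A) (a : E1 σ) (z : 𝓀[E]),
          extendZero (gammaRes h A) (torus σ a * t z * (diagE1 σ p * x) * (torus σ a * t z)⁻¹) =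
            0 := by
        intro A hA a z
        obtain ⟨x', hx', he', hc⟩ := H.exists_conj_eq a p (ht z) hx
        rw [he']
        refine H.extendZero_gammaRes_eq_zero hA hx' (Or.inr ?_)
        rw [hc, hu, htz]
        simpa using h0
      simp only [htop]
      rw [Finset.sum_congr rfl fun z _ ↦ hval le_top 1 z,
        Finset.sum_congr rfl fun i _ ↦ hval (E11_le_E10 σ) i.2.out i.1, hT,
        H.trace_of_cls_ne_zero he hV hτ h1 hp hx h0]
      simp
  · have hg0 : ∀ i : 𝓀[E] × (E1 σ ⧸ E10 σ), extendZero (gammaRes h (E10 σ)) (torus σ i.2.out *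
        t i.1 * (diagE1 σ p * x) * (torus σ i.2.out * t i.1)⁻¹) = 0 := by
      intro i
      obtain ⟨x', hx', he', hc⟩ := H.exists_conj_eq i.2.out p (ht i.1) hx
      rw [he']
      exact H.extendZero_gammaRes_eq_zero (E11_le_E10 σ) hx' (Or.inl h1)
    rw [Finset.sum_congr rfl fun i _ ↦ hg0 i, Finset.sum_const_zero, mul_zero, zero_sub]
    have hu : (((redHom σ (p.1 * p.2⁻¹))⁻¹ : normOne (resConj σ)) : 𝓀[E]ˣ) - (1 : 𝓀[E]) ≠ 0 := by
      intro h3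
      apply h1
      rw [mem_E10_iff, ← H.redHom_div hp, ← inv_eq_one]
      exact Subtype.ext (Units.ext (sub_eq_zero.mp h3))
    -- a single conjugate of `g` by the representatives has class zero
    rw [Finset.sum_eq_single (-cls ϖ j x /
      ((((redHom σ (p.1 * p.2⁻¹))⁻¹ : normOne (resConj σ)) : 𝓀[E]ˣ) - (1 : 𝓀[E])))]
    · rw [htop]
      obtain ⟨x', hx', he', hc⟩ := H.exists_conj_eq 1 p (ht (-cls ϖ j x /
        ((((redHom σ (p.1 * p.2⁻¹))⁻¹ : normOne (resConj σ)) : 𝓀[E]ˣ) - (1 : 𝓀[E])))) hx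
      have hc0 : cls ϖ j x' = 0 := by
        rw [hc, htz, mul_eq_zero]
        right
        field_simp
        ring
      rw [he', H.extendZero_gammaRes (Subgroup.mem_top _) hp hx' hc0, ← hcl 1 _ x' hx' he',
        H.trace_of_notMem_E10 he hV hτ h1 hp hx' hc0]
    · intro z _ hz
      rw [htop]
      obtain ⟨x', hx', he', hc⟩ := H.exists_conj_eq 1 p (ht z) hx
      rw [he']
      refine H.extendZero_gammaRes_eq_zero le_top hx' (Or.inr fun h3 ↦ hz ?_)
      rw [hc, mul_eq_zero, or_iff_right (Units.ne_zero _), htz] at h3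
      rw [eq_div_iff hu]
      linear_combination h3
    · intro h3
      exact absurd (Finset.mem_univ _) h3

end Trace

end IsEvenDatum

end CharacterFormula

/-! ### The topology of the unitary group -/

section Topology

open Topology

variable {F E : Type*} [Field F] [ValuativeRel F] [TopologicalSpace F]
  [IsNonarchimedeanLocalField F] [Field E] [ValuativeRel E] [TopologicalSpace E]
  [IsNonarchimedeanLocalField E] [Algebra F E] [ValuativeExtension F E]
  [Algebra.IsQuadraticExtension F E] {σ : E ≃ₐ[F] E} {ϖ : UnramifiedUniformizer F E}

lemma ball_mem_nhds {c : ValueGroupWithZero E} (hc : c ≠ 0) :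
    {x : E | valuation E x < c} ∈ 𝓝 (0 : E) :=
  (IsValuativeTopology.hasBasis_nhds_zero' E).mem_of_mem hc

lemma t2Space (E : Type*) [Field E] [ValuativeRel E] [TopologicalSpace E]
    [IsNonarchimedeanLocalField E] : T2Space E :=
  IsTopologicalAddGroup.t2Space_of_zero_sep fun x hx ↦
    ⟨_, ball_mem_nhds ((valuation E).ne_zero_iff.mpr hx), fun h ↦
    lt_irrefl (valuation E x) h⟩

lemma PE_mem_nhds (ϖ : UnramifiedUniformizer F E) (k : ℤ) : PE ϖ k ∈ 𝓝 (0 : E) :=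
  Filter.mem_of_superset (ball_mem_nhds (zpow_ne_zero k (val_unif_pos ϖ).ne')) fun x hx ↦
    le_of_lt (show valuation E x < _ from hx)

lemma continuous_conj (σ : E ≃ₐ[F] E) : Continuous σ := by
  refine continuous_of_continuousAt_zero σ ?_
  rw [ContinuousAt, map_zero, ((IsValuativeTopology.hasBasis_nhds_zero' E).tendsto_iff
    (IsValuativeTopology.hasBasis_nhds_zero' E))]
  exact fun c hc ↦ ⟨c, hc, fun x hx ↦ (val_conj σ x).trans_lt hx⟩

/-- The decomposition of an element of `U(2)` according to `U(2) = D¹ ⋊ E¹`. -/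
lemma exists_U2_eq {g : GL (Fin 2) E} (hg : g ∈ U2 σ ϖ) : ∃ b : E1 σ,
    (g : Matrix (Fin 2) (Fin 2) E).det = ((b : Eˣ) : E) ∧
      g 0 0 * σ (g 0 0) - algebraMap F E ϖ.val * (g 0 1 * σ (g 0 1)) = 1 ∧
      ∃ x : GL (Fin 2) E, (x : Matrix (Fin 2) (Fin 2) E) ∈ quat σ ϖ ∧
        (x : Matrix (Fin 2) (Fin 2) E).det = 1 ∧ g = diagE1 σ (1, b) * x ∧
        x 0 0 = g 0 0 ∧ x 0 1 = g 0 1 := by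
  have hg' : (g : Matrix (Fin 2) (Fin 2) E) * !![1, 0; 0, -algebraMap F E ϖ.val] *
    ((g : Matrix (Fin 2) (Fin 2) E).map σ).transpose = !![1, 0; 0, -algebraMap F E ϖ.val] := hg
  have h00 := congrFun (congrFun hg' 0) 0
  have h01 := congrFun (congrFun hg' 0) 1
  have h10 := congrFun (congrFun hg' 1) 0
  have hd := congrArg Matrix.det hg'
  simp only [Matrix.mul_apply, Fin.sum_univ_two, Matrix.of_apply, Matrix.cons_val', Matrix.cons_val_zero,
    Matrix.cons_val_one, Matrix.cons_val_fin_one, mul_zero, zero_add, add_zero, mul_one,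
    Matrix.transpose_apply, Matrix.map_apply] at h00 h01 h10
  rw [Matrix.det_mul, Matrix.det_mul, Matrix.det_transpose, Matrix.det_fin_two_of,
    ← AlgEquiv.mapMatrix_apply, ← AlgEquiv.map_det] at hd
  have hϖ := unif_ne_zero ϖ
  have h1 : (g : Matrix (Fin 2) (Fin 2) E).det * σ (g : Matrix (Fin 2) (Fin 2) E).det = 1 := by
    apply mul_left_cancel₀ hϖ
    linear_combination -hd
  let b : E1 σ := ⟨Units.mk0 _ (left_ne_zero_of_mul_eq_one h1), h1⟩
  have hb : (((b : E1 σ) : Eˣ) : E) = g 0 0 * g 1 1 - g 0 1 * g 1 0 := Matrix.det_fin_two _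
  have hb0 : (((b : E1 σ) : Eˣ) : E) ≠ 0 := Units.ne_zero _
  have h11 : g 1 1 = ((b : Eˣ) : E) * σ (g 0 0) := by
    rw [hb]
    linear_combination (-g 1 1) * h00 + g 0 1 * h10
  have h10' : g 1 0 = ((b : Eˣ) : E) * (algebraMap F E ϖ.val * σ (g 0 1)) := by
    rw [hb]
    linear_combination (-g 1 0) * h00 + g 0 0 * h10
  refine ⟨b, rfl, by linear_combination h00, diagE1 σ (1, b⁻¹) * g, ⟨?_, ?_⟩, ?_, ?_, ?_, ?_⟩
  · simp [diagE1, Matrix.mul_apply, Fin.sum_univ_two, h11, hb0]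
  · simp [diagE1, Matrix.mul_apply, Fin.sum_univ_two, h10', hb0]
  · rw [Units.val_mul, Matrix.det_mul, diagE1_det, one_mul]
    change _ * (((b : E1 σ) : Eˣ) : E) = 1
    simp
  · rw [← mul_assoc, ← map_mul]
    simp [Prod.mk_one_one]
  · simp [diagE1, Matrix.mul_apply, Fin.sum_univ_two]
  · simp [diagE1, Matrix.mul_apply, Fin.sum_univ_two]

/-- The Hermitian form is anisotropic: the entries of norm one elements of `D` are integral. -/
lemma val_le_one_of_norm_eq_one {a c : E}
    (h : a * σ a - algebraMap F E ϖ.val * (c * σ c) = 1) :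
    valuation E a ≤ 1 ∧ valuation E c ≤ 1 := by
  have hϖ1 := val_unif_lt_one ϖ
  have hϖ0 := val_unif_pos ϖ
  set u := valuation E (algebraMap F E ϖ.val) with hu
  have h1 : valuation E (a * σ a) = valuation E a ^ 2 := by rw [map_mul, val_conj, pow_two]
  have h2 : valuation E (algebraMap F E ϖ.val * (c * σ c)) = u * valuation E c ^ 2 := by
    rw [map_mul, map_mul, val_conj, pow_two]
  -- `v(ϖ)` is not a square in the value group
  have hne : valuation E a ^ 2 = u * valuation E c ^ 2 → a = 0 := by
    intro h3
    by_contra ha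
    have ha' : valuation E a ≠ 0 := (valuation E).ne_zero_iff.mpr ha
    have hc' : valuation E c ≠ 0 := by
      intro h4
      rw [h4] at h3
      simp [ha'] at h3
    have h4 : valuation E (a / c) ^ 2 = u := by
      rw [map_div₀, div_pow, h3, mul_div_cancel_right₀ _ (pow_ne_zero 2 hc')]
    have h5 : valuation E (a / c) < 1 := by
      by_contra! h6
      exact absurd (one_le_pow₀ h6 (n := 2)) (not_le.mpr (h4 ▸ hϖ1))
    have h6 : valuation E (a / c) ≤ u := ϖ.le_ext _ h5
    have h7 : u ≤ u ^ 2 := by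
      conv_lhs => rw [← h4]
      exact pow_le_pow_left₀ zero_le h6 2
    have h8 : u ^ 2 < u := by
      rw [pow_two]; exact mul_lt_of_lt_one_left hϖ0 hϖ1
    exact absurd h7 (not_le.mpr h8)
  have ha : valuation E a ≤ 1 := by
    by_contra! h3
    have h4 : a * σ a = 1 + algebraMap F E ϖ.val * (c * σ c) := by linear_combination h
    have h5 : (1 : ValueGroupWithZero E) < valuation E a ^ 2 := one_lt_pow₀ h3 two_ne_zero
    have h6 : valuation E (algebraMap F E ϖ.val * (c * σ c)) = valuation E (a * σ a) := by
      have h7 : algebraMap F E ϖ.val * (c * σ c) = a * σ a - 1 := by linear_combination -h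
      rw [h7]
      refine Valuation.map_sub_eq_of_lt_left (valuation E) ?_
      rw [h1, map_one]
      exact h5
    rw [h1, h2] at h6
    rw [hne h6.symm, map_zero] at h3
    exact absurd h3 (not_lt.mpr zero_le)
  refine ⟨ha, ?_⟩
  by_contra! h3
  have h4 : valuation E (algebraMap F E ϖ.val * (c * σ c)) ≤ 1 := by
    have h7 : algebraMap F E ϖ.val * (c * σ c) = a * σ a - 1 := by linear_combination -h
    rw [h7]
    refine Valuation.map_sub_le (valuation E) ?_ (map_one (valuation E)).le
    rw [h1]
    exact pow_le_one₀ zero_le ha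
  have h5 : valuation E c⁻¹ ≤ u := ϖ.le_ext _ (by rw [map_inv₀]; exact inv_lt_one_of_one_lt₀ h3)
  have hc0 : 0 < valuation E c := zero_lt_one.trans h3
  have h6 : 1 ≤ u * valuation E c := by
    rw [map_inv₀] at h5
    calc (1 : ValueGroupWithZero E) = (valuation E c)⁻¹ * valuation E c :=
          (inv_mul_cancel₀ hc0.ne').symm
      _ ≤ _ := mul_le_mul_left h5 _
  rw [h2, pow_two, ← mul_assoc] at h4
  exact absurd h4 (not_le.mpr (one_lt_mul_of_le_of_lt h6 h3))

lemma U2_entry_integral {g : GL (Fin 2) E} (hg : g ∈ U2 σ ϖ) (i k : Fin 2) :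
    valuation E (g i k) ≤ 1 := by
  obtain ⟨b, -, hn, x, hx, -, hgx, h00, h01⟩ := exists_U2_eq hg
  obtain ⟨h1, h2⟩ := val_le_one_of_norm_eq_one hn
  have hb := val_norm_one σ b.2
  fin_cases i <;> fin_cases k
  · exact h1
  · exact h2
  · change valuation E (g 1 0) ≤ 1
    have h3 : g 1 0 = ((b : Eˣ) : E) * x 1 0 := by
      rw [hgx]; simp [diagE1, Matrix.mul_apply, Fin.sum_univ_two]
    rw [h3, hx.2, map_mul, map_mul, hb, one_mul, val_conj, h01]
    exact mul_le_one' (val_unif_lt_one ϖ).le h2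
  · change valuation E (g 1 1) ≤ 1
    have h3 : g 1 1 = ((b : Eˣ) : E) * x 1 1 := by
      rw [hgx]; simp [diagE1, Matrix.mul_apply, Fin.sum_univ_two]
    rw [h3, hx.1, map_mul, hb, one_mul, val_conj, h00]
    exact h1

lemma isClosed_U2 (σ : E ≃ₐ[F] E) (ϖ : UnramifiedUniformizer F E) :
    IsClosed (U2 σ ϖ : Set (GL (Fin 2) E)) := by
  have hT := t2Space E
  have h1 : Continuous fun g : GL (Fin 2) E ↦ (g : Matrix (Fin 2) (Fin 2) E) *
      !![1, 0; 0, -algebraMap F E ϖ.val] * ((g : Matrix (Fin 2) (Fin 2) E).map σ).transpose := by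
    have h2 : Continuous fun g : GL (Fin 2) E ↦ (g : Matrix (Fin 2) (Fin 2) E) :=
      Units.continuous_val
    exact (h2.mul continuous_const).mul ((h2.matrix_map (continuous_conj σ)).matrix_transpose)
  exact isClosed_singleton.preimage h1

lemma isCompact_U2 (σ : E ≃ₐ[F] E) (ϖ : UnramifiedUniformizer F E) :
    IsCompact (U2 σ ϖ : Set (GL (Fin 2) E)) := by
  let C : Set (Matrix (Fin 2) (Fin 2) E) :=
    Set.univ.pi fun _ ↦ Set.univ.pi fun _ ↦ {x : E | valuation E x ≤ 1}
  have hC : IsCompact C := isCompact_univ_pi fun _ ↦ isCompact_univ_pi fun _ ↦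
    IsNonarchimedeanLocalField.isCompact_closedBall E 1
  have hmem : ∀ g ∈ U2 σ ϖ, (g : Matrix (Fin 2) (Fin 2) E) ∈ C := fun g hg i _ k _ ↦
    U2_entry_integral hg i k
  have hK : IsCompact (C ×ˢ (MulOpposite.unop ⁻¹' C)) := by
    refine hC.prod ?_
    exact MulOpposite.opHomeomorph.symm.isCompact_preimage.mpr hC
  have hT := t2Space E
  have hT' : T2Space (Matrix (Fin 2) (Fin 2) E) := inferInstanceAs (T2Space (Fin 2 → Fin 2 → E))
  have hemb : IsClosedEmbedding (Units.embedProduct (Matrix (Fin 2) (Fin 2) E)) :=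
    Units.isClosedEmbedding_embedProduct
  refine (hemb.isCompact_preimage hK).of_isClosed_subset (isClosed_U2 σ ϖ) fun g hg ↦ ?_
  exact ⟨hmem g hg, hmem g⁻¹ (inv_mem hg)⟩

lemma eventually_entries (ϖ : UnramifiedUniformizer F E) (k : ℤ) :
    ∀ᶠ g : GL (Fin 2) E in 𝓝 1, g 0 0 - 1 ∈ PE ϖ k ∧ g 0 1 ∈ PE ϖ k := by
  have h2 : Continuous fun g : GL (Fin 2) E ↦ (g : Matrix (Fin 2) (Fin 2) E) :=
    Units.continuous_val
  have h3 : Continuous fun g : GL (Fin 2) E ↦ g 0 0 - 1 := (h2.matrix_elem 0 0).sub continuous_const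
  have h4 : Continuous fun g : GL (Fin 2) E ↦ g 0 1 := h2.matrix_elem 0 1
  refine Filter.Eventually.and ?_ ?_
  · exact h3.tendsto' 1 0 (by simp) (PE_mem_nhds ϖ k)
  · exact h4.tendsto' 1 0 (by simp) (PE_mem_nhds ϖ k)

lemma mem_D1_of_entries {k : ℕ} {x : GL (Fin 2) E}
    (hx : (x : Matrix (Fin 2) (Fin 2) E) ∈ quat σ ϖ)
    (hd : (x : Matrix (Fin 2) (Fin 2) E).det = 1) (h00 : x 0 0 - 1 ∈ PE ϖ (k + 1))
    (h01 : x 0 1 ∈ PE ϖ (k + 1)) : x ∈ D1 σ ϖ k :=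
  mem_D1.mpr ⟨hx, hd, PE_anti (by omega) h00, PE_anti (by omega) h01⟩

lemma isOpen_mixed (σ : E ≃ₐ[F] E) (ϖ : UnramifiedUniformizer F E) (k : ℕ) :
    IsOpen ((mixed σ ϖ ⊤ k ⊤).subgroupOf (U2 σ ϖ) : Set (U2 σ ϖ)) := by
  refine Subgroup.isOpen_of_mem_nhds _ (g := 1) ?_
  have h1 : ∀ᶠ g : U2 σ ϖ in 𝓝 1, (g : GL (Fin 2) E) 0 0 - 1 ∈ PE ϖ (k + 1) ∧
      (g : GL (Fin 2) E) 0 1 ∈ PE ϖ (k + 1) :=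
    (continuous_subtype_val.tendsto' (1 : U2 σ ϖ) 1 rfl).eventually (eventually_entries ϖ _)
  filter_upwards [h1] with g hg
  obtain ⟨b, -, -, x, hx, hd, hgx, h00, h01⟩ := exists_U2_eq g.2
  change (g : GL (Fin 2) E) ∈ mixed σ ϖ ⊤ k ⊤
  rw [hgx]
  exact diagE1_mul_mem_mixed (Subgroup.mem_top _) (Subgroup.mem_top _)
    (mem_D1_of_entries hx hd (h00 ▸ hg.1) (h01 ▸ hg.2))

lemma finite_quotient_mixed (σ : E ≃ₐ[F] E) (ϖ : UnramifiedUniformizer F E) (k : ℕ) :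
    Finite (U2 σ ϖ ⧸ (mixed σ ϖ ⊤ k ⊤).subgroupOf (U2 σ ϖ)) := by
  have : CompactSpace (U2 σ ϖ) := isCompact_iff_compactSpace.mp (isCompact_U2 σ ϖ)
  exact Subgroup.quotient_finite_of_isOpen _ (isOpen_mixed σ ϖ k)

lemma isCompact_mixed (σ : E ≃ₐ[F] E) (ϖ : UnramifiedUniformizer F E) (k : ℕ) :
    IsCompact (mixed σ ϖ ⊤ k ⊤ : Set (GL (Fin 2) E)) := by
  have : CompactSpace (U2 σ ϖ) := isCompact_iff_compactSpace.mp (isCompact_U2 σ ϖ)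
  have h1 : IsCompact ((mixed σ ϖ ⊤ k ⊤).subgroupOf (U2 σ ϖ) : Set (U2 σ ϖ)) :=
    (Subgroup.isClosed_of_isOpen _ (isOpen_mixed σ ϖ k)).isCompact
  have h2 := h1.image continuous_subtype_val
  rwa [show Subtype.val '' ((mixed σ ϖ ⊤ k ⊤).subgroupOf (U2 σ ϖ) : Set (U2 σ ϖ)) =
    (mixed σ ϖ ⊤ k ⊤ : Set (GL (Fin 2) E)) from ?_] at h2
  ext g
  constructor
  · rintro ⟨u, hu, rfl⟩
    exact hu
  · intro hg
    exact ⟨⟨g, mixed_le_U2 σ ϖ ⊤ k ⊤ hg⟩, hg, rfl⟩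

/-- A continuous character of `E¹` is trivial near `1`, since `ℂˣ` has no small subgroups. -/
lemma exists_ball_trivial {χ : E1 σ →* ℂˣ} (hχ : Continuous χ) :
    ∃ c : ValueGroupWithZero E, c ≠ 0 ∧
      ∀ b : E1 σ, valuation E (((b : Eˣ) : E) - 1) < c → χ b = 1 := by
  have h1 : ∀ᶠ b : E1 σ in 𝓝 1, ‖((χ b : ℂˣ) : ℂ) - 1‖ < 1 / 2 := by
    have h2 : Continuous fun b : E1 σ ↦ ‖((χ b : ℂˣ) : ℂ) - 1‖ :=
      ((Units.continuous_val.comp hχ).sub continuous_const).norm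
    exact h2.tendsto' 1 0 (by simp) (Iio_mem_nhds (by norm_num))
  have hind : IsInducing fun b : E1 σ ↦ ((b : Eˣ) : E) :=
    Units.isEmbedding_val₀.isInducing.comp IsInducing.subtypeVal
  rw [hind.nhds_eq_comap, Filter.eventually_comap] at h1
  have h3 : ∀ᶠ x : E in 𝓝 0, ∀ b : E1 σ, ((b : Eˣ) : E) = 1 + x →
      ‖((χ b : ℂˣ) : ℂ) - 1‖ < 1 / 2 := by
    have h4 : Filter.Tendsto (fun x : E ↦ 1 + x) (𝓝 0) (𝓝 (((1 : E1 σ) : Eˣ) : E)) :=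
      (continuous_const.add continuous_id).tendsto' 0 _ (by simp)
    exact h4.eventually h1
  obtain ⟨c, hc, hcb⟩ := (IsValuativeTopology.hasBasis_nhds_zero' E).mem_iff.mp h3
  refine ⟨c, hc, fun b hb ↦ Units.ext (eq_one_of_norm_pow_sub_one_lt fun m ↦ ?_)⟩
  have hm : valuation E (((b ^ m : E1 σ) : Eˣ) - 1 : E) < c := by
    induction m with
    | zero => simpa [zero_lt_iff] using hc
    | succ m ih =>
      have h5 : (((b ^ (m + 1) : E1 σ) : Eˣ) : E) - 1 =
          ((b ^ m : E1 σ) : Eˣ) * (((b : Eˣ) : E) - 1) + ((((b ^ m : E1 σ) : Eˣ) : E) - 1) := by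
        rw [pow_succ, Subgroup.coe_mul, Units.val_mul]; ring
      rw [h5]
      refine Valuation.map_add_lt _ ?_ ih
      rw [map_mul, val_norm_one σ (b ^ m).2, one_mul]
      exact hb
  have h6 := hcb hm (b ^ m) (by ring)
  rwa [map_pow, Units.val_pow_eq_pow_val] at h6

end Topology

/-! ### Existence -/

section Existence

open Topology

variable {F E : Type*} [Field F] [ValuativeRel F] [TopologicalSpace F]
  [IsNonarchimedeanLocalField F] [Field E] [ValuativeRel E] [TopologicalSpace E]
  [IsNonarchimedeanLocalField E] [Algebra F E] [ValuativeExtension F E]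
  [Algebra.IsQuadraticExtension F E] {σ : E ≃ₐ[F] E} {ϖ : UnramifiedUniformizer F E}
  {ψ : AddChar F ℂ} {n r : ℕ} {β : Matrix (Fin 2) (Fin 2) E} {γ ζ : E1 σ →* ℂˣ}

attribute [local instance] fintypeResidueField

lemma D1_le_mixed {A B : Subgroup (E1 σ)} {k : ℕ} {x : GL (Fin 2) E} (hx : x ∈ D1 σ ϖ k) :
    x ∈ mixed σ ϖ A k B := by
  have := diagE1_mul_mem_mixed (p := 1) (A := A) (B := B) (one_mem _) (by simp [one_mem]) hx
  simpa using this

namespace IsEvenDatum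

variable {h : IsDatum σ ϖ ψ n r β γ ζ} {j : ℕ} {y : E} (H : IsEvenDatum h j y)
include H

lemma card_residueField_eq : Nat.card 𝓀[F] = Nat.card (fixedField (resConj σ)) :=
  card_residueField h.conj_ne_one H.val_two_eq

lemma psiY_eq_one {x : GL (Fin 2) E} (hx : x 0 0 - 1 ∈ PE ϖ (2 * j + 2)) : psiY ψ y x = 1 := by
  rw [psiY, h.psi_trace_eq_one]
  rw [← mem_PE_one (ϖ := ϖ)]
  exact PE_anti (by omega) (PE_mul H.y_mem_PE hx)

section

variable {V : Type*} [AddCommGroup V] [Module ℂ V] [FiniteDimensional ℂ V]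
  {e : 𝓀[E] → Module.End ℂ V} (he : IsWeyl (resConj σ) H.resChar e)
  (hV : Module.finrank ℂ V = Nat.card (fixedField (resConj σ)))
  {τ : Representation ℂ (mixed σ ϖ ⊤ (r - 1) ⊤) V}
  (hτ : H.IsWeilExtension e τ)
include he hτ

lemma apply_D1 {x : GL (Fin 2) E} (hx : x ∈ D1 σ ϖ (r - 1)) :
    τ ⟨x, D1_le_mixed hx⟩ = psiY ψ y x • e (cls ϖ j x) := by
  have h1 := hτ 1 x hx (by rw [map_one, one_mul]; exact D1_le_mixed hx)
  simpa [IsWeyl.weil_one] using h1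

lemma apply_semi (b : E1 σ) :
    τ ⟨semi σ b, mem_mixed_semi ⊤ (r - 1) (Subgroup.mem_top b)⟩ =
      (ζ b : ℂ) • IsWeyl.weil (resConj σ) e ((redHom σ b⁻¹ : 𝓀[E]ˣ) : 𝓀[E]) := by
  have h1 := hτ (1, b) 1 (one_mem _) (by
    rw [mul_one]; exact mem_mixed_semi ⊤ (r - 1) (Subgroup.mem_top b))
  rw [H.cls_one, he.apply_zero, H.psiY_one] at h1
  simp only [mul_one, map_one, one_mul] at h1
  exact h1

include hV

lemma isIrreducible : τ.IsIrreducible := by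
  have hq := IsOddCharacter.two_le_card_fixedField (resConj σ)
  have : Nontrivial V := Module.nontrivial_of_finrank_pos (R := ℂ) (by omega)
  refine
    { exists_pair_ne := ⟨⊥, ⊤, fun h0 ↦ ?_⟩
      eq_bot_or_eq_top := fun W ↦ ?_ }
  · exact bot_ne_top (α := Submodule ℂ V) (congrArg Subrepresentation.toSubmodule h0)
  · have hW : ∀ c, ∀ v ∈ W.toSubmodule, e c v ∈ W.toSubmodule := by
      intro c v hv
      obtain ⟨x, hx, rfl⟩ := H.exists_cls_eq c
      have h1 := W.apply_mem_toSubmodule ⟨x, D1_le_mixed hx⟩ hv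
      rw [H.apply_D1 he hτ hx, LinearMap.smul_apply] at h1
      exact (Submodule.smul_mem_iff _ (H.psiY_ne_zero hx)).mp h1
    rcases he.stable_eq_bot_or_top H.isOddCharacter hV _ hW with h1 | h1
    · exact Or.inl (Subrepresentation.toSubmodule_injective h1)
    · exact Or.inr (Subrepresentation.toSubmodule_injective h1)

lemma not_occurs {v : V}
    (hv : ∀ b : E1 σ, τ ⟨semi σ b, mem_mixed_semi ⊤ (r - 1) (Subgroup.mem_top b)⟩ v =
      (ζ b : ℂ) • v) : v = 0 := by
  refine he.eq_zero_of_weil_fixed H.isOddCharacter hV fun u ↦ ?_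
  obtain ⟨b, hb⟩ := redHom_surjective (σ := σ) H.val_two_eq ϖ u⁻¹
  have h1 := hv b
  rw [H.apply_semi he hτ, map_inv, hb, inv_inv, LinearMap.smul_apply] at h1
  exact smul_right_injective V (Units.ne_zero (ζ b)) h1

omit hV in
lemma isSmoothRep : IsSmoothRep τ := by
  have hker : IsOpen (τ.ker : Set (mixed σ ϖ ⊤ (r - 1) ⊤)) := by
    obtain ⟨c, hc, hζ⟩ := exists_ball_trivial h.zeta_continuous
    refine Subgroup.isOpen_of_mem_nhds _ (g := 1) ?_
    have h1 : ∀ᶠ g : mixed σ ϖ ⊤ (r - 1) ⊤ in 𝓝 1,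
        (g : GL (Fin 2) E) 0 0 - 1 ∈ PE ϖ (2 * j + 2) ∧
          (g : GL (Fin 2) E) 0 1 ∈ PE ϖ (2 * j + 2) :=
      (continuous_subtype_val.tendsto' (1 : mixed σ ϖ ⊤ (r - 1) ⊤) 1 rfl).eventually
        (eventually_entries ϖ _)
    have h2 : ∀ᶠ g : mixed σ ϖ ⊤ (r - 1) ⊤ in 𝓝 1,
        valuation E (((g : GL (Fin 2) E) : Matrix (Fin 2) (Fin 2) E).det - 1) < min 1 c := by
      have h3 : Continuous fun g : mixed σ ϖ ⊤ (r - 1) ⊤ ↦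
          ((g : GL (Fin 2) E) : Matrix (Fin 2) (Fin 2) E).det - 1 :=
        (Units.continuous_val.comp continuous_subtype_val).matrix_det.sub continuous_const
      refine h3.tendsto' 1 0 (by simp) (ball_mem_nhds ?_)
      rw [← zero_lt_iff] at hc ⊢
      exact lt_min zero_lt_one hc
    filter_upwards [h1, h2] with g hg hdet
    obtain ⟨g, hgm⟩ := g
    obtain ⟨b, hb, -, x, hx, hd, hgx, h00, h01⟩ := exists_U2_eq (mixed_le_U2 σ ϖ _ _ _ hgm)
    change _ ∈ τ.ker
    rw [MonoidHom.mem_ker]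
    have hr := H.r_eq_add
    have hxr : x ∈ D1 σ ϖ r := H.mem_D1_r.mpr
      ⟨hx, hd, PE_anti (by omega) (h00 ▸ hg.1), PE_anti (by omega) (h01 ▸ hg.2)⟩
    have hxp := H.mem_D1_pred_of_r hxr
    subst hgx
    change valuation E ((diagE1 σ (1, b) * x : GL (Fin 2) E).val.det - 1) < _ at hdet
    rw [hb] at hdet
    have hb1 : b ∈ E11 σ := lt_of_lt_of_le hdet (min_le_left _ _)
    rw [hτ _ x hxp, H.psiY_eq_one (h00 ▸ hg.1), (H.cls_eq_zero_iff hxp).mpr hxr, he.apply_zero,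
      one_mul, one_mul, hζ b (lt_of_lt_of_le hdet (min_le_right _ _)),
      redHom_eq_one_iff.mpr (inv_mem hb1)]
    simp [IsWeyl.weil_one]
  exact fun v ↦ ⟨τ.ker, hker, fun g hg ↦ by rw [MonoidHom.mem_ker.mp hg, Module.End.one_apply]⟩

end

/-- The existence of `τ¹`, together with its description by a Weyl system. -/
lemma exists_isTauOne : ∃ (e : 𝓀[E] → Module.End ℂ (Fin (Nat.card 𝓀[F]) → ℂ))
    (τ : Representation ℂ (mixed σ ϖ ⊤ (r - 1) ⊤) (Fin (Nat.card 𝓀[F]) → ℂ)),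
      IsWeyl (resConj σ) H.resChar e ∧ H.IsWeilExtension e τ ∧ IsTauOne h τ := by
  obtain ⟨e, he⟩ := exists_isWeyl H.isOddCharacter H.card_residueField_eq
  have hV : Module.finrank ℂ (Fin (Nat.card 𝓀[F]) → ℂ) = Nat.card (fixedField (resConj σ)) := by
    rw [Module.finrank_fin_fun, H.card_residueField_eq]
  obtain ⟨τ, hτ⟩ := H.exists_rep he hV
  refine ⟨e, τ, he, hτ, ⟨⟨H.isIrreducible he hV hτ, H.isSmoothRep he hτ, fun g ↦ ?_⟩,
    fun v hv ↦ H.not_occurs he hV hτ hv⟩⟩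
  rw [H.character_eq he hV hτ, H.card_residueField_eq]

end IsEvenDatum

end Existence

/-! ### Operators of finite order -/

section FiniteOrder

lemma IsSmoothRep.isOpen_ker {G V : Type*} [Group G] [TopologicalSpace G] [IsTopologicalGroup G]
    [AddCommGroup V] [Module ℂ V] [FiniteDimensional ℂ V] {τ : Representation ℂ G V}
    (hτ : IsSmoothRep τ) : IsOpen (τ.ker : Set G) := by
  choose U hU hUv using hτ
  let b := Module.finBasis ℂ V
  have h1 : IsOpen ((⨅ i, U (b i) : Subgroup G) : Set G) := by
    rw [Subgroup.coe_iInf]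
    exact isOpen_iInter_of_finite fun i ↦ hU (b i)
  refine Subgroup.isOpen_mono (fun g hg ↦ ?_) h1
  rw [MonoidHom.mem_ker]
  exact b.ext fun i ↦ hUv (b i) g (Subgroup.mem_iInf.mp hg i)

/-- The elements of a compact group act on a smooth representation of finite dimension by operators
of finite order. -/
lemma IsSmoothRep.exists_pow_eq_one {G V : Type*} [Group G] [TopologicalSpace G]
    [IsTopologicalGroup G] [CompactSpace G] [AddCommGroup V] [Module ℂ V] [FiniteDimensional ℂ V]
    {τ : Representation ℂ G V} (hτ : IsSmoothRep τ) (g : G) : ∃ N : ℕ, N ≠ 0 ∧ τ g ^ N = 1 := by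
  have hfin : Finite (G ⧸ τ.ker) := Subgroup.quotient_finite_of_isOpen _ hτ.isOpen_ker
  have hidx : τ.ker.index ≠ 0 := Nat.card_pos.ne'
  obtain ⟨N, hN, -, hgN⟩ := Subgroup.exists_pow_mem_of_index_ne_zero hidx g
  exact ⟨N, hN.ne', by rw [← map_pow]; exact MonoidHom.mem_ker.mp hgN⟩

/-- If two representations with the same character on the powers of `g` are finite on `g` and `g`
acts by a scalar in the first one, then `g` acts by the same scalar in the second one. -/
lemma eq_smul_one_of_trace_eq {G V V' : Type*} [Group G] [AddCommGroup V] [Module ℂ V]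
    [FiniteDimensional ℂ V] [AddCommGroup V'] [Module ℂ V'] [FiniteDimensional ℂ V']
    [Nontrivial V] (hV : Module.finrank ℂ V = Module.finrank ℂ V')
    {τ : Representation ℂ G V} {τ' : Representation ℂ G V'} {g : G}
    (htr : ∀ k : ℕ, τ.character (g ^ k) = τ'.character (g ^ k)) {N N' : ℕ} (hN : N ≠ 0)
    (hN' : N' ≠ 0) (hg : τ g ^ N = 1) (hg' : τ' g ^ N' = 1) {a : ℂ} (ha : τ g = a • 1) :
    τ' g = a • 1 := by
  have haN : a ^ (N * N') = 1 := by
    have h1 : (a ^ (N * N')) • (1 : Module.End ℂ V) = 1 := by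
      rw [← one_pow (M := Module.End ℂ V) (N * N'), ← smul_pow, ← ha, pow_mul, hg, one_pow, one_pow]
    obtain ⟨v, hv⟩ := exists_ne (0 : V)
    have h2 := LinearMap.congr_fun h1 v
    rw [LinearMap.smul_apply, Module.End.one_apply] at h2
    exact smul_left_injective ℂ hv (h2.trans (one_smul ℂ v).symm)
  have ha0 : a ≠ 0 := by
    rintro rfl
    rw [zero_pow (mul_ne_zero hN hN')] at haN
    exact zero_ne_one haN
  have h1 : a⁻¹ • τ' g = 1 := by
    refine eq_one_of_trace_pow (mul_ne_zero hN hN') ?_ fun k ↦ ?_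
    · rw [smul_pow, inv_pow, haN, mul_comm N N', pow_mul, hg', one_pow, inv_one, one_smul]
    · have h2 := htr k
      rw [Representation.character, Representation.character, map_pow τ, map_pow τ', ha, smul_pow,
        one_pow, map_smul, LinearMap.trace_one, hV] at h2
      rw [smul_pow, map_smul, ← h2, smul_smul, ← mul_pow, inv_mul_cancel₀ ha0, one_pow, one_smul]
  rw [← h1, smul_inv_smul₀ ha0]

end FiniteOrder

/-! ### Uniqueness -/

section Uniqueness

variable {F E : Type*} [Field F] [ValuativeRel F] [TopologicalSpace F]
  [IsNonarchimedeanLocalField F] [Field E] [ValuativeRel E] [TopologicalSpace E]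
  [IsNonarchimedeanLocalField E] [Algebra F E] [ValuativeExtension F E]
  [Algebra.IsQuadraticExtension F E] {σ : E ≃ₐ[F] E} {ϖ : UnramifiedUniformizer F E}
  {ψ : AddChar F ℂ} {n r : ℕ} {β : Matrix (Fin 2) (Fin 2) E} {γ ζ : E1 σ →* ℂˣ}

attribute [local instance] fintypeResidueField

namespace IsEvenDatum

variable {h : IsDatum σ ϖ ψ n r β γ ζ} {j : ℕ} {y : E} (H : IsEvenDatum h j y)
include H

section

variable {V V' : Type*} [AddCommGroup V] [Module ℂ V] [FiniteDimensional ℂ V]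
  [AddCommGroup V'] [Module ℂ V'] [FiniteDimensional ℂ V']
  {e : 𝓀[E] → Module.End ℂ V} (he : IsWeyl (resConj σ) H.resChar e)
  (hV : Module.finrank ℂ V = Nat.card (fixedField (resConj σ)))
  {τ : Representation ℂ (mixed σ ϖ ⊤ (r - 1) ⊤) V} (hτ : H.IsWeilExtension e τ)
include he hV hτ

/-- A smooth representation with the character of the Heisenberg representation is scalar on
`D¹_r`. -/
lemma apply_D1_of_character_eq (hV' : Module.finrank ℂ V' = Nat.card (fixedField (resConj σ)))
    {τ' : Representation ℂ (mixed σ ϖ ⊤ (r - 1) ⊤) V'} (hs : IsSmoothRep τ')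
    (hch : ∀ g : mixed σ ϖ ⊤ (r - 1) (E11 σ),
      τ.character (Subgroup.inclusion (mixed_mono le_rfl le_rfl le_top) g) =
        τ'.character (Subgroup.inclusion (mixed_mono le_rfl le_rfl le_top) g))
    {x : GL (Fin 2) E} (hx : x ∈ D1 σ ϖ r) :
    τ' ⟨x, D1_le_mixed (H.mem_D1_pred_of_r hx)⟩ = psiY ψ y x • 1 := by
  have hxp := H.mem_D1_pred_of_r hx
  have : CompactSpace (mixed σ ϖ ⊤ (r - 1) ⊤) :=
    isCompact_iff_compactSpace.mp (isCompact_mixed σ ϖ (r - 1))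
  have hq := IsOddCharacter.two_le_card_fixedField (resConj σ)
  have : Nontrivial V := Module.nontrivial_of_finrank_pos (R := ℂ) (by omega)
  obtain ⟨N, hN, hg⟩ := (H.isSmoothRep he hτ).exists_pow_eq_one ⟨x, D1_le_mixed hxp⟩
  obtain ⟨N', hN', hg'⟩ := hs.exists_pow_eq_one ⟨x, D1_le_mixed hxp⟩
  refine eq_smul_one_of_trace_eq (hV.trans hV'.symm) (fun k ↦ ?_) hN hN' hg hg' ?_
  · exact hch (⟨x, D1_le_mixed hxp⟩ ^ k)
  · rw [H.apply_D1 he hτ hxp, (H.cls_eq_zero_iff hxp).mpr hx, he.apply_zero]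

omit he hV hτ in
/-- A representation that is scalar on `D¹_r`, as prescribed by `psiY`, defines a Weyl system. -/
lemma exists_isWeyl_of_apply_D1 {τ' : Representation ℂ (mixed σ ϖ ⊤ (r - 1) ⊤) V'}
    (hD : ∀ x (hx : x ∈ D1 σ ϖ r), τ' ⟨x, D1_le_mixed (H.mem_D1_pred_of_r hx)⟩ = psiY ψ y x • 1) :
    ∃ e' : 𝓀[E] → Module.End ℂ V', IsWeyl (resConj σ) H.resChar e' ∧
      ∀ x (hx : x ∈ D1 σ ϖ (r - 1)), τ' ⟨x, D1_le_mixed hx⟩ = psiY ψ y x • e' (cls ϖ j x) := by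
  choose t ht htz using H.exists_cls_eq
  let e' : 𝓀[E] → Module.End ℂ V' := fun z ↦ (psiY ψ y (t z))⁻¹ • τ' ⟨t z, D1_le_mixed (ht z)⟩
  have hmul : ∀ x x' (hx : x ∈ D1 σ ϖ (r - 1)) (hx' : x' ∈ D1 σ ϖ (r - 1)),
      τ' ⟨x * x', D1_le_mixed (mul_mem hx hx')⟩ =
        τ' ⟨x, D1_le_mixed hx⟩ * τ' ⟨x', D1_le_mixed hx'⟩ := fun x x' hx hx' ↦
    map_mul τ' ⟨x, D1_le_mixed hx⟩ ⟨x', D1_le_mixed hx'⟩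
  have hx' : ∀ x (hx : x ∈ D1 σ ϖ (r - 1)),
      τ' ⟨x, D1_le_mixed hx⟩ = psiY ψ y x • e' (cls ϖ j x) := by
    intro x hx
    set z := cls ϖ j x with hz
    have h1 := mul_mem (inv_mem (ht z)) hx
    have h2 : (t z)⁻¹ * x ∈ D1 σ ϖ r := by
      rw [← H.cls_eq_zero_iff h1, H.cls_mul (inv_mem (ht z)) hx, H.cls_inv (ht z), htz, ← hz,
        neg_add_cancel]
    have h3 : x = t z * ((t z)⁻¹ * x) := by group
    have h4 : psiY ψ y x = psiY ψ y (t z) * psiY ψ y ((t z)⁻¹ * x) := by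
      conv_lhs => rw [h3, H.psiY_mul (ht z) h1, (H.cls_eq_zero_iff h1).mpr h2]
      simp
    have h5 : (⟨x, D1_le_mixed hx⟩ : mixed σ ϖ ⊤ (r - 1) ⊤) =
        ⟨t z * ((t z)⁻¹ * x), D1_le_mixed (mul_mem (ht z) h1)⟩ := Subtype.ext h3
    rw [h5, hmul _ _ (ht z) h1, hD _ h2, h4, mul_smul_comm, mul_one, smul_smul, mul_right_comm,
      mul_inv_cancel₀ (H.psiY_ne_zero (ht z)), one_mul]
  refine ⟨e', ⟨?_, fun c d ↦ ?_⟩, hx'⟩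
  · have h1 := hx' 1 (one_mem _)
    rw [H.psiY_one, H.cls_one, one_smul] at h1
    exact h1.symm.trans (map_one τ')
  · have h1 := hmul _ _ (ht c) (ht d)
    rw [hx' _ (mul_mem (ht c) (ht d)), hx' _ (ht c), hx' _ (ht d), H.psiY_mul (ht c) (ht d),
      H.cls_mul (ht c) (ht d), htz, htz, smul_mul_smul_comm, mul_smul] at h1
    exact (smul_right_injective _ (mul_ne_zero (H.psiY_ne_zero (ht c))
      (H.psiY_ne_zero (ht d))) h1).symm

/-- A representation with the restriction to `D¹_(r-1)` and with the character of the Heisenberg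
representation, in whose restriction to the semidirect factor `ζ` does not occur. -/
lemma eq_of_apply_D1_eq {τ' : Representation ℂ (mixed σ ϖ ⊤ (r - 1) ⊤) V}
    (hD : ∀ x (hx : x ∈ D1 σ ϖ (r - 1)), τ' ⟨x, D1_le_mixed hx⟩ = τ ⟨x, D1_le_mixed hx⟩)
    (hch : ∀ g : mixed σ ϖ ⊤ (r - 1) (E11 σ),
      τ.character (Subgroup.inclusion (mixed_mono le_rfl le_rfl le_top) g) =
        τ'.character (Subgroup.inclusion (mixed_mono le_rfl le_rfl le_top) g))
    (hocc : ∀ v : V, (∀ b : E1 σ, τ' ⟨semi σ b, mem_mixed_semi ⊤ (r - 1) (Subgroup.mem_top b)⟩ v =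
      (ζ b : ℂ) • v) → v = 0) : τ' = τ := by
  have hodd := H.isOddCharacter
  have hq := IsOddCharacter.two_le_card_fixedField (resConj σ)
  have hnt : Nontrivial V := Module.nontrivial_of_finrank_pos (R := ℂ) (by omega)
  have hdm : ∀ p, diagE1 σ p ∈ mixed σ ϖ ⊤ (r - 1) ⊤ := fun p ↦ by
    have := diagE1_mul_mem_mixed (p := p) (Subgroup.mem_top _) (Subgroup.mem_top _)
      (one_mem (D1 σ ϖ (r - 1)))
    rwa [mul_one] at this
  let d : E1 σ × E1 σ →* mixed σ ϖ ⊤ (r - 1) ⊤ := (diagE1 σ).codRestrict _ hdm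
  -- by Schur's lemma the two representations differ by a scalar on the diagonal matrices
  have hsc : ∀ p, ∃ a : ℂ, τ' (d p) = a • τ (d p) := by
    intro p
    obtain ⟨a, ha⟩ := he.exists_smul_of_commute hodd hV (T := τ' (d p) * τ (d p)⁻¹) (fun c ↦ by
      obtain ⟨x, hx, rfl⟩ := H.exists_cls_eq c
      have h1 : e (cls ϖ j x) = (psiY ψ y x)⁻¹ • τ ⟨x, D1_le_mixed hx⟩ := by
        rw [H.apply_D1 he hτ hx, inv_smul_smul₀ (H.psiY_ne_zero hx)]
      have hx' : (diagE1 σ p⁻¹ * x * (diagE1 σ p⁻¹)⁻¹) ∈ D1 σ ϖ (r - 1) := diagE1_conj_mem _ hx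
      have h2 : (⟨_, D1_le_mixed hx'⟩ : mixed σ ϖ ⊤ (r - 1) ⊤) =
          (d p)⁻¹ * ⟨x, D1_le_mixed hx⟩ * d p := by
        refine Subtype.ext ?_
        change diagE1 σ p⁻¹ * x * (diagE1 σ p⁻¹)⁻¹ = (diagE1 σ p)⁻¹ * x * diagE1 σ p
        rw [map_inv, inv_inv]
      have h3 : τ' (d p) * τ (d p)⁻¹ * τ ⟨x, D1_le_mixed hx⟩ =
          τ ⟨x, D1_le_mixed hx⟩ * (τ' (d p) * τ (d p)⁻¹) := by
        calc _ = τ' (d p) * τ ((d p)⁻¹ * ⟨x, D1_le_mixed hx⟩ * d p) * τ (d p)⁻¹ := by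
              rw [mul_assoc, mul_assoc, ← map_mul, ← map_mul]; congr 2; group
          _ = τ' (d p) * τ' ((d p)⁻¹ * ⟨x, D1_le_mixed hx⟩ * d p) * τ (d p)⁻¹ := by
              rw [← h2, hD _ hx']
          _ = τ' ⟨x, D1_le_mixed hx⟩ * τ' (d p) * τ (d p)⁻¹ := by
              rw [← map_mul, ← map_mul]; congr 2; group
          _ = _ := by rw [hD _ hx, mul_assoc]
      rw [h1, mul_smul_comm, smul_mul_assoc, h3])
    refine ⟨a, ?_⟩
    have h4 : τ' (d p) = τ' (d p) * τ (d p)⁻¹ * τ (d p) := by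
      rw [mul_assoc, ← map_mul, inv_mul_cancel, map_one, mul_one]
    rw [h4, ha, smul_mul_assoc, one_mul]
  choose a ha using hsc
  have hτ0 : ∀ p, τ (d p) ≠ 0 := fun p h0 ↦ by
    have h1 : τ (d p) * τ (d p)⁻¹ = 1 := by rw [← map_mul, mul_inv_cancel, map_one]
    rw [h0, zero_mul] at h1
    exact zero_ne_one h1
  have hainj : ∀ p (c : ℂ), τ' (d p) = c • τ (d p) → a p = c := fun p c hc ↦
    smul_left_injective ℂ (hτ0 p) ((ha p).symm.trans hc)
  let χ : E1 σ × E1 σ →* ℂ :=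
    { toFun := a
      map_one' := hainj _ _ (by simp)
      map_mul' := fun p p' ↦ hainj _ _ (by
        rw [map_mul, map_mul, map_mul, ha, ha, smul_mul_smul_comm]) }
  -- the scalar is `1` where the trace of the Heisenberg representation does not vanish
  have hχ1 : ∀ p : E1 σ × E1 σ, p.1 * p.2 ∈ E11 σ → χ p = 1 := by
    intro p hp
    refine hainj p 1 ?_
    have hm1 : diagE1 σ p ∈ mixed σ ϖ ⊤ (r - 1) (E11 σ) := by
      have := diagE1_mul_mem_mixed (p := p) (A := ⊤) (Subgroup.mem_top _) hp
        (one_mem (D1 σ ϖ (r - 1)))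
      rwa [mul_one] at this
    have h1 := hch ⟨_, hm1⟩
    change LinearMap.trace ℂ V (τ (d p)) = LinearMap.trace ℂ V (τ' (d p)) at h1
    have h2 : LinearMap.trace ℂ V (τ (d p)) ≠ 0 := by
      have h3 : diagE1 σ p * 1 ∈ mixed σ ϖ ⊤ (r - 1) ⊤ := by rw [mul_one]; exact hdm p
      have h4 : d p = ⟨diagE1 σ p * 1, h3⟩ := Subtype.ext (mul_one _).symm
      rw [h4]
      by_cases h5 : p.1 ∈ E10 σ
      · rw [H.trace_of_mem_E10 he hV hτ h5 hp (one_mem _) H.cls_one, H.psiY_one, mul_one]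
        refine mul_ne_zero ?_ (Units.ne_zero _)
        exact_mod_cast (by omega : Nat.card (fixedField (resConj σ)) ≠ 0)
      · rw [H.trace_of_notMem_E10 he hV hτ h5 hp (one_mem _) H.cls_one, H.psiY_one, mul_one]
        exact neg_ne_zero.mpr (Units.ne_zero _)
    rw [ha p, map_smul, smul_eq_mul] at h1
    have h6 : a p = 1 := mul_right_cancel₀ h2 (by rw [one_mul]; exact h1.symm)
    rw [ha p, h6]
  -- hence it is given by a character of the residual group of norm one elements
  let χ₂ : E1 σ →* ℂˣ := ((χ.comp (MonoidHom.prod 1 (MonoidHom.id _))).toHomUnits)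
  have hχ₂ : ∀ b, ((χ₂ b : ℂˣ) : ℂ) = a (1, b) := fun b ↦ rfl
  have hker : (redHom σ).ker ≤ χ₂.ker := fun b hb ↦ by
    rw [MonoidHom.mem_ker, redHom_eq_one_iff] at hb
    exact MonoidHom.mem_ker.mpr (Units.ext (hχ1 (1, b) (by simpa using hb)))
  let χ₃ : normOne (resConj σ) →* ℂˣ :=
    (redHom σ).liftOfSurjective (redHom_surjective H.val_two_eq ϖ) ⟨χ₂, hker⟩
  have hχ₃ : ∀ b, χ₃ (redHom σ b) = χ₂ b := fun b ↦
    MonoidHom.liftOfRightInverse_comp_apply _ _ _ ⟨χ₂, hker⟩ b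
  have hχ₃1 : χ₃ = 1 := by
    by_contra hne
    obtain ⟨v, hv, hvw⟩ := he.exists_weil_eigenvector hodd hV hne
    refine hv (hocc v fun b ↦ ?_)
    have h1 : τ' ⟨semi σ b, mem_mixed_semi ⊤ (r - 1) (Subgroup.mem_top b)⟩ =
        a (1, b) • τ ⟨semi σ b, mem_mixed_semi ⊤ (r - 1) (Subgroup.mem_top b)⟩ := ha (1, b)
    rw [h1, H.apply_semi he hτ, LinearMap.smul_apply, LinearMap.smul_apply, hvw, map_inv, map_inv,
      hχ₃, ← hχ₂, Units.val_inv_eq_inv_val, smul_smul, smul_smul]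
    congr 1
    field_simp
  have hall : ∀ p, τ' (d p) = τ (d p) := by
    intro p
    have h1 : χ p = 1 := by
      have h2 : p = (p.1, p.1⁻¹) * (1, p.1 * p.2) := by
        rw [Prod.mk_mul_mk, mul_one, inv_mul_cancel_left]
      rw [h2, map_mul, hχ1 (p.1, p.1⁻¹) (by simp [one_mem]), one_mul]
      change a (1, p.1 * p.2) = 1
      rw [← hχ₂, ← hχ₃, hχ₃1]
      rfl
    rw [ha p, show a p = 1 from h1, one_smul]
  refine MonoidHom.ext fun g ↦ ?_
  obtain ⟨g, hg⟩ := g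
  obtain ⟨p, -, -, x, hx, rfl⟩ := mem_mixed_iff.mp hg
  have h1 : (⟨diagE1 σ p * x, hg⟩ : mixed σ ϖ ⊤ (r - 1) ⊤) = d p * ⟨x, D1_le_mixed hx⟩ :=
    Subtype.ext rfl
  rw [h1, map_mul, map_mul, hall, hD _ hx]

end

/-- The uniqueness of `τ¹`. -/
lemma nonempty_equiv {e : 𝓀[E] → Module.End ℂ (Fin (Nat.card 𝓀[F]) → ℂ)}
    {τ : Representation ℂ (mixed σ ϖ ⊤ (r - 1) ⊤) (Fin (Nat.card 𝓀[F]) → ℂ)}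
    (he : IsWeyl (resConj σ) H.resChar e) (hτ : H.IsWeilExtension e τ) (hh : IsHeisenberg h τ)
    {τ' : Representation ℂ (mixed σ ϖ ⊤ (r - 1) ⊤) (Fin (Nat.card 𝓀[F]) → ℂ)}
    (hτ' : IsTauOne h τ') : Nonempty (τ.Equiv τ') := by
  have hV : Module.finrank ℂ (Fin (Nat.card 𝓀[F]) → ℂ) = Nat.card (fixedField (resConj σ)) := by
    rw [Module.finrank_fin_fun, H.card_residueField_eq]
  have hch : ∀ g : mixed σ ϖ ⊤ (r - 1) (E11 σ),
      τ.character (Subgroup.inclusion (mixed_mono le_rfl le_rfl le_top) g) =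
        τ'.character (Subgroup.inclusion (mixed_mono le_rfl le_rfl le_top) g) := fun g ↦ by
    rw [hh.character_eq, hτ'.character_eq]
  obtain ⟨e', he', hD'⟩ := H.exists_isWeyl_of_apply_D1 fun x hx ↦
    H.apply_D1_of_character_eq he hV hτ hV hτ'.smooth hch hx
  obtain ⟨P, hP⟩ := he.exists_equiv H.isOddCharacter he' hV hV
  let τ'' : Representation ℂ (mixed σ ϖ ⊤ (r - 1) ⊤) (Fin (Nat.card 𝓀[F]) → ℂ) :=
    (P.symm.conjRingEquiv : _ →* _).comp τ'
  have hτ'' : ∀ g v, τ'' g v = P.symm (τ' g (P v)) := fun g v ↦ rfl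
  have h1 : τ'' = τ := by
    refine H.eq_of_apply_D1_eq he hV hτ (fun x hx ↦ LinearMap.ext fun v ↦ ?_) (fun g ↦ ?_)
      (fun v hv ↦ ?_)
    · rw [hτ'', H.apply_D1 he hτ hx, hD' x hx, LinearMap.smul_apply, LinearMap.smul_apply, ← hP,
        map_smul, P.symm_apply_apply]
    · rw [hch g]
      exact (LinearMap.trace_conj' _ P.symm).symm
    · have h2 : P v = 0 := hτ'.not_occurs _ fun b ↦ by
        have h3 := congrArg P (hv b)
        rwa [hτ'', P.apply_symm_apply, map_smul] at h3
      simpa using h2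
  refine ⟨Representation.Equiv.mk P fun g ↦ LinearMap.ext fun v ↦ ?_⟩
  have h2 := hτ'' g v
  rw [h1] at h2
  change P (τ g v) = τ' g (P v)
  rw [h2, P.apply_symm_apply]

end IsEvenDatum

end Uniqueness

/-! ### Induction to the unitary group -/

section Induction

variable {F E : Type*} [Field F] [ValuativeRel F] [TopologicalSpace F]
  [IsNonarchimedeanLocalField F] [Field E] [ValuativeRel E] [TopologicalSpace E]
  [IsNonarchimedeanLocalField E] [Algebra F E] [ValuativeExtension F E]
  [Algebra.IsQuadraticExtension F E] {σ : E ≃ₐ[F] E} {ϖ : UnramifiedUniformizer F E}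
  {ψ : AddChar F ℂ} {n r : ℕ} {β : Matrix (Fin 2) (Fin 2) E} {γ ζ : E1 σ →* ℂˣ}

attribute [local instance] fintypeResidueField

/-- Every element of `U(2)` is a product of an element of `E¹` and of an element of `D¹`, and the
elements of `D¹` are integral. -/
lemma exists_eq_diagE1_mul {g : GL (Fin 2) E} (hg : g ∈ U2 σ ϖ) :
    ∃ b : E1 σ, ∃ x ∈ D1 σ ϖ 0, g = diagE1 σ (1, b) * x := by
  obtain ⟨b, -, hn, x, hx, hd, hgx, h00, h01⟩ := exists_U2_eq hg
  obtain ⟨h1, h2⟩ := val_le_one_of_norm_eq_one hn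
  refine ⟨b, x, mem_D1.mpr ⟨hx, hd, ?_, ?_⟩, hgx⟩
  · rw [h00]
    exact PE_sub (mem_PE_zero.mpr h1) (mem_PE_zero.mpr (map_one (valuation E)).le)
  · rw [h01]
    exact mem_PE_zero.mpr h2

lemma D1_zero_mem_PD {x : GL (Fin 2) E} (hx : x ∈ D1 σ ϖ 0) :
    (x : Matrix (Fin 2) (Fin 2) E) ∈ PD σ ϖ 0 := by
  have h1 : (1 : Matrix (Fin 2) (Fin 2) E) ∈ PD σ ϖ 0 := by
    rw [mem_PD]
    refine ⟨one_mem _, mem_PE_zero.mpr (by simp), mem_PE_zero.mpr (by simp)⟩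
  have h2 := PD_add hx.2.2 h1
  rwa [sub_add_cancel] at h2

lemma D1_conj_mem {k : ℕ} {x d : GL (Fin 2) E} (hx : x ∈ D1 σ ϖ 0) (hd : d ∈ D1 σ ϖ k) :
    x * d * x⁻¹ ∈ D1 σ ϖ k := by
  have h0 := mul_mem (mul_mem hx (D1_anti (Nat.zero_le k) hd)) (inv_mem hx)
  refine ⟨h0.1, h0.2.1, ?_⟩
  have h1 : ((x * d * x⁻¹ : GL (Fin 2) E) : Matrix (Fin 2) (Fin 2) E) - 1 =
      x * ((d : Matrix (Fin 2) (Fin 2) E) - 1) * (x⁻¹ : GL (Fin 2) E) := by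
    rw [mul_sub, sub_mul, mul_one, ← Units.val_mul, ← Units.val_mul, ← Units.val_mul,
      mul_inv_cancel, Units.val_one]
  rw [h1]
  have h2 := PD_mul (PD_mul (D1_zero_mem_PD hx) hd.2.2) (D1_zero_mem_PD (inv_mem hx))
  rwa [zero_add, add_zero] at h2

/-- `D¹_k` is normal in `U(2)`. -/
lemma U2_conj_mem {k : ℕ} {g d : GL (Fin 2) E} (hg : g ∈ U2 σ ϖ) (hd : d ∈ D1 σ ϖ k) :
    g * d * g⁻¹ ∈ D1 σ ϖ k := by
  obtain ⟨b, x, hx, rfl⟩ := exists_eq_diagE1_mul hg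
  have h1 := diagE1_conj_mem (1, b) (D1_conj_mem hx hd)
  rwa [show diagE1 σ (1, b) * x * d * (diagE1 σ (1, b) * x)⁻¹ =
    diagE1 σ (1, b) * (x * d * x⁻¹) * (diagE1 σ (1, b))⁻¹ by group]

lemma val_D1_zero_00 {x : GL (Fin 2) E} (hx : x ∈ D1 σ ϖ 0) : valuation E (x 0 0) = 1 := by
  have h1 := D1_det hx
  have hc : valuation E (x 0 1) ≤ 1 := mem_PE_zero.mp (mem_D1.mp hx).2.2.2
  have h2 : valuation E (algebraMap F E ϖ.val * (x 0 1 * σ (x 0 1))) < 1 := by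
    rw [map_mul, map_mul, val_conj]
    exact mul_lt_one_of_lt_of_le (val_unif_lt_one ϖ) (mul_le_one' hc hc)
  have h3 : x 0 0 * σ (x 0 0) = 1 + algebraMap F E ϖ.val * (x 0 1 * σ (x 0 1)) := by
    linear_combination h1
  have h4 : valuation E (x 0 0) ^ 2 = 1 := by
    have h5 := congrArg (valuation E) h3
    rwa [map_mul, val_conj, ← pow_two, Valuation.map_one_add_of_lt (v := valuation E) h2] at h5
  exact (pow_eq_one_iff.mp h4).resolve_right two_ne_zero

namespace IsEvenDatum

variable {h : IsDatum σ ϖ ψ n r β γ ζ} {j : ℕ} {y : E} (H : IsEvenDatum h j y)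
include H

/-- The elements `a + c δ` of `D¹` with `c` divisible by `ϖ ^ j` are in `E¹ D¹_(r-1)`. -/
lemma mem_mixed_of_entry {x : GL (Fin 2) E} (hx : x ∈ D1 σ ϖ 0) (hc : x 0 1 ∈ PE ϖ j) :
    x ∈ mixed σ ϖ ⊤ (r - 1) ⊤ := by
  have h1 := D1_det hx
  have h2 : x 0 0 * σ (x 0 0) - 1 ∈ PE ϖ (2 * j + 1) := by
    have h3 : x 0 0 * σ (x 0 0) - 1 = algebraMap F E ϖ.val * (x 0 1 * σ (x 0 1)) := by
      linear_combination h1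
    rw [h3]
    exact PE_anti (by omega) (PE_mul (unif_mem_PE ϖ) (PE_mul hc (PE_conj σ hc)))
  obtain ⟨b, hb⟩ := exists_normOne_near H.val_two_eq (by omega) h2
  have h4 : x = diagE1 σ (b, b⁻¹) * (diagE1 σ (b, b⁻¹)⁻¹ * x) := by
    rw [map_inv, mul_inv_cancel_left]
  rw [h4]
  refine diagE1_mul_mem_mixed (Subgroup.mem_top _) (Subgroup.mem_top _) ?_
  have h00 : (diagE1 σ (b, b⁻¹)⁻¹ * x) 0 0 = ((b : Eˣ) : E)⁻¹ * x 0 0 := by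
    simp [diagE1, Matrix.mul_apply, Fin.sum_univ_two]
  have h01 : (diagE1 σ (b, b⁻¹)⁻¹ * x) 0 1 = ((b : Eˣ) : E)⁻¹ * x 0 1 := by
    simp [diagE1, Matrix.mul_apply, Fin.sum_univ_two]
  have h10 : (diagE1 σ (b, b⁻¹)⁻¹ * x) 1 0 = ((b : Eˣ) : E) * x 1 0 := by
    simp [diagE1, Matrix.mul_apply, Fin.sum_univ_two]
  have h11 : (diagE1 σ (b, b⁻¹)⁻¹ * x) 1 1 = ((b : Eˣ) : E) * x 1 1 := by
    simp [diagE1, Matrix.mul_apply, Fin.sum_univ_two]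
  have hbv : ((b : Eˣ) : E)⁻¹ ∈ PE ϖ 0 := by
    rw [mem_PE_zero, map_inv₀, val_norm_one σ b.2, inv_one]
  refine H.mem_D1_pred.mpr ⟨⟨?_, ?_⟩, ?_, ?_, ?_⟩
  · rw [h00, h11, D1_entry_11 hx, map_mul, map_inv₀, E1_conj, inv_inv]
  · rw [h10, h01, D1_entry_10 hx, map_mul, map_inv₀, E1_conj, inv_inv]
    ring
  · rw [Units.val_mul, Matrix.det_mul, hx.2.1, diagE1_det]
    simp
  · have h5 : ((b : Eˣ) : E)⁻¹ * x 0 0 - 1 = ((b : Eˣ) : E)⁻¹ * (x 0 0 - (b : Eˣ)) := by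
      rw [mul_sub, inv_mul_cancel₀ (Units.ne_zero _)]
    rw [h00, h5]
    exact PE_anti (by omega) (PE_mul hbv hb)
  · rw [h01]
    have h6 := PE_mul hbv hc
    rwa [zero_add] at h6

/-- An element of `D¹` outside `E¹ D¹_(r-1)` does not stabilize the character of `D¹_r`. -/
lemma exists_psi_conj_ne {x : GL (Fin 2) E} (hx : x ∈ D1 σ ϖ 0) (hc : x 0 1 ∉ PE ϖ j) :
    ∃ d ∈ D1 σ ϖ r, psiY ψ y (x * d * x⁻¹) ≠ psiY ψ y d := by
  obtain ⟨t₀, ht₀, hψ⟩ := h.psi_ne_one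
  have h20 : (2 : E) ≠ 0 := by
    rw [← (valuation E).ne_zero_iff, H.val_two_eq]; exact one_ne_zero
  have h8 : valuation E (8 : E) = 1 := by
    rw [show (8 : E) = 2 ^ 3 by norm_num, map_pow, H.val_two_eq, one_pow]
  have h80 : (8 : E) ≠ 0 := by
    rw [← (valuation E).ne_zero_iff, h8]; exact one_ne_zero
  set m : E := y * algebraMap F E ϖ.val * (x 0 0 * σ (x 0 1)) with hm
  have hmv : valuation E (algebraMap F E ϖ.val) ^ (-(j + 1) : ℤ) ≤ valuation E m := by
    have h1 : valuation E (algebraMap F E ϖ.val) ^ (j - 1 : ℤ) ≤ valuation E (x 0 1) :=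
      le_val_of_notMem_PE (by rwa [sub_add_cancel])
    rw [hm, map_mul, map_mul, map_mul, H.val_y, val_D1_zero_00 hx, one_mul, val_conj]
    have h2 : (-(j + 1) : ℤ) = (-(2 * j + 1) + 1) + (j - 1) := by ring
    rw [h2, zpow_add₀ (val_unif_pos ϖ).ne', zpow_add₀ (val_unif_pos ϖ).ne', zpow_one]
    exact mul_le_mul_right h1 _
  have hm0 : m ≠ 0 := by
    rw [← (valuation E).ne_zero_iff, ← zero_lt_iff]
    exact (zpow_pos (val_unif_pos ϖ) _).trans_le hmv
  -- the `δ`-coordinate of the Cayley transform is `2 t (1 + e)`, and conjugation by `x` multiplies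
  -- the character by `ψ (- 4 Tr (m t (1 + e)))`; this is `ψ t₀` for the following `t`
  set t : E := -algebraMap F E t₀ / 8 / m with ht
  have htm : t ∈ PE ϖ (j + 1 : ℕ) := by
    have h1 : m⁻¹ ∈ PE ϖ (j + 1 : ℕ) := by
      have := inv_mem_PE hmv
      push_cast
      rwa [neg_neg] at this
    have h2 : -algebraMap F E t₀ / 8 ∈ PE ϖ 0 := by
      rw [mem_PE_zero, map_div₀, h8, div_one, Valuation.map_neg]
      exact (val_le_one_iff t₀).mpr ht₀
    have h3 := PE_mul h2 h1
    rwa [zero_add, ← div_eq_mul_inv] at h3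
  obtain ⟨d, hd, hd0, e, he, hev, hde⟩ := exists_cayley (σ := σ) H.val_two_eq htm
  have hr := H.r_eq_add
  refine ⟨d, D1_anti (by omega) hd, ?_⟩
  have hxd : (x * d * x⁻¹) 0 0 = d 0 0 + algebraMap F E ϖ.val *
      (σ (x 0 0 * σ (x 0 1) * d 0 1) - x 0 0 * σ (x 0 1) * d 0 1) := by
    have h1 : x * d * x⁻¹ * x = x * d := by group
    have h00 := D1_mul_00 (x * d * x⁻¹) hx
    have h01 := D1_mul_01 (x * d * x⁻¹) hx
    rw [h1] at h00 h01
    rw [D1_mul_00 x hd] at h00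
    rw [D1_mul_01 x hd, hd0] at h01
    have h2 := D1_det hx
    simp only [map_mul, conj_conj]
    linear_combination (-(x * d * x⁻¹) 0 0 + d 0 0) * h2 - σ (x 0 0) * h00 +
      algebraMap F E ϖ.val * σ (x 0 1) * h01
  have hkey : psiY ψ y (x * d * x⁻¹) = ψ t₀ * psiY ψ y d := by
    rw [psiY, psiY, hxd]
    have h1 : y * (d 0 0 + algebraMap F E ϖ.val * (σ (x 0 0 * σ (x 0 1) * d 0 1) -
        x 0 0 * σ (x 0 1) * d 0 1) - 1) =
        -(m * d 0 1 + σ (m * d 0 1)) + y * (d 0 0 - 1) := by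
      simp only [hm, map_mul, conj_conj, H.conj_y, AlgEquiv.commutes]
      ring
    have h2 : m * d 0 1 = -algebraMap F E (t₀ / 4) + -algebraMap F E t₀ / 4 * e := by
      have h40 : (4 : E) ≠ 0 := by
        rw [show (4 : E) = 2 ^ 2 by norm_num]; exact pow_ne_zero 2 h20
      rw [hde, ht, map_div₀, map_ofNat]
      field_simp
      ring
    have h4 : valuation E (-algebraMap F E t₀ / 4 * e) < 1 := by
      have h44 : valuation E (4 : E) = 1 := by
        rw [show (4 : E) = 2 ^ 2 by norm_num, map_pow, H.val_two_eq, one_pow]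
      rw [mul_comm, map_mul, map_div₀, h44, div_one, Valuation.map_neg]
      exact mul_lt_one_of_lt_of_le hev ((val_le_one_iff t₀).mpr ht₀)
    have h4F : (4 : F) ≠ 0 := fun h0 ↦ by
      have h6 := congrArg (algebraMap F E) h0
      rw [map_ofNat, map_zero, show (4 : E) = 2 ^ 2 by norm_num] at h6
      exact pow_ne_zero 2 h20 h6
    have h5 : Algebra.trace F E (-(m * d 0 1 + σ (m * d 0 1))) =
        t₀ + Algebra.trace F E (-(-algebraMap F E t₀ / 4 * e + -algebraMap F E t₀ / 4 * e)) := by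
      rw [map_neg, map_add, h.trace_conj, h2, map_add, map_neg, Algebra.trace_algebraMap,
        Algebra.IsQuadraticExtension.finrank_eq_two F E, map_neg, map_add, nsmul_eq_mul]
      push_cast
      field_simp
      ring
    rw [h1, map_add, AddChar.map_add_eq_mul, h5, AddChar.map_add_eq_mul, h.psi_trace_eq_one,
      mul_one]
    rw [Valuation.map_neg]
    exact Valuation.map_add_lt _ h4 h4
  rw [hkey]
  intro h0
  have h1 : psiY ψ y d ≠ 0 := H.psiY_ne_zero (D1_anti (by omega) hd)
  exact hψ (mul_right_cancel₀ h1 (h0.trans (one_mul _).symm))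

/-- The stabilizer in `U(2)` of the character `ψ_β` of `D¹_r` is contained in
`E¹ D¹_(r-1) ⋊ E¹`. -/
lemma exists_psi_conj_ne_of_notMem {g : GL (Fin 2) E} (hg : g ∈ U2 σ ϖ)
    (hgJ : g ∉ mixed σ ϖ ⊤ (r - 1) ⊤) :
    ∃ d ∈ D1 σ ϖ r, psi ψ β (g * d * g⁻¹ : GL (Fin 2) E) ≠ psi ψ β d := by
  obtain ⟨b, x, hx, rfl⟩ := exists_eq_diagE1_mul hg
  have hc : x 0 1 ∉ PE ϖ j := fun hc ↦ hgJ (mul_mem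
    (mem_mixed_semi ⊤ (r - 1) (Subgroup.mem_top b)) (H.mem_mixed_of_entry hx hc))
  obtain ⟨d, hd, hne⟩ := H.exists_psi_conj_ne hx hc
  refine ⟨d, hd, ?_⟩
  have hxd := D1_conj_mem hx hd
  rwa [show diagE1 σ (1, b) * x * d * (diagE1 σ (1, b) * x)⁻¹ =
    diagE1 σ (1, b) * (x * d * x⁻¹) * (diagE1 σ (1, b))⁻¹ by group, psi_conj h _ hxd,
    H.psi_eq_psiY hxd, H.psi_eq_psiY hd]

/-- The representation of `U(2)` induced from a Heisenberg representation. -/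
lemma isSmoothRep_and_isIrreducible_ind
    {τ : Representation ℂ (mixed σ ϖ ⊤ (r - 1) ⊤) (Fin (Nat.card 𝓀[F]) → ℂ)}
    (hτ : IsHeisenberg h τ) : IsSmoothRep (ind (mixed_le_U2 σ ϖ ⊤ (r - 1) ⊤) τ) ∧
      (ind (mixed_le_U2 σ ϖ ⊤ (r - 1) ⊤) τ).IsIrreducible := by
  have hfin := finite_quotient_mixed σ ϖ (r - 1)
  have hfin' : Finite (Quotient (QuotientGroup.rightRel
      ((mixed σ ϖ ⊤ (r - 1) ⊤).subgroupOf (U2 σ ϖ)))) :=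
    Finite.of_equiv _ (QuotientGroup.quotientRightRelEquivQuotientLeftRel _).symm
  refine ⟨isSmoothRep_ind _ τ hτ.smooth (isOpen_mixed σ ϖ (r - 1)), ?_⟩
  have hV : Module.finrank ℂ (Fin (Nat.card 𝓀[F]) → ℂ) = Nat.card (fixedField (resConj σ)) := by
    rw [Module.finrank_fin_fun, H.card_residueField_eq]
  obtain ⟨e, τ₀, he, hτ₀, h₀⟩ := H.exists_isTauOne
  refine isIrreducible_ind _ τ hτ.irreducible (D1 σ ϖ r : Set (GL (Fin 2) E))
    (fun d hd ↦ D1_le_mixed (H.mem_D1_pred_of_r hd)) (fun k hk d hd ↦ U2_conj_mem hk hd)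
    (fun x ↦ psi ψ β x) (fun d hd v ↦ ?_) (fun k hk hkJ ↦ H.exists_psi_conj_ne_of_notMem hk hkJ)
  rw [H.apply_D1_of_character_eq he hV hτ₀ hV hτ.smooth
    (fun g ↦ by rw [h₀.character_eq, hτ.character_eq]) hd, H.psi_eq_psiY hd,
    LinearMap.smul_apply, Module.End.one_apply]

end IsEvenDatum

end Induction

end HeisenbergU2

theorem mainTheorem9 {F E : Type*} [Field F] [ValuativeRel F] [TopologicalSpace F]
    [IsNonarchimedeanLocalField F] [Field E] [ValuativeRel E] [TopologicalSpace E]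
    [IsNonarchimedeanLocalField E] [Algebra F E] [ValuativeExtension F E]
    [Algebra.IsQuadraticExtension F E] (hp : ringChar 𝓀[F] ≠ 2)
    (σ : E ≃ₐ[F] E) (ϖ : HeisenbergU2.UnramifiedUniformizer F E) (ψ : AddChar F ℂ) (n r : ℕ)
    (β : Matrix (Fin 2) (Fin 2) E) (γ ζ : HeisenbergU2.E1 σ →* ℂˣ)
    (h : HeisenbergU2.IsDatum σ ϖ ψ n r β γ ζ) (hn : Even n) (hr : Even r) :
    (∃ τ, HeisenbergU2.IsTauOne h τ ∧
      ∀ τ', HeisenbergU2.IsTauOne h τ' → Nonempty (τ.Equiv τ')) ∧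
    ∀ τ, HeisenbergU2.IsHeisenberg h τ →
      HeisenbergU2.IsSmoothRep
        (HeisenbergU2.ind (HeisenbergU2.mixed_le_U2 σ ϖ ⊤ (r - 1) ⊤) τ) ∧
      (HeisenbergU2.ind (HeisenbergU2.mixed_le_U2 σ ϖ ⊤ (r - 1) ⊤) τ).IsIrreducible := by
  obtain ⟨j, y, H⟩ := HeisenbergU2.exists_isEvenDatum hp h hn hr
  obtain ⟨e, τ, he, hτ, hτ1⟩ := H.exists_isTauOne
  exact ⟨⟨τ, hτ1, fun τ' hτ' ↦ H.nonempty_equiv he hτ hτ1.toIsHeisenberg hτ'⟩,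
    fun τ hτ ↦ H.isSmoothRep_and_isIrreducible_ind hτ⟩
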